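/- **Machine.** A randomized real RAM has two unbounded random-access memories, one with natural-number cells (indices, control) and one with real cells. Its unit-cost instructions are: natural constants, $+$, truncated $-$, $\times$ on naturals; conversion of a natural number to a real; exact $+,-,\times,/$ on reals (division by $0$ returns $0$); loads and stores with direct and indirect addressing; branching on $\le$ between two naturals or two reals; and drawing a fresh independent sample from $\mathcal N(0,1)$ or from the uniform distribution on $[0,1]$. A program is a finite list of such instructions with jumps. **Algorithms and hardness.** A program solves a (promise) problem in time $T$ with failure probability at most $\eta$ if on every input of size $n$, whether or not the promise holds, and for every random outcome it halts within $T(n)$ steps, and on every input of size $n$ satisfying the promise its output is incorrect with probability at most $\eta(n)$. Write $g=\tilde\Omega(f)$ if $g=\Omega(f/\log^d f)$ for some constant $d$. A problem is $\tilde\Omega(f)$-hard (with failure probability $\eta$) if every $T$ such that some program solves it in time $T$ with failure probability at most $\eta$ satisfies $T=\tilde\Omega(f)$. Let $\omega$ be the infimum of all $\tau$ such that $n\times n$ real matrices can be multiplied on the real RAM in time $O(n^\tau)$ (with failure probability at most $1/3$). **Rank-finding conjecture.** For some constant $C$, computing the rank of a matrix $A\in\mathbb R^{m\times n}$ with $m\le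 Cn$ with high probability (failure probability at most $1/n^{\log_2 n}$) is $\tilde\Omega(n^\omega)$-hard on the real RAM. (In particular this holds if the problem is $\Omega(n^\omega)$-hard.) **Corollary 4.2.** Assume the rank-finding conjecture. Let $c>0$ be a constant and let $\eta:\mathbb N\to\mathbb R$ satisfy $\eta(n)\le 1/3$ for all sufficiently large $n$. Then for every constant $C\ge 1$ the $(1-1/n^c)$-approximate linear search problem, "given $A\in\mathbb R^{m\times n}$ with $m\le Cn$ and $b\in\mathbb R^m$, with the promise that $Ax=b$ is satisfiable, find $x\in\mathbb R^n$ with $\|Ax-b\|_2\le(1-1/n^c)\|b\|_2$", is $\tilde\Omega(n^\omega)$-hard on the real RAM for randomized algorithms with failure probability at most $\eta$. Moreover, this remains true for the same problem restricted to square matrices $A\in\mathbb R^{n\times n}$ with the promise that $A$ has full rank. -/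

import Mathlib

open Filter Asymptotics MeasureTheory ProbabilityTheory

noncomputable section

namespace RealRAM

/-! ## The randomized real RAM

The machine has an unbounded random-access memory `N[0], N[1], …` of natural numbers (used for
indices and control) and an unbounded random-access memory `R[0], R[1], …` of real numbers.
Every instruction costs one step.  There is no rounding: real numbers influence the
natural-number memory only through the outcomes of comparisons. -/

/-- Contents of the two memories. -/
structure Memory where
  nat : ℕ → ℕ
  real : ℕ → ℝ

/-- The memory instructions. -/
inductive Op where
  /-- `N[a] := k` -/
  | natConst (a k : ℕ)
  /-- `N[a] := N[b] + N[c]` -/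
  | natAdd (a b c : ℕ)
  /-- `N[a] := max (N[b] - N[c]) 0` -/
  | natSub (a b c : ℕ)
  /-- `N[a] := N[b] * N[c]` -/
  | natMul (a b c : ℕ)
  /-- `N[a] := N[N[b]]` -/
  | natLoad (a b : ℕ)
  /-- `N[N[a]] := N[b]` -/
  | natStore (a b : ℕ)
  /-- `R[a] := N[b]` -/
  | realOfNat (a b : ℕ)
  /-- `R[a] := R[b] + R[c]` -/
  | realAdd (a b c : ℕ)
  /-- `R[a] := R[b] - R[c]` -/
  | realSub (a b c : ℕ)
  /-- `R[a] := R[b] * R[c]` -/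
  | realMul (a b c : ℕ)
  /-- `R[a] := R[b] / R[c]`; the machine returns `0` when `R[c] = 0`. -/
  | realDiv (a b c : ℕ)
  /-- `R[a] := R[N[b]]` -/
  | realLoad (a b : ℕ)
  /-- `R[N[a]] := R[b]` -/
  | realStore (a b : ℕ)
  /-- `R[a] :=` a fresh sample of the standard Gaussian distribution. -/
  | gauss (a : ℕ)
  /-- `R[a] :=` a fresh sample of the uniform distribution on `[0,1]`. -/
  | unif (a : ℕ)

/-- Effect of a memory instruction; `ξ` is the pair (Gaussian sample, uniform sample) that is
available in the current step. -/
def Op.eval (ξ : ℝ × ℝ) : Op → Memory → Memory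
  | .natConst a k, M => { M with nat := Function.update M.nat a k }
  | .natAdd a b c, M => { M with nat := Function.update M.nat a (M.nat b + M.nat c) }
  | .natSub a b c, M => { M with nat := Function.update M.nat a (M.nat b - M.nat c) }
  | .natMul a b c, M => { M with nat := Function.update M.nat a (M.nat b * M.nat c) }
  | .natLoad a b, M => { M with nat := Function.update M.nat a (M.nat (M.nat b)) }
  | .natStore a b, M => { M with nat := Function.update M.nat (M.nat a) (M.nat b) }
  | .realOfNat a b, M => { M with real := Function.update M.real a (M.nat b : ℝ) }
  | .realAdd a b c, M => { M with real := Function.update M.real a (M.real b + M.real c) }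
  | .realSub a b c, M => { M with real := Function.update M.real a (M.real b - M.real c) }
  | .realMul a b c, M => { M with real := Function.update M.real a (M.real b * M.real c) }
  | .realDiv a b c, M => { M with real := Function.update M.real a (M.real b / M.real c) }
  | .realLoad a b, M => { M with real := Function.update M.real a (M.real (M.nat b)) }
  | .realStore a b, M => { M with real := Function.update M.real (M.nat a) (M.real b) }
  | .gauss a, M => { M with real := Function.update M.real a ξ.1 }
  | .unif a, M => { M with real := Function.update M.real a ξ.2 }

/-- The comparisons a program can branch on. -/
inductive Test where
  /-- `N[a] ≤ N[b]` -/
  | natLe (a b : ℕ)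
  /-- `R[a] ≤ R[b]` -/
  | realLe (a b : ℕ)

/-- Outcome of a comparison. -/
def Test.holds : Test → Memory → Prop
  | .natLe a b, M => M.nat a ≤ M.nat b
  | .realLe a b, M => M.real a ≤ M.real b

/-- An instruction together with the label(s) of the instruction to be executed next;
`none` means that the machine halts. -/
inductive Instr (Label : Type) where
  | exec (o : Op) (next : Option Label)
  | branch (t : Test) (yes no : Option Label)

/-- A program: finitely many labelled instructions and a start label. -/
structure Program where
  Label : Type
  finite_label : Finite Label
  start : Label
  code : Label → Instr Label

/-- A configuration: the label of the next instruction (`none` once halted) and the memory. -/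
structure Config (Label : Type) where
  pc : Option Label
  mem : Memory

open Classical in
/-- One step of a program. A halted machine does not change any more. -/
def Program.step (P : Program) (ξ : ℝ × ℝ) (s : Config P.Label) : Config P.Label :=
  match s.pc with
  | none => s
  | some l =>
    match P.code l with
    | .exec o next => ⟨next, o.eval ξ s.mem⟩
    | .branch t yes no => ⟨if t.holds s.mem then yes else no, s.mem⟩

/-- A random outcome: for each time step the pair of samples available in that step. -/
abbrev Tape : Type := ℕ → ℝ × ℝ

/-- The samples of all the time steps are independent; in each pair the first component is
standard Gaussian, the second is uniform on `[0,1]`, and the two are independent. -/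
def tapeLaw : Measure Tape :=
  Measure.infinitePi fun _ : ℕ =>
    (gaussianReal 0 1).prod ((volume : Measure ℝ).restrict (Set.Icc 0 1))

instance : IsProbabilityMeasure ((volume : Measure ℝ).restrict (Set.Icc 0 1)) := ⟨by simp⟩

instance : IsProbabilityMeasure tapeLaw := by
  unfold tapeLaw
  infer_instance

/-- The configuration after `t` steps when started on the memory `M`. -/
def Program.run (P : Program) (M : Memory) (ξ : Tape) : ℕ → Config P.Label
  | 0 => ⟨some P.start, M⟩
  | t + 1 => P.step (ξ t) (P.run M ξ t)

/-! ## Problems, algorithms and hardness -/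

/-- A (promise) problem for the real RAM. -/
structure Problem where
  /-- the inputs -/
  Input : Type
  /-- the size parameter in which running times are measured -/
  size : Input → ℕ
  /-- the initial memory holding the input -/
  encode : Input → Memory
  /-- the inputs on which the output matters -/
  Promise : Input → Prop
  /-- the final memories that hold a correct output -/
  Correct : Input → Memory → Prop

/-- `P` is a randomized algorithm for `Q` with running time `T` and failure probability at most
`err`: on every input of size `n` and for every random outcome it halts within `T n` steps, and on
every input of size `n` that satisfies the promise the output is incorrect with probability at
most `err n`. -/
def Problem.SolvedBy (Q : Problem) (err : ℕ → ℝ) (P : Program) (T : ℕ → ℕ) : Prop :=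
  ∀ I : Q.Input,
    (∀ ξ : Tape, (P.run (Q.encode I) ξ (T (Q.size I))).pc = none) ∧
    (Q.Promise I →
      tapeLaw {ξ | ¬ Q.Correct I (P.run (Q.encode I) ξ (T (Q.size I))).mem} ≤
        ENNReal.ofReal (err (Q.size I)))

/-- `g = Ω̃(f)`, that is, `g = Ω(f / polylog(f))`. -/
def IsTildeOmega (g f : ℕ → ℝ) : Prop :=
  ∃ d : ℕ, (fun n => f n / Real.log (f n) ^ d) =O[atTop] g

/-- `Q` is `Ω̃(f)`-hard for randomized algorithms with failure probability at most `err`: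
the running time of every such algorithm is `Ω̃(f)`. -/
def Problem.TildeOmegaHard (Q : Problem) (err : ℕ → ℝ) (f : ℕ → ℝ) : Prop :=
  ∀ (P : Program) (T : ℕ → ℕ), Q.SolvedBy err P T → IsTildeOmega (fun n => (T n : ℝ)) f

/-! ## The problems -/

/-- The row-major list of the entries of a matrix, followed by zeros: entry `(i, j)` is at
position `n * i + j`. -/
def rowMajor {m n : ℕ} (A : Matrix (Fin m) (Fin n) ℝ) (k : ℕ) : ℝ :=
  if h : k < m * n then
    A (finProdFinEquiv.symm ⟨k, h⟩).1 (finProdFinEquiv.symm ⟨k, h⟩).2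
  else 0

/-- The entries of a vector, followed by zeros. -/
def vecList {m : ℕ} (b : Fin m → ℝ) (k : ℕ) : ℝ :=
  if h : k < m then b ⟨k, h⟩ else 0

/-- `N[0] = m`, `N[1] = n`, and all other cells of the natural-number memory are `0`. -/
def dims (m n : ℕ) (k : ℕ) : ℕ :=
  if k = 0 then m else if k = 1 then n else 0

/-- Multiplication of two `n × n` real matrices. -/
def matMul : Problem where
  Input := Σ n : ℕ, Matrix (Fin n) (Fin n) ℝ × Matrix (Fin n) (Fin n) ℝ
  size I := I.1
  encode I :=
    { nat := dims I.1 I.1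
      real := fun k =>
        if k < I.1 * I.1 then rowMajor I.2.1 k else rowMajor I.2.2 (k - I.1 * I.1) }
  Promise _ := True
  Correct I M := ∀ i j : Fin I.1, M.real (I.1 * i + j) = (I.2.1 * I.2.2) i j

/-- The matrix multiplication exponent: the infimum of the exponents `τ` for which `n × n` real
matrices can be multiplied in time `O(n ^ τ)`. -/
def omega : ℝ :=
  sInf {τ : ℝ | ∃ (P : Program) (T : ℕ → ℕ), matMul.SolvedBy (fun _ => 1 / 3) P T ∧
    (fun n => (T n : ℝ)) =O[atTop] fun n : ℕ => (n : ℝ) ^ τ}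

/-- A real matrix with `m ≤ C * n` rows and `n` columns. -/
structure MatrixInput (C : ℕ) where
  m : ℕ
  n : ℕ
  rows_le : m ≤ C * n
  A : Matrix (Fin m) (Fin n) ℝ

/-- Given a real `m × n` matrix with `m ≤ C * n`, find its rank (and leave it in `N[0]`). -/
def rankFinding (C : ℕ) : Problem where
  Input := MatrixInput C
  size I := I.n
  encode I := { nat := dims I.m I.n, real := rowMajor I.A }
  Promise _ := True
  Correct I M := M.nat 0 = I.A.rank

/-- The memory that holds a linear system: the dimensions, then the rows of `A`, then `b`. -/
def encodeSystem {m n : ℕ} (A : Matrix (Fin m) (Fin n) ℝ) (b : Fin m → ℝ) : Memory where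
  nat := dims m n
  real := fun k => if k < m * n then rowMajor A k else vecList b (k - m * n)

/-- `‖A x - b‖₂ ≤ ε ‖b‖₂` with Euclidean norms. -/
def IsApproxSolution {m n : ℕ} (ε : ℝ) (A : Matrix (Fin m) (Fin n) ℝ) (b : Fin m → ℝ)
    (x : Fin n → ℝ) : Prop :=
  ‖WithLp.toLp 2 (A.mulVec x - b)‖ ≤ ε * ‖WithLp.toLp 2 b‖

/-- A linear system with `m ≤ C * n` equations in `n` unknowns. -/
structure SystemInput (C : ℕ) extends MatrixInput C where
  b : Fin m → ℝ

/-- The `ε(n)`-approximate linear search problem: given a satisfiable linear system with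
`m ≤ C * n` equations in `n` unknowns, find an `ε(n)`-approximate solution (and leave it in
`R[0], …, R[n-1]`). -/
def approxLinearSearch (C : ℕ) (ε : ℕ → ℝ) : Problem where
  Input := SystemInput C
  size I := I.n
  encode I := encodeSystem I.A I.b
  Promise I := ∃ x : Fin I.n → ℝ, I.A.mulVec x = I.b
  Correct I M := IsApproxSolution (ε I.n) I.A I.b fun j => M.real j

/-- The `ε(n)`-approximate linear search problem restricted to square matrices of full rank. -/
def approxLinearSearchSquareFullRank (ε : ℕ → ℝ) : Problem where
  Input := Σ n : ℕ, Matrix (Fin n) (Fin n) ℝ × (Fin n → ℝ)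
  size I := I.1
  encode I := encodeSystem I.2.1 I.2.2
  Promise I := I.2.1.rank = I.1
  Correct I M := IsApproxSolution (ε I.1) I.2.1 I.2.2 fun j => M.real j

/-- The rank-finding conjecture: for some constant `C`, finding the rank of real `m × n` matrices
with `m ≤ C * n` with high probability, i.e. probability `1 - 1 / n ^ log₂ n`, is
`Ω̃(n ^ ω)`-hard. -/
def RankFindingConjecture : Prop :=
  ∃ C : ℕ, (rankFinding C).TildeOmegaHard
    (fun n => 1 / (n : ℝ) ^ Real.logb 2 n) (fun n => (n : ℝ) ^ omega)

end RealRAM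

end

noncomputable section

namespace RealRAM

open scoped ENNReal

/-! Rank finding is reduced to approximate search on square systems of full rank. This restricted
problem suffices, because an algorithm for the general one also solves it
(`Problem.SolvedBy.square`).

Pad the input matrix by zeros to an `h × h` matrix `A` with `h` larger than its rank `ρ`. For `q ≤
h` consider the random `N × N` system with block rows `(A, U, 0, g)`, `(V, I, 0, g')`, `(0, 0, I,
g'')`, `(0, 0, 0, θ²)` and right-hand side `(0, 0, 0, θ²)`. Here `U` has `q` columns, `V` has `q`
rows, the entries of `U`, `V`, `g`, `g'`, `g''` are independent and uniform on `[0,1]`, and `θ` is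
smaller than every power of `1/N`. A candidate `x` is accepted if its residual in the first `N - 1`
equations has norm at most `θ²` and its last coordinate is at least `θ`.

If `ρ + q ≥ h`, some choice of `U`, `V` makes the Schur complement `A - U V` invertible. The
determinant is then a nonzero polynomial in the draws, so the system is almost surely invertible
(`Dat.prob_singular`), and every solution with relative error `1 - θ` is accepted
(`Dat.accept_of_isApproxSolution`). If `ρ + q < h`, some `u ≠ 0` annihilates the first `h` rows from
the left except for their last column `g`. With `max |uᵢ| = 1`, acceptance of any `x` at all forces
`|u · g| ≤ h θ`, which is unlikely because `u` does not depend on `g` (`Dat.prob_accept_le`). Wrong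
acceptance is thus rare whatever the search algorithm returns.

With `ell = ⌈log₂ N⌉`, repeating the trial `ell²` times lowers the error from `1/3` to about `3 ^
(-ell²)`, and a binary search of `ell` rounds over `q` finds `ρ` with total error below `1 / n ^
log₂ n` (`rankFinding_solvedBy`).

The running time is `polylog N * (N² + T N)`. The term `N²` is absorbed because every search
algorithm must touch a constant fraction of the matrix entries (`sq_sub_le_time`). Since `N = D n +
r + 1` with `D` fixed, the reduction is carried out for each residue class modulo `D`, and the
resulting bounds are combined (`isTildeOmega_of_residues`).

To make this a statement about machines, algorithms are written as structured commands for a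
register machine, analysed by weakest preconditions that bound both time and expected cost, and
compiled to the real RAM (`Cmd.Spec.toRam`, `Cmd.Spec.toProgram`). The given program is run as a
simulated subroutine (`Program.call_spec`). -/

/-! ## Structured programs -/

/-- The law of the pair of samples available in one step. -/
def sampleLaw : Measure (ℝ × ℝ) :=
  (gaussianReal 0 1).prod ((volume : Measure ℝ).restrict (Set.Icc 0 1))

instance : IsProbabilityMeasure sampleLaw := by
  unfold sampleLaw
  infer_instance

/-- Structured commands over atomic instructions `α` and tests `τ`. -/
inductive Cmd (α τ : Type) where
  | skip
  | op (a : α)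
  | seq (c d : Cmd α τ)
  | ite (t : τ) (c d : Cmd α τ)
  | loop (t : τ) (c : Cmd α τ)

/-- Interpretation of atomic instructions and tests on states `σ`; `pre` is a precondition that
has to be met when the instruction is executed. -/
structure Machine (α τ σ : Type) where
  ev : α → ℝ × ℝ → σ → σ
  pre : α → σ → Prop
  holds : τ → σ → Prop

/-- A continuation: `K s t p` says that what remains to be done from state `s` takes time at most
`t` and has cost at most `p` in expectation. -/
abbrev Cont (σ : Type) : Type := σ → ℕ → ℝ≥0∞ → Prop

/-- Monotonicity of a continuation in the bounds. -/
def Cont.Mono {σ : Type} (K : Cont σ) : Prop :=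
  ∀ s t t' p p', t ≤ t' → p ≤ p' → K s t p → K s t' p'

/-- Finitely many rounds of a loop. -/
def iterLoop {σ : Type} (B : σ → Prop) (W : Cont σ → Cont σ) (K : Cont σ) : ℕ → Cont σ
  | 0 => fun _ _ _ => False
  | k + 1 => fun s t p => ∃ t', t' + 1 ≤ t ∧
      (B s → W (iterLoop B W K k) s t' p) ∧ (¬ B s → ∃ t'' ≤ t', ∃ p' ≤ p, K s t'' p')

/-- Weakest preconditions with bounds on time and expected cost. -/
def Cmd.wp {α τ σ : Type} (S : Machine α τ σ) : Cmd α τ → Cont σ → Cont σ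
  | .skip, K => fun s t p => ∃ t' ≤ t, ∃ p' ≤ p, K s t' p'
  -- The cost `h` as a function of the sample need not be measurable. Bounds on probabilities are
  -- extracted in `Program.Good.measure_le` by monotonicity of the lower integral alone.
  | .op a, K => fun s t p => S.pre a s ∧ ∃ t', ∃ h : ℝ × ℝ → ℝ≥0∞, t' + 1 ≤ t ∧
      (∀ x, K (S.ev a x s) t' (h x)) ∧ ∫⁻ x, h x ∂sampleLaw ≤ p
  | .seq c d, K => c.wp S (d.wp S K)
  | .ite b c d, K => fun s t p => ∃ t', t' + 1 ≤ t ∧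
      (S.holds b s → c.wp S K s t' p) ∧ (¬ S.holds b s → d.wp S K s t' p)
  | .loop b c, K => fun s t p => ∃ k, iterLoop (S.holds b) (c.wp S) K k s t p

section Logic

variable {α τ σ : Type} {S : Machine α τ σ}

theorem iterLoop_mono {B : σ → Prop} {W : Cont σ → Cont σ} {K : Cont σ}
    (hW : ∀ K, (W K).Mono) (k : ℕ) : (iterLoop B W K k).Mono := by
  intro s t t' p p' ht hp h
  cases k with
  | zero => exact h
  | succ k =>
    obtain ⟨u, hu, h1, h2⟩ := h
    refine ⟨u, hu.trans ht, fun hb => hW _ _ _ _ _ _ le_rfl hp (h1 hb), fun hb => ?_⟩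
    obtain ⟨v, hv, q, hq, hK⟩ := h2 hb
    exact ⟨v, hv, q, hq.trans hp, hK⟩

theorem Cmd.wp_mono (c : Cmd α τ) (K : Cont σ) : (c.wp S K).Mono := by
  induction c generalizing K with
  | skip =>
    rintro s t t' p p' ht hp ⟨u, hu, q, hq, hK⟩
    exact ⟨u, hu.trans ht, q, hq.trans hp, hK⟩
  | op a =>
    rintro s t t' p p' ht hp ⟨hpre, u, h, hu, hK, hh⟩
    exact ⟨hpre, u, h, hu.trans ht, hK, hh.trans hp⟩
  | seq c d ihc ihd => exact ihc _
  | ite b c d ihc ihd =>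
    rintro s t t' p p' ht hp ⟨u, hu, h1, h2⟩
    exact ⟨u, hu.trans ht, fun hb => ihc _ _ _ _ _ _ le_rfl hp (h1 hb),
      fun hb => ihd _ _ _ _ _ _ le_rfl hp (h2 hb)⟩
  | loop b c ih =>
    rintro s t t' p p' ht hp ⟨k, hk⟩
    exact ⟨k, iterLoop_mono ih k _ _ _ _ _ ht hp hk⟩

theorem iterLoop_conseq {B : σ → Prop} {W : Cont σ → Cont σ} {K K' : Cont σ}
    (hW : ∀ K K' : Cont σ, (∀ s t p, K s t p → K' s t p) → ∀ s t p, W K s t p → W K' s t p)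
    (hK : ∀ s t p, K s t p → K' s t p) (k : ℕ) :
    ∀ s t p, iterLoop B W K k s t p → iterLoop B W K' k s t p := by
  induction k with
  | zero => exact fun _ _ _ h => h.elim
  | succ k ih =>
    rintro s t p ⟨u, hu, h1, h2⟩
    refine ⟨u, hu, fun hb => hW _ _ ih _ _ _ (h1 hb), fun hb => ?_⟩
    obtain ⟨v, hv, q, hq, h⟩ := h2 hb
    exact ⟨v, hv, q, hq, hK _ _ _ h⟩

theorem Cmd.wp_conseq (c : Cmd α τ) : ∀ {K K' : Cont σ}, (∀ s t p, K s t p → K' s t p) →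
    ∀ s t p, c.wp S K s t p → c.wp S K' s t p := by
  induction c with
  | skip =>
    rintro K K' h s t p ⟨u, hu, q, hq, hK⟩
    exact ⟨u, hu, q, hq, h _ _ _ hK⟩
  | op a =>
    rintro K K' hKK s t p ⟨hpre, u, h, hu, hK, hh⟩
    exact ⟨hpre, u, h, hu, fun x => hKK _ _ _ (hK x), hh⟩
  | seq c d ihc ihd => exact fun h => ihc (ihd h)
  | ite b c d ihc ihd =>
    rintro K K' h s t p ⟨u, hu, h1, h2⟩
    exact ⟨u, hu, fun hb => ihc h _ _ _ (h1 hb), fun hb => ihd h _ _ _ (h2 hb)⟩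
  | loop b c ih =>
    rintro K K' h s t p ⟨k, hk⟩
    exact ⟨k, iterLoop_conseq (fun _ _ => ih) h k _ _ _ hk⟩

/-- `c.Spec S s T I G δ`: started in `s`, the command `c` terminates within time `T` in a state
satisfying `I` for every random outcome, and in a state satisfying `G` with probability at least
`1 - δ`. -/
def Cmd.Spec (S : Machine α τ σ) (c : Cmd α τ) (s : σ) (T : ℕ) (I G : σ → Prop) (δ : ℝ≥0∞) :
    Prop :=
  -- A failure raises the cost from `a` to `a + b`, so a failure probability `δ` raises the
  -- expectation by `δ * b`; `a = 0`, `b = 1` gives back the probability. Finiteness of `b` allows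
  -- it to be pulled out of lower integrals of arbitrary functions.
  ∀ K : Cont σ, K.Mono → ∀ t a b, b ≠ ∞ → (∀ s', I s' → G s' → K s' t a) →
    (∀ s', I s' → K s' t (a + b)) →
    c.wp S K s (T + t) (a + δ * b)

/-- The deterministic part of `Cmd.Spec`. -/
abbrev Cmd.Sure (S : Machine α τ σ) (c : Cmd α τ) (s : σ) (T : ℕ) (I : σ → Prop) : Prop :=
  c.Spec S s T I (fun _ => True) 0

theorem Cmd.Spec.mono {c : Cmd α τ} {s : σ} {T T' : ℕ} {I I' G G' : σ → Prop} {δ δ' : ℝ≥0∞}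
    (h : c.Spec S s T I G δ) (hT : T ≤ T') (hI : ∀ s, I s → I' s) (hG : ∀ s, I s → G s → G' s)
    (hδ : δ ≤ δ') : c.Spec S s T' I' G' δ' := by
  intro K hK t a b hb h1 h2
  exact c.wp_mono K _ _ _ _ _ (by lia) (by gcongr)
    (h K hK t a b hb (fun s' i g => h1 s' (hI _ i) (hG _ i g)) fun s' i => h2 s' (hI _ i))

theorem Cmd.Spec.sure {c : Cmd α τ} {s : σ} {T : ℕ} {I G : σ → Prop} {δ : ℝ≥0∞}
    (h : c.Spec S s T I G δ) : c.Sure S s T I := by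
  intro K hK t a b _ h1 h2
  have := h K hK t a 0 (by simp) (fun s' i _ => h1 s' i trivial)
    (fun s' i => by simpa using h1 s' i trivial)
  simpa using this

theorem Cmd.Sure.wp {c : Cmd α τ} {s : σ} {T : ℕ} {I : σ → Prop}
    (h : c.Sure S s T I) {K : Cont σ} (hK : K.Mono) {t : ℕ} {p : ℝ≥0∞}
    (h1 : ∀ s', I s' → K s' t p) : c.wp S K s (T + t) p := by
  simpa using h K hK t p 0 (by simp) (fun s' i _ => h1 s' i) (fun s' i => by simpa using h1 s' i)

theorem Cmd.Sure.mono {c : Cmd α τ} {s : σ} {T T' : ℕ} {I I' : σ → Prop}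
    (h : c.Sure S s T I) (hT : T ≤ T') (hI : ∀ s, I s → I' s) : c.Sure S s T' I' :=
  Cmd.Spec.mono h hT hI (fun _ _ _ => trivial) le_rfl

theorem Cmd.Sure.spec_one {c : Cmd α τ} {s : σ} {T : ℕ} {I : σ → Prop}
    (h : c.Sure S s T I) (G : σ → Prop) : c.Spec S s T I G 1 := by
  intro K hK t a b _ h1 h2
  rw [one_mul]
  exact h.wp hK h2

/-- After success of `c` the remaining cost is `a + δ₂ * b`, after failure at most `δ₃ * b` more, so
the specification of `c` is applied with these two costs in place of `a` and `a + b`. -/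
theorem Cmd.Spec.seq_gen {c d : Cmd α τ} {s : σ} {T₁ T₂ : ℕ} {I₁ G₁ I G : σ → Prop}
    {δ₁ δ₂ δ₃ : ℝ≥0∞} (hc : c.Spec S s T₁ I₁ G₁ δ₁)
    (h1 : ∀ s₁, I₁ s₁ → G₁ s₁ → d.Spec S s₁ T₂ I G δ₂) (hδ : δ₃ ≠ ∞)
    (h2 : ∀ s₁, I₁ s₁ → d.Spec S s₁ T₂ I G δ₃) :
    (Cmd.seq c d).Spec S s (T₁ + T₂) I G (δ₂ + δ₁ * δ₃) := by
  intro K hK t a b hb0 ha hb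
  have := hc (d.wp S K) (d.wp_mono K) (T₂ + t) (a + δ₂ * b) (δ₃ * b) (ENNReal.mul_ne_top hδ hb0)
    (fun s' i g => h1 s' i g K hK t a b hb0 ha hb)
    (fun s' i => d.wp_mono K _ _ _ _ _ le_rfl (by gcongr; exact le_self_add)
      (h2 s' i K hK t a b hb0 ha hb))
  refine c.wp_mono _ _ _ _ _ _ (by lia) (le_of_eq ?_) this
  ring

/-- Union bound for a sequence of two commands. -/
theorem Cmd.Spec.seq {c d : Cmd α τ} {s : σ} {T₁ T₂ : ℕ} {I₁ G₁ I G : σ → Prop}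
    {δ₁ δ₂ : ℝ≥0∞} (hc : c.Spec S s T₁ I₁ G₁ δ₁)
    (h1 : ∀ s₁, I₁ s₁ → G₁ s₁ → d.Spec S s₁ T₂ I G δ₂)
    (h2 : ∀ s₁, I₁ s₁ → d.Sure S s₁ T₂ I) :
    (Cmd.seq c d).Spec S s (T₁ + T₂) I G (δ₂ + δ₁) := by
  simpa using Cmd.Spec.seq_gen hc h1 ENNReal.one_ne_top (fun s₁ i => (h2 s₁ i).spec_one G)

theorem Cmd.Sure.seq_spec {c d : Cmd α τ} {s : σ} {T₁ T₂ : ℕ} {I₁ I G : σ → Prop}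
    {δ : ℝ≥0∞} (hc : c.Sure S s T₁ I₁) (h1 : ∀ s₁, I₁ s₁ → d.Spec S s₁ T₂ I G δ) :
    (Cmd.seq c d).Spec S s (T₁ + T₂) I G δ := by
  intro K hK t a b hb0 ha hb
  refine c.wp_mono _ _ _ _ _ _ (by lia) le_rfl (hc.wp (d.wp_mono K) (t := T₂ + t) fun s' i => ?_)
  exact h1 s' i K hK t a b hb0 ha hb

theorem Cmd.Sure.seq {c d : Cmd α τ} {s : σ} {T₁ T₂ : ℕ} {I₁ I : σ → Prop}
    (hc : c.Sure S s T₁ I₁) (h1 : ∀ s₁, I₁ s₁ → d.Sure S s₁ T₂ I) :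
    (Cmd.seq c d).Sure S s (T₁ + T₂) I :=
  Cmd.Sure.seq_spec hc h1

theorem Cmd.Spec.seq_sure {c d : Cmd α τ} {s : σ} {T₁ T₂ : ℕ} {I₁ G₁ I G : σ → Prop}
    {δ : ℝ≥0∞} (hc : c.Spec S s T₁ I₁ G₁ δ)
    (h1 : ∀ s₁, I₁ s₁ → d.Sure S s₁ T₂ I)
    (h2 : ∀ s₁, I₁ s₁ → G₁ s₁ → d.Sure S s₁ T₂ fun s' => I s' ∧ G s') :
    (Cmd.seq c d).Spec S s (T₁ + T₂) I G δ := by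
  have := Cmd.Spec.seq (δ₂ := 0) (G := G) hc
    (fun s₁ i g => Cmd.Spec.mono (h2 s₁ i g) le_rfl (fun _ i => i.1) (fun _ i _ => i.2) le_rfl) h1
  simpa using this

theorem Cmd.Sure.skip {s : σ} : (Cmd.skip : Cmd α τ).Sure S s 0 (fun s' => s' = s) := by
  intro K hK t a b _ h1 h2
  exact ⟨t, by lia, a, by simp, h1 s rfl trivial⟩

theorem Cmd.Sure.op {a : α} {s : σ} {I : σ → Prop} (hp : S.pre a s) (h : ∀ x, I (S.ev a x s)) :
    (Cmd.op a : Cmd α τ).Sure S s 1 I := by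
  intro K hK t p b _ h1 h2
  exact ⟨hp, t, fun _ => p, by lia, fun x => h1 _ (h x) trivial, by simp⟩

theorem Cmd.Spec.ite {b : τ} {c d : Cmd α τ} {s : σ} {T : ℕ} {I G : σ → Prop} {δ : ℝ≥0∞}
    (h1 : S.holds b s → c.Spec S s T I G δ) (h2 : ¬ S.holds b s → d.Spec S s T I G δ) :
    (Cmd.ite b c d).Spec S s (T + 1) I G δ := by
  intro K hK t p q hq0 hp hq
  exact ⟨T + t, by lia, fun hb => h1 hb K hK t p q hq0 hp hq, fun hb => h2 hb K hK t p q hq0 hp hq⟩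

theorem Cmd.Sure.ite {b : τ} {c d : Cmd α τ} {s : σ} {T : ℕ} {I : σ → Prop}
    (h1 : S.holds b s → c.Sure S s T I) (h2 : ¬ S.holds b s → d.Sure S s T I) :
    (Cmd.ite b c d).Sure S s (T + 1) I :=
  Cmd.Spec.ite h1 h2

/-- The general rule for loops with a bounded number of rounds. -/
theorem Cmd.wp_loop {b : τ} {c : Cmd α τ} {T : ℕ} (Inv : ℕ → σ → ℝ≥0∞ → Prop)
    {K : Cont σ} {t : ℕ}
    (h1 : ∀ n s p, Inv (n + 1) s p → S.holds b s ∧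
      ∀ K' : Cont σ, K'.Mono → ∀ t', (∀ s' p', Inv n s' p' → K' s' t' p') →
        c.wp S K' s (T + t') p)
    (h0 : ∀ s p, Inv 0 s p → ¬ S.holds b s ∧ K s t p) (n : ℕ) (s : σ) (p : ℝ≥0∞)
    (h : Inv n s p) :
    (Cmd.loop b c).wp S K s (n * (T + 1) + 1 + t) p := by
  refine ⟨n + 1, ?_⟩
  induction n generalizing s p with
  | zero =>
    exact ⟨t, by lia, fun hb => ((h0 s p h).1 hb).elim,
      fun _ => ⟨t, le_rfl, p, le_rfl, (h0 s p h).2⟩⟩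
  | succ n ih =>
    refine ⟨T + (n * (T + 1) + 1 + t), by lia, fun _ => ?_, fun hb => (hb (h1 n s p h).1).elim⟩
    exact (h1 n s p h).2 _ (iterLoop_mono (fun K => c.wp_mono K) _) _ fun s' p' h' => ih s' p' h'

/-- Union bound over the rounds of a loop. -/
theorem Cmd.Spec.loop {b : τ} {c : Cmd α τ} {T : ℕ} {δ : ℝ≥0∞} (Inv G : ℕ → σ → Prop)
    (hb : ∀ n s, Inv (n + 1) s → S.holds b s)
    (hc : ∀ n s, Inv (n + 1) s → c.Sure S s T (Inv n))
    (hg : ∀ n s, Inv (n + 1) s → G (n + 1) s → c.Spec S s T (Inv n) (G n) δ)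
    (h0 : ∀ s, Inv 0 s → ¬ S.holds b s) (n : ℕ) (s : σ) (hI : Inv n s) (hG : G n s) :
    (Cmd.loop b c).Spec S s (n * (T + 1) + 1) (Inv 0) (G 0) (n * δ) := by
  intro K hK t p q hq0 hp hq
  -- Either a round has already failed and the full cost `p + q` is budgeted, or no round has failed
  -- and each of the remaining `n` rounds contributes `δ * q`.
  refine Cmd.wp_loop (fun n s r => Inv n s ∧ (p + q ≤ r ∨ (G n s ∧ p + n * δ * q ≤ r)))
    ?_ ?_ n s _ ⟨hI, Or.inr ⟨hG, le_rfl⟩⟩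
  · rintro n s r ⟨i, hr⟩
    refine ⟨hb n s i, fun K' hK' t' h' => ?_⟩
    rcases hr with hr | ⟨g, hr⟩
    · exact (hc n s i).wp hK' fun s' i' => h' s' r ⟨i', Or.inl hr⟩
    · have := hg n s i g K' hK' t' (p + n * δ * q) q hq0
        (fun s' i' g' => h' s' _ ⟨i', Or.inr ⟨g', le_rfl⟩⟩)
        (fun s' i' => h' s' _ ⟨i', Or.inl (by gcongr; exact le_self_add)⟩)
      refine c.wp_mono _ _ _ _ _ _ le_rfl (le_trans (le_of_eq ?_) hr) this
      push_cast
      ring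
  · rintro s r ⟨i, hr⟩
    refine ⟨h0 s i, ?_⟩
    rcases hr with hr | ⟨g, hr⟩
    · exact hK _ _ _ _ _ le_rfl hr (hq s i)
    · exact hK _ _ _ _ _ le_rfl (by simpa using hr) (hp s i g)

theorem Cmd.Sure.loop {b : τ} {c : Cmd α τ} {T : ℕ} (Inv : ℕ → σ → Prop)
    (hb : ∀ n s, Inv (n + 1) s → S.holds b s)
    (hc : ∀ n s, Inv (n + 1) s → c.Sure S s T (Inv n))
    (h0 : ∀ s, Inv 0 s → ¬ S.holds b s) (n : ℕ) (s : σ) (hI : Inv n s) :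
    (Cmd.loop b c).Sure S s (n * (T + 1) + 1) (Inv 0) := by
  simpa using Cmd.Spec.loop (δ := 0) Inv (fun _ _ => True) hb hc (fun n s i _ => hc n s i) h0 n s
    hI trivial

/-- Amplification: each round succeeds with probability at least `1 - δ`, whatever the previous
rounds did, and successes persist. -/
theorem Cmd.Spec.loop_amplify {b : τ} {c : Cmd α τ} {T : ℕ} {δ : ℝ≥0∞} (hδ : δ ≠ ∞)
    (Inv : ℕ → σ → Prop) (G : σ → Prop)
    (hb : ∀ n s, Inv (n + 1) s → S.holds b s)
    (hc : ∀ n s, Inv (n + 1) s → c.Spec S s T (Inv n) G δ)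
    (hg : ∀ n s, Inv (n + 1) s → G s → c.Sure S s T fun s' => Inv n s' ∧ G s')
    (h0 : ∀ s, Inv 0 s → ¬ S.holds b s) (n : ℕ) (s : σ) (hI : Inv n s) :
    (Cmd.loop b c).Spec S s (n * (T + 1) + 1) (Inv 0) G (δ ^ n) := by
  intro K hK t p q hq0 hp hq
  -- Before the first success the budget is `p + δ ^ n * q` with `n` rounds to go; after it only `p`
  -- is needed.
  refine Cmd.wp_loop (fun n s r => Inv n s ∧ ((G s ∧ p ≤ r) ∨ p + δ ^ n * q ≤ r))
    ?_ ?_ n s _ ⟨hI, Or.inr le_rfl⟩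
  · rintro n s r ⟨i, hr⟩
    refine ⟨hb n s i, fun K' hK' t' h' => ?_⟩
    rcases hr with ⟨g, hr⟩ | hr
    · exact (hg n s i g).wp hK' fun s' i' => h' s' r ⟨i'.1, Or.inl ⟨i'.2, hr⟩⟩
    · have := hc n s i K' hK' t' p (δ ^ n * q)
        (ENNReal.mul_ne_top (ENNReal.pow_ne_top hδ) hq0)
        (fun s' i' g' => h' s' _ ⟨i', Or.inl ⟨g', le_rfl⟩⟩)
        (fun s' i' => h' s' _ ⟨i', Or.inr le_rfl⟩)
      refine c.wp_mono _ _ _ _ _ _ le_rfl (le_trans (le_of_eq ?_) hr) this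
      ring
  · rintro s r ⟨i, hr⟩
    refine ⟨h0 s i, ?_⟩
    rcases hr with ⟨g, hr⟩ | hr
    · exact hK _ _ _ _ _ le_rfl hr (hp s i g)
    · exact hK _ _ _ _ _ le_rfl (by simpa using hr) (hq s i)

/-- Straight-line code. -/
def Cmd.block : List α → Cmd α τ
  | [] => .skip
  | a :: l => .seq (.op a) (Cmd.block l)

/-- The instruction does not use the random samples. -/
def Machine.Det (S : Machine α τ σ) (a : α) : Prop := ∀ x y s, S.ev a x s = S.ev a y s

/-- The effect of straight-line code without random instructions. -/
def Machine.exec (S : Machine α τ σ) : List α → σ → σ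
  | [], s => s
  | a :: l, s => S.exec l (S.ev a 0 s)

/-- Preconditions of straight-line code. -/
def Machine.pres (S : Machine α τ σ) : List α → σ → Prop
  | [], _ => True
  | a :: l, s => S.pre a s ∧ S.pres l (S.ev a 0 s)

theorem Cmd.Sure.block {l : List α} (hl : ∀ a ∈ l, S.Det a) {s : σ} (hp : S.pres l s) :
    (Cmd.block l : Cmd α τ).Sure S s l.length (fun s' => s' = S.exec l s) := by
  induction l generalizing s with
  | nil => exact Cmd.Sure.skip
  | cons a l ih =>
    have h1 : (Cmd.op a : Cmd α τ).Sure S s 1 (fun s' => s' = S.ev a 0 s) :=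
      Cmd.Sure.op hp.1 fun x => hl a (by simp) x 0 s
    have := h1.seq (d := Cmd.block l) (T₂ := l.length) (I := fun s' => s' = S.exec (a :: l) s)
      fun s₁ e => by
        subst e
        exact ih (fun a ha => hl a (by simp [ha])) hp.2
    exact this.mono (by simp [add_comm]) fun _ h => h

end Logic

/-! ## Tapes and runs from arbitrary configurations -/

/-- The tape with first entry `x` and remaining entries `ζ`. -/
def consTape (x : ℝ × ℝ) (ζ : Tape) : Tape
  | 0 => x
  | n + 1 => ζ n

theorem consTape_eta (ξ : Tape) : consTape (ξ 0) (fun n => ξ (n + 1)) = ξ := by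
  funext n
  cases n <;> rfl

theorem measurable_consTape : Measurable fun z : (ℝ × ℝ) × Tape => consTape z.1 z.2 := by
  refine measurable_pi_lambda _ fun n => ?_
  cases n with
  | zero => exact measurable_fst
  | succ n => exact (measurable_pi_apply n).comp measurable_snd

/-- The infinite product measure is determined by its values on boxes. A box pulls back to a
condition on the first sample times a box with shifted indices. -/
theorem map_consTape : (sampleLaw.prod tapeLaw).map (fun z => consTape z.1 z.2) = tapeLaw := by
  refine Measure.eq_infinitePi _ fun s t ht => ?_
  have hset : (fun z : (ℝ × ℝ) × Tape => consTape z.1 z.2) ⁻¹' Set.pi s t =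
      {x | 0 ∈ s → x ∈ t 0} ×ˢ Set.pi ((s.erase 0).image Nat.pred : Finset ℕ)
        (fun n => t (n + 1)) := by
    ext ⟨x, ζ⟩
    simp only [Set.mem_preimage, Set.mem_pi, Set.mem_prod, Set.mem_ofPred_eq, Finset.coe_image,
      Set.mem_image, Finset.mem_coe, Finset.mem_erase, forall_exists_index, and_imp]
    constructor
    · refine fun h => ⟨fun h0 => h 0 h0, ?_⟩
      rintro n k hk0 hk rfl
      obtain ⟨k, rfl⟩ := Nat.exists_eq_succ_of_ne_zero hk0
      exact h _ hk
    · rintro ⟨h0, h⟩ n hn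
      cases n with
      | zero => exact h0 hn
      | succ n => exact h n (n + 1) (by simp) hn rfl
  rw [Measure.map_apply measurable_consTape
    (MeasurableSet.pi s.countable_toSet fun i _ => ht i), hset, Measure.prod_prod]
  unfold tapeLaw
  rw [Measure.infinitePi_pi _ (fun i _ => ht (i + 1)),
    Finset.prod_image (by
      intro a ha b hb h
      simp only [Finset.coe_erase, Set.mem_sdiff, Finset.mem_coe, Set.mem_singleton_iff] at ha hb
      simp only [Nat.pred_eq_sub_one] at h
      have := ha.2
      have := hb.2
      lia)]
  have hprod : ∏ x ∈ s.erase 0, ((gaussianReal 0 1).prod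
      ((volume : Measure ℝ).restrict (Set.Icc 0 1))) (t (Nat.pred x + 1)) =
      ∏ x ∈ s.erase 0, sampleLaw (t x) := by
    refine Finset.prod_congr rfl fun x hx => ?_
    rw [Nat.pred_eq_sub_one, Nat.sub_add_cancel
      (Nat.one_le_iff_ne_zero.2 (Finset.ne_of_mem_erase hx))]
    rfl
  rw [hprod]
  by_cases h0 : 0 ∈ s
  · rw [← Finset.mul_prod_erase s _ h0]
    congr 2
    ext x
    simp [h0]
  · simp only [h0, false_imp_iff, Set.ofPred_true, measure_univ, one_mul]
    rw [Finset.erase_eq_of_notMem h0]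
    rfl

theorem tapeLaw_apply {S : Set Tape} (hS : MeasurableSet S) :
    tapeLaw S = ∫⁻ x, tapeLaw {ζ | consTape x ζ ∈ S} ∂sampleLaw := by
  conv_lhs => rw [← map_consTape]
  rw [Measure.map_apply measurable_consTape hS, Measure.prod_apply (measurable_consTape hS)]
  rfl

/-- For a set that need not be measurable one half of the Fubini identity survives, by passing to a
measurable hull. This is the half used by `Program.good_of_halts`, where nothing is known about
measurability of the correct outputs of a problem. -/
theorem lintegral_tapeLaw_le (S : Set Tape) :
    ∫⁻ x, tapeLaw {ζ | consTape x ζ ∈ S} ∂sampleLaw ≤ tapeLaw S := by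
  rw [← measure_toMeasurable S, tapeLaw_apply (measurableSet_toMeasurable _ S)]
  refine lintegral_mono fun x => measure_mono fun ζ h => ?_
  exact subset_toMeasurable _ _ h

/-- The configuration reached after `t` steps from a given configuration. -/
def Program.runFrom (P : Program) (s : Config P.Label) (ξ : Tape) : ℕ → Config P.Label
  | 0 => s
  | t + 1 => P.step (ξ t) (P.runFrom s ξ t)

theorem Program.run_eq_runFrom (P : Program) (M : Memory) (ξ : Tape) (t : ℕ) :
    P.run M ξ t = P.runFrom ⟨some P.start, M⟩ ξ t := by
  induction t with
  | zero => rfl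
  | succ t ih => simp only [Program.run, Program.runFrom, ih]

theorem Program.runFrom_cons (P : Program) (s : Config P.Label) (x : ℝ × ℝ) (ζ : Tape) (t : ℕ) :
    P.runFrom s (consTape x ζ) (t + 1) = P.runFrom (P.step x s) ζ t := by
  induction t with
  | zero => rfl
  | succ t ih =>
    rw [Program.runFrom, ih]
    rfl

theorem Program.step_of_halted (P : Program) (x : ℝ × ℝ) {s : Config P.Label} (h : s.pc = none) :
    P.step x s = s := by
  simp [Program.step, h]

theorem Program.runFrom_of_halted (P : Program) {s : Config P.Label} (h : s.pc = none) (ξ : Tape)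
    (t : ℕ) : P.runFrom s ξ t = s := by
  induction t with
  | zero => rfl
  | succ t ih => rw [Program.runFrom, ih, P.step_of_halted _ h]

/-! ## Measurability -/

instance : MeasurableSpace Memory :=
  MeasurableSpace.comap (fun M : Memory => (M.nat, M.real)) inferInstance

theorem measurable_memory_iff {Ω : Type*} [MeasurableSpace Ω] {f : Ω → Memory} :
    Measurable f ↔ Measurable (fun w => (f w).nat) ∧ Measurable (fun w => (f w).real) := by
  rw [measurable_comap_iff, ← measurable_prodMk_iff_aux]
  rfl
where
  measurable_prodMk_iff_aux {Ω : Type _} [MeasurableSpace Ω] {f : Ω → Memory} :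
    Measurable (fun w => ((f w).nat, (f w).real)) ↔
      Measurable (fun w => (f w).nat) ∧ Measurable (fun w => (f w).real) :=
    ⟨fun h => ⟨h.fst, h.snd⟩, fun h => h.1.prodMk h.2⟩

theorem measurable_update_index {Ω β : Type*} [MeasurableSpace Ω] [MeasurableSpace β]
    {u : Ω → ℕ → β} {a : Ω → ℕ} {v : Ω → β} (hu : Measurable u) (ha : Measurable a)
    (hv : Measurable v) : Measurable fun w => Function.update (u w) (a w) (v w) := by
  refine measurable_pi_lambda _ fun k => ?_
  simp only [Function.update_apply]
  exact Measurable.ite (measurableSet_eq_fun measurable_const ha) hv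
    ((measurable_pi_apply k).comp hu)

theorem measurable_eval_index {Ω β : Type*} [MeasurableSpace Ω] [MeasurableSpace β]
    {u : Ω → ℕ → β} {a : Ω → ℕ} (hu : Measurable u) (ha : Measurable a) :
    Measurable fun w => u w (a w) := by
  have : Measurable fun z : ℕ × (ℕ → β) => z.2 z.1 :=
    measurable_from_prod_countable_right fun n => measurable_pi_apply n
  exact this.comp (ha.prodMk hu)

theorem Op.measurable_eval {Ω : Type*} [MeasurableSpace Ω] {x : Ω → ℝ × ℝ} {f : Ω → Memory}
    (hx : Measurable x) (hf : Measurable f) (o : Op) :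
    Measurable fun w => o.eval (x w) (f w) := by
  obtain ⟨hn, hr⟩ := measurable_memory_iff.1 hf
  have hn' (a : ℕ) : Measurable fun w => (f w).nat a := (measurable_pi_apply a).comp hn
  have hr' (a : ℕ) : Measurable fun w => (f w).real a := (measurable_pi_apply a).comp hr
  rw [measurable_memory_iff]
  cases o with
  | natConst a k => exact ⟨measurable_update_index hn measurable_const measurable_const, hr⟩
  | natAdd a b c =>
    exact ⟨measurable_update_index hn measurable_const ((hn' b).add (hn' c)), hr⟩
  | natSub a b c =>
    exact ⟨measurable_update_index hn measurable_const ((hn' b).sub (hn' c)), hr⟩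
  | natMul a b c =>
    exact ⟨measurable_update_index hn measurable_const ((hn' b).mul (hn' c)), hr⟩
  | natLoad a b =>
    exact ⟨measurable_update_index hn measurable_const (measurable_eval_index hn (hn' b)), hr⟩
  | natStore a b => exact ⟨measurable_update_index hn (hn' a) (hn' b), hr⟩
  | realOfNat a b =>
    exact ⟨hn, measurable_update_index hr measurable_const (measurable_from_nat.comp (hn' b))⟩
  | realAdd a b c =>
    exact ⟨hn, measurable_update_index hr measurable_const ((hr' b).add (hr' c))⟩
  | realSub a b c =>
    exact ⟨hn, measurable_update_index hr measurable_const ((hr' b).sub (hr' c))⟩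
  | realMul a b c =>
    exact ⟨hn, measurable_update_index hr measurable_const ((hr' b).mul (hr' c))⟩
  | realDiv a b c =>
    exact ⟨hn, measurable_update_index hr measurable_const ((hr' b).div (hr' c))⟩
  | realLoad a b =>
    exact ⟨hn, measurable_update_index hr measurable_const (measurable_eval_index hr (hn' b))⟩
  | realStore a b => exact ⟨hn, measurable_update_index hr (hn' a) (hr' b)⟩
  | gauss a => exact ⟨hn, measurable_update_index hr measurable_const hx.fst⟩
  | unif a => exact ⟨hn, measurable_update_index hr measurable_const hx.snd⟩

theorem Test.measurableSet_holds {Ω : Type*} [MeasurableSpace Ω] {f : Ω → Memory}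
    (hf : Measurable f) (t : Test) : MeasurableSet {w | t.holds (f w)} := by
  obtain ⟨hn, hr⟩ := measurable_memory_iff.1 hf
  cases t with
  | natLe a b =>
    exact measurableSet_le ((measurable_pi_apply a).comp hn) ((measurable_pi_apply b).comp hn)
  | realLe a b =>
    exact measurableSet_le ((measurable_pi_apply a).comp hr) ((measurable_pi_apply b).comp hr)

-- There are finitely many labels, so measurability can be checked separately for each value of the
-- program counter, where the instruction is fixed.
open Classical in
theorem Program.measurable_runFrom (P : Program) (s : Config P.Label) (t : ℕ) :
    (∀ l, MeasurableSet {ξ | (P.runFrom s ξ t).pc = l}) ∧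
      Measurable fun ξ => (P.runFrom s ξ t).mem := by
  have := P.finite_label
  let _ : MeasurableSpace P.Label := ⊤
  let _ : MeasurableSpace (Option P.Label) := ⊤
  suffices h : (Measurable fun ξ => (P.runFrom s ξ t).pc) ∧
      Measurable fun ξ => (P.runFrom s ξ t).mem from
    ⟨fun l => h.1 (MeasurableSet.of_discrete (s := {l})), h.2⟩
  induction t with
  | zero => exact ⟨measurable_const (a := s.pc), measurable_const (a := s.mem)⟩
  | succ t ih =>
    obtain ⟨hpc, hmem⟩ := ih
    have h1 : Measurable fun z : Option P.Label × Tape =>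
        (P.step (z.2 t) ⟨z.1, (P.runFrom s z.2 t).mem⟩).pc := by
      refine measurable_from_prod_countable_right fun l => ?_
      cases l with
      | none => exact measurable_const
      | some l =>
        cases h : P.code l with
        | exec o next => simp only [Program.step, h]; exact measurable_const
        | branch b yes no =>
          simp only [Program.step, h]
          exact Measurable.ite (b.measurableSet_holds hmem) measurable_const measurable_const
    have h2 : Measurable fun z : Option P.Label × Tape =>
        (P.step (z.2 t) ⟨z.1, (P.runFrom s z.2 t).mem⟩).mem := by
      refine measurable_from_prod_countable_right fun l => ?_
      cases l with
      | none => simpa only [Program.step] using hmem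
      | some l =>
        cases h : P.code l with
        | exec o next =>
          simp only [Program.step, h]
          exact o.measurable_eval (measurable_pi_apply t) hmem
        | branch b yes no => simpa only [Program.step, h] using hmem
    exact ⟨h1.comp (hpc.prodMk measurable_id), h2.comp (hpc.prodMk measurable_id)⟩

/-! ## Bounds on running time and expected cost -/

/-- From the configuration `s` the program halts within `t` steps for every random outcome, and
the expectation of `bad` on the final memory is at most `p`. -/
def Program.Good (P : Program) (bad : Memory → ℝ≥0∞) : ℕ → Config P.Label → ℝ≥0∞ → Prop
  | 0, s, p => s.pc = none ∧ bad s.mem ≤ p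
  | t + 1, s, p => (s.pc = none ∧ bad s.mem ≤ p) ∨ s.pc ≠ none ∧
      ∃ h : ℝ × ℝ → ℝ≥0∞, (∀ x, P.Good bad t (P.step x s) (h x)) ∧ ∫⁻ x, h x ∂sampleLaw ≤ p

theorem Program.Good.of_halted {P : Program} {bad : Memory → ℝ≥0∞} {s : Config P.Label}
    {p : ℝ≥0∞} (h : s.pc = none) (hp : bad s.mem ≤ p) (t : ℕ) : P.Good bad t s p := by
  cases t with
  | zero => exact ⟨h, hp⟩
  | succ t => exact Or.inl ⟨h, hp⟩

theorem Program.Good.mono {P : Program} {bad : Memory → ℝ≥0∞} {t t' : ℕ} {s : Config P.Label}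
    {p p' : ℝ≥0∞} (h : P.Good bad t s p) (ht : t ≤ t') (hp : p ≤ p') : P.Good bad t' s p' := by
  induction t generalizing s p p' t' with
  | zero => exact Program.Good.of_halted h.1 (h.2.trans hp) _
  | succ t ih =>
    rcases h with h | ⟨hpc, h, h1, h2⟩
    · exact Program.Good.of_halted h.1 (h.2.trans hp) _
    · obtain ⟨t', rfl⟩ := Nat.exists_eq_succ_of_ne_zero (show t' ≠ 0 by lia)
      exact Or.inr ⟨hpc, h, fun x => ih (h1 x) (by lia) le_rfl, h2.trans hp⟩

theorem Program.Good.halts {P : Program} {bad : Memory → ℝ≥0∞} {t : ℕ} {s : Config P.Label}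
    {p : ℝ≥0∞} (h : P.Good bad t s p) (ξ : Tape) : (P.runFrom s ξ t).pc = none := by
  induction t generalizing s p ξ with
  | zero => exact h.1
  | succ t ih =>
    rcases h with h | ⟨hpc, h, h1, h2⟩
    · rw [P.runFrom_of_halted h.1, h.1]
    · rw [← consTape_eta ξ, P.runFrom_cons]
      exact ih (h1 _) _

/-- Conditioning on the first sample needs an upper bound for the measure of the whole set, hence
the exact identity `tapeLaw_apply` and a measurable `B`. -/
theorem Program.Good.measure_le {P : Program} {B : Set Memory} (hB : MeasurableSet B) {t : ℕ}
    {s : Config P.Label} {p : ℝ≥0∞} (h : P.Good (B.indicator 1) t s p) :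
    tapeLaw {ξ | (P.runFrom s ξ t).mem ∈ B} ≤ p := by
  have key : ∀ (s : Config P.Label) (p : ℝ≥0∞) t, s.pc = none → B.indicator 1 s.mem ≤ p →
      tapeLaw {ξ | (P.runFrom s ξ t).mem ∈ B} ≤ p := by
    intro s p t h hp
    simp only [P.runFrom_of_halted h]
    by_cases hs : s.mem ∈ B
    · simpa [hs] using hp
    · simp [hs]
  induction t generalizing s p with
  | zero => exact key s p 0 h.1 h.2
  | succ t ih =>
    rcases h with h | ⟨hpc, h, h1, h2⟩
    · exact key s p _ h.1 h.2
    · have hm : MeasurableSet {ξ | (P.runFrom s ξ (t + 1)).mem ∈ B} :=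
        (P.measurable_runFrom s _).2 hB
      rw [tapeLaw_apply hm]
      refine (lintegral_mono fun x => ?_).trans h2
      simp only [Set.mem_ofPred_eq, P.runFrom_cons]
      exact ih (h1 x)

/-- Conversely, halting runs and a bound on the failure probability give `Program.Good`. -/
theorem Program.good_of_halts (P : Program) (B : Set Memory) {t : ℕ} {s : Config P.Label}
    (h : ∀ ξ, (P.runFrom s ξ t).pc = none) :
    P.Good (B.indicator 1) t s (tapeLaw {ξ | (P.runFrom s ξ t).mem ∈ B}) := by
  induction t generalizing s with
  | zero =>
    refine ⟨h fun _ => 0, ?_⟩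
    simp only [Program.runFrom]
    by_cases hs : s.mem ∈ B
    · simp [hs]
    · simp [hs]
  | succ t ih =>
    by_cases hpc : s.pc = none
    · refine Program.Good.of_halted hpc ?_ _
      simp only [P.runFrom_of_halted hpc]
      by_cases hs : s.mem ∈ B
      · simp [hs]
      · simp [hs]
    refine Or.inr ⟨hpc, fun x => tapeLaw {ζ | (P.runFrom (P.step x s) ζ t).mem ∈ B},
      fun x => ih fun ζ => ?_, ?_⟩
    · rw [← P.runFrom_cons]
      exact h _
    · refine le_trans (le_of_eq ?_) (lintegral_tapeLaw_le _)
      simp only [Set.mem_ofPred_eq, P.runFrom_cons]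

/-! ## Compilation of structured programs -/

/-- The structured programs of the real RAM. -/
def ram : Machine Op Test Memory where
  ev o x M := o.eval x M
  pre _ _ := True
  holds t M := t.holds M

/-- The labels of the code of a command. -/
def Cmd.Lab {α τ : Type} : Cmd α τ → Type
  | .skip => Empty
  | .op _ => Unit
  | .seq c d => c.Lab ⊕ d.Lab
  | .ite _ c d => Option (c.Lab ⊕ d.Lab)
  | .loop _ c => Option c.Lab

theorem Cmd.finite_lab {α τ : Type} (c : Cmd α τ) : Finite c.Lab := by
  induction c with
  | skip => exact inferInstanceAs (Finite Empty)
  | op _ => exact inferInstanceAs (Finite Unit)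
  | seq c d ihc ihd => exact inferInstanceAs (Finite (c.Lab ⊕ d.Lab))
  | ite _ c d ihc ihd => exact inferInstanceAs (Finite (Option (c.Lab ⊕ d.Lab)))
  | loop _ c ih => exact inferInstanceAs (Finite (Option c.Lab))

/-- The entry point of the code of a command, when its labels are embedded by `e` and `k` is the
label to be executed afterwards. -/
def Cmd.entry {α τ L : Type} : (c : Cmd α τ) → (c.Lab → L) → Option L → Option L
  | .skip, _, k => k
  | .op _, e, _ => some (e ())
  | .seq c d, e, k => c.entry (fun l => e (.inl l)) (d.entry (fun l => e (.inr l)) k)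
  | .ite _ _ _, e, _ => some (e none)
  | .loop _ _, e, _ => some (e none)

/-- The code of a command. -/
def Cmd.code {L : Type} : (c : Cmd Op Test) → (c.Lab → L) → Option L → c.Lab → Instr L
  | .skip, _, _ => fun l => l.elim
  | .op o, _, k => fun _ => .exec o k
  | .seq c d, e, k => fun l => match l with
    | .inl l => c.code (fun l => e (.inl l)) (d.entry (fun l => e (.inr l)) k) l
    | .inr l => d.code (fun l => e (.inr l)) k l
  | .ite t c d, e, k => fun l => match l with
    | none => .branch t (c.entry (fun l => e (some (.inl l))) k)
        (d.entry (fun l => e (some (.inr l))) k)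
    | some (.inl l) => c.code (fun l => e (some (.inl l))) k l
    | some (.inr l) => d.code (fun l => e (some (.inr l))) k l
  | .loop t c, e, k => fun l => match l with
    | none => .branch t (c.entry (fun l => e (some l)) (some (e none))) k
    | some l => c.code (fun l => e (some l)) (some (e none)) l

theorem Program.step_exec {P : Program} {l : P.Label} {o : Op} {k : Option P.Label}
    (h : P.code l = .exec o k) (x : ℝ × ℝ) (M : Memory) :
    P.step x ⟨some l, M⟩ = ⟨k, o.eval x M⟩ := by
  simp only [Program.step, h]

theorem Program.step_yes {P : Program} {l : P.Label} {b : Test} {k k' : Option P.Label}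
    (h : P.code l = .branch b k k') (x : ℝ × ℝ) {M : Memory} (hb : b.holds M) :
    P.step x ⟨some l, M⟩ = ⟨k, M⟩ := by
  simp only [Program.step, h, hb, if_true]

theorem Program.step_no {P : Program} {l : P.Label} {b : Test} {k k' : Option P.Label}
    (h : P.code l = .branch b k k') (x : ℝ × ℝ) {M : Memory} (hb : ¬ b.holds M) :
    P.step x ⟨some l, M⟩ = ⟨k', M⟩ := by
  simp only [Program.step, h, hb, if_false]

theorem Program.Good.of_step {P : Program} {bad : Memory → ℝ≥0∞} {t : ℕ} {s : Config P.Label}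
    {p : ℝ≥0∞} (hpc : s.pc ≠ none) (h : ∀ x, P.Good bad t (P.step x s) p) :
    P.Good bad (t + 1) s p :=
  Or.inr ⟨hpc, fun _ => p, h, by simp⟩

/-- Correctness of the compiler. The label `k` plays the role of the continuation `K`; for a loop,
the continuation of the body is the label of the loop test, and a second induction runs over the
number of rounds. -/
theorem Cmd.good_of_wp {P : Program} {bad : Memory → ℝ≥0∞} (c : Cmd Op Test) :
    ∀ (e : c.Lab → P.Label) (k : Option P.Label), (∀ l, P.code (e l) = c.code e k l) →
    ∀ (K : Cont Memory), (∀ M t p, K M t p → P.Good bad t ⟨k, M⟩ p) →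
    ∀ M t p, c.wp ram K M t p → P.Good bad t ⟨c.entry e k, M⟩ p := by
  induction c with
  | skip =>
    rintro e k - K hK M t p ⟨u, hu, q, hq, h⟩
    exact (hK _ _ _ h).mono hu hq
  | op o =>
    rintro e k he K hK M t p ⟨-, u, h, hu, h1, h2⟩
    refine Program.Good.mono (t := u + 1) (Or.inr ⟨Option.some_ne_none _, h, fun x => ?_, h2⟩) hu
        le_rfl
    have : P.step x ⟨(Cmd.op o : Cmd Op Test).entry e k, M⟩ = ⟨k, o.eval x M⟩ :=
      Program.step_exec (he ()) x M
    rw [this]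
    exact hK _ _ _ (h1 x)
  | seq c d ihc ihd =>
    intro e k he K hK M t p h
    exact ihc (fun l => e (.inl l)) _ (fun l => he (.inl l)) _
      (ihd (fun l => e (.inr l)) k (fun l => he (.inr l)) K hK) M t p h
  | ite b c d ihc ihd =>
    rintro e k he K hK M t p ⟨u, hu, h1, h2⟩
    refine Program.Good.mono (t := u + 1) (Program.Good.of_step (Option.some_ne_none _) fun x => ?_) hu
        le_rfl
    by_cases hb : b.holds M
    · have : P.step x ⟨(Cmd.ite b c d).entry e k, M⟩ =
          ⟨c.entry (fun l => e (some (.inl l))) k, M⟩ :=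
        Program.step_yes (he none) x hb
      rw [this]
      exact ihc (fun l => e (some (.inl l))) k (fun l => he (some (.inl l))) K hK M u p (h1 hb)
    · have : P.step x ⟨(Cmd.ite b c d).entry e k, M⟩ =
          ⟨d.entry (fun l => e (some (.inr l))) k, M⟩ :=
        Program.step_no (he none) x hb
      rw [this]
      exact ihd (fun l => e (some (.inr l))) k (fun l => he (some (.inr l))) K hK M u p (h2 hb)
  | loop b c ih =>
    rintro e k he K hK M t p ⟨n, hn⟩
    change P.Good bad t ⟨some (e none), M⟩ p
    induction n generalizing M t p with
    | zero => exact hn.elim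
    | succ n ihn =>
      obtain ⟨u, hu, h1, h2⟩ := hn
      refine Program.Good.mono (t := u + 1) (Program.Good.of_step (Option.some_ne_none _) fun x => ?_) hu
        le_rfl
      by_cases hb : b.holds M
      · have : P.step x ⟨some (e none), M⟩ =
            ⟨c.entry (fun l => e (some l)) (some (e none)), M⟩ :=
          Program.step_yes (he none) x hb
        rw [this]
        exact ih (fun l => e (some l)) _ (fun l => he (some l)) _ ihn M u p (h1 hb)
      · have : P.step x ⟨some (e none), M⟩ = ⟨k, M⟩ :=
          Program.step_no (he none) x hb
        rw [this]
        obtain ⟨v, hv, q, hq, h⟩ := h2 hb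
        exact (hK _ _ _ h).mono hv hq

/-- The program executing the instruction `o` and then the command `c`. -/
def Cmd.toProgram (o : Op) (c : Cmd Op Test) : Program where
  -- The code of a command may be empty, while a program needs a start label; the instruction `o`
  -- provides one.
  Label := Option c.Lab
  finite_label := by
    have := c.finite_lab
    infer_instance
  start := none
  code
    | none => .exec o (c.entry some none)
    | some l => c.code some none l

/-- The specification is applied to the cost that is `1` on failure and `0` otherwise, whose
expectation is the failure probability. -/
theorem Cmd.Spec.toProgram {o : Op} {c : Cmd Op Test} {M : Memory} {T : ℕ} {I G : Memory → Prop}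
    {δ : ℝ≥0∞} (h : (Cmd.seq (.op o) c).Spec ram M T I G δ) (hG : MeasurableSet {M | G M}) :
    (∀ ξ, ((c.toProgram o).run M ξ T).pc = none) ∧
      tapeLaw {ξ | ¬ G ((c.toProgram o).run M ξ T).mem} ≤ δ := by
  have key : (c.toProgram o).Good ({M | ¬ G M}.indicator 1) T
      ⟨some (c.toProgram o).start, M⟩ δ := by
    have := h (fun M _ p => {M | ¬ G M}.indicator 1 M ≤ p)
      (fun _ _ _ _ _ _ hp h => h.trans hp) 0 0 1 (by simp)
      (fun s _ g => by simp [g])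
      (fun s _ => by rw [zero_add]; exact Set.indicator_le_self' (fun _ _ => zero_le) _)
    simp only [add_zero, mul_one, zero_add] at this
    obtain ⟨-, u, f, hu, h1, h2⟩ := this
    refine Program.Good.mono (t := u + 1) (Or.inr ⟨Option.some_ne_none _, f, fun x => ?_, h2⟩) hu
        le_rfl
    exact c.good_of_wp (P := c.toProgram o) some none (fun l => rfl) _
      (fun M t p h => Program.Good.of_halted rfl h t) _ _ _ (h1 x)
  refine ⟨fun ξ => ?_, ?_⟩
  · rw [Program.run_eq_runFrom]
    exact key.halts ξ
  · simp only [Program.run_eq_runFrom]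
    exact key.measure_le hG.compl

/-! ## A machine with registers and separate arrays

The states consist of finitely many registers, three arrays of reals and one array of natural
numbers.  Array `0` holds the input, array `1` a linear system; array `2` and the array of natural
numbers are the memory of a subroutine, which can be replaced by a fresh (zero) one. -/

/-- States of the register machine. -/
structure St where
  nr : Fin 32 → ℕ
  rr : Fin 16 → ℝ
  arr : Fin 3 → ℕ → ℝ
  nsub : ℕ → ℕ
  cap : ℕ

/-- Instructions of the register machine. -/
inductive HOp where
  | nconst (a : Fin 32) (k : ℕ)
  | nadd (a b c : Fin 32)
  | nmonus (a b c : Fin 32)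
  | nmul (a b c : Fin 32)
  | nload (a b : Fin 32)
  | nstore (a b : Fin 32)
  | rofnat (a : Fin 16) (b : Fin 32)
  | radd (a b c : Fin 16)
  | rsub (a b c : Fin 16)
  | rmul (a b c : Fin 16)
  | rdiv (a b c : Fin 16)
  | rload (z : Fin 3) (a : Fin 16) (b : Fin 32)
  | rstore (z : Fin 3) (a : Fin 32) (b : Fin 16)
  | gauss (a : Fin 16)
  | unif (a : Fin 16)
  | fresh

/-- Tests of the register machine. -/
inductive HTest where
  | nle (a b : Fin 32)
  | rle (a b : Fin 16)

/-- Assignment to a natural-number register. -/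
def St.setN (s : St) (a : Fin 32) (v : ℕ) : St := { s with nr := Function.update s.nr a v }

/-- Assignment to a real register. -/
def St.setR (s : St) (a : Fin 16) (v : ℝ) : St := { s with rr := Function.update s.rr a v }

/-- Assignment to an entry of an array. -/
def St.setA (s : St) (z : Fin 3) (k : ℕ) (v : ℝ) : St :=
  { s with arr := Function.update s.arr z (Function.update (s.arr z) k v) }

/-- Assignment to an entry of the array of natural numbers. -/
def St.setS (s : St) (k v : ℕ) : St := { s with nsub := Function.update s.nsub k v }

/-- Replacement of the memory of the subroutine by a fresh one. -/
def St.renew (s : St) : St :=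
  { s with arr := Function.update s.arr 2 (fun _ => 0), nsub := fun _ => 0, cap := s.cap - 1 }

/-- Effect of the instructions of the register machine. -/
def HOp.ev : HOp → ℝ × ℝ → St → St
  | .nconst a k, _, s => s.setN a k
  | .nadd a b c, _, s => s.setN a (s.nr b + s.nr c)
  | .nmonus a b c, _, s => s.setN a (s.nr b - s.nr c)
  | .nmul a b c, _, s => s.setN a (s.nr b * s.nr c)
  | .nload a b, _, s => s.setN a (s.nsub (s.nr b))
  | .nstore a b, _, s => s.setS (s.nr a) (s.nr b)
  | .rofnat a b, _, s => s.setR a (s.nr b)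
  | .radd a b c, _, s => s.setR a (s.rr b + s.rr c)
  | .rsub a b c, _, s => s.setR a (s.rr b - s.rr c)
  | .rmul a b c, _, s => s.setR a (s.rr b * s.rr c)
  | .rdiv a b c, _, s => s.setR a (s.rr b / s.rr c)
  | .rload z a b, _, s => s.setR a (s.arr z (s.nr b))
  | .rstore z a b, _, s => s.setA z (s.nr a) (s.rr b)
  | .gauss a, x, s => s.setR a x.1
  | .unif a, x, s => s.setR a x.2
  | .fresh, _, s => s.renew

/-- The register machine. -/
def hl : Machine HOp HTest St where
  ev := HOp.ev
  pre a s := match a with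
    | .fresh => 0 < s.cap
    | _ => True
  holds t s := match t with
    | .nle a b => s.nr a ≤ s.nr b
    | .rle a b => s.rr a ≤ s.rr b

/-! ## Implementation on the real RAM -/

/-- The zone of the memory in which an array is stored. -/
def zoneOf (idx : ℕ) (z : Fin 3) : ℕ := if z = 2 then idx else z

/-- `M` represents the state `s`: registers are stored in the first cells, entry `k` of zone `z`
in cell `base + W * k + z`. The current memory of the subroutine is zone `idx`. -/
structure Rep (W base idx : ℕ) (s : St) (M : Memory) : Prop where
  width : M.nat 41 = W
  zone : ∀ z : Fin 3, M.nat (42 + z) = base + zoneOf idx z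
  nr : ∀ a : Fin 32, M.nat a = s.nr a
  rr : ∀ a : Fin 16, M.real a = s.rr a
  arr : ∀ z k, M.real (base + W * k + zoneOf idx z) = s.arr z k
  nsub : ∀ k, M.nat (base + W * k + idx) = s.nsub k
  fresh : ∀ z k, idx < z → z < W →
    M.real (base + W * k + z) = 0 ∧ M.nat (base + W * k + z) = 0
  base_le : 50 ≤ base
  idx_le : 2 ≤ idx
  cap : idx + s.cap < W

/-- Quotient and remainder modulo `W` recover the entry and the zone. Zones are therefore disjoint,
and writing to one leaves the others alone. -/
theorem zone_injective {W base k k' z z' : ℕ} (hz : z < W) (hz' : z' < W)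
    (h : base + W * k + z = base + W * k' + z') : k = k' ∧ z = z' := by
  have h' : z + W * k = z' + W * k' := by lia
  have h1 := congrArg (· % W) h'
  have h2 := congrArg (· / W) h'
  simp only [Nat.add_mul_mod_self_left, Nat.mod_eq_of_lt hz, Nat.mod_eq_of_lt hz'] at h1
  simp only [Nat.add_mul_div_left _ _ (show 0 < W by lia), Nat.div_eq_of_lt hz,
    Nat.div_eq_of_lt hz'] at h2
  lia

namespace Rep

variable {W base idx : ℕ} {s : St} {M : Memory}

theorem zoneOf_lt (h : Rep W base idx s M) (z : Fin 3) : zoneOf idx z < W := by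
  have := h.cap
  have := h.idx_le
  unfold zoneOf
  split <;> lia

theorem idx_lt (h : Rep W base idx s M) : idx < W := by
  have := h.cap
  lia

theorem tmp (h : Rep W base idx s M) (v : ℕ) :
    Rep W base idx s { M with nat := Function.update M.nat 40 v } := by
  have hb := h.base_le
  refine ⟨?_, fun z => ?_, fun a => ?_, h.rr, h.arr, fun k => ?_, fun z k h1 h2 => ?_, h.base_le,
    h.idx_le, h.cap⟩
  · simp [h.width]
  · dsimp only
    rw [Function.update_of_ne (by lia)]
    exact h.zone z
  · dsimp only
    rw [Function.update_of_ne (by lia)]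
    exact h.nr a
  · dsimp only
    rw [Function.update_of_ne (by lia)]
    exact h.nsub k
  · dsimp only
    rw [Function.update_of_ne (by lia)]
    exact h.fresh z k h1 h2

theorem setN (h : Rep W base idx s M) (a : Fin 32) (v : ℕ) :
    Rep W base idx (s.setN a v) { M with nat := Function.update M.nat a v } := by
  have hb := h.base_le
  refine ⟨?_, fun z => ?_, fun b => ?_, h.rr, h.arr, fun k => ?_, fun z k h1 h2 => ?_, h.base_le,
    h.idx_le, h.cap⟩
  · dsimp only
    rw [Function.update_of_ne (by lia)]
    exact h.width
  · dsimp only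
    rw [Function.update_of_ne (by lia)]
    exact h.zone z
  · simp only [Function.update_apply, St.setN, Fin.val_inj, h.nr]
  · dsimp only
    rw [Function.update_of_ne (by lia)]
    exact h.nsub k
  · dsimp only
    rw [Function.update_of_ne (by lia)]
    exact h.fresh z k h1 h2

theorem setR (h : Rep W base idx s M) (a : Fin 16) (v : ℝ) :
    Rep W base idx (s.setR a v) { M with real := Function.update M.real a v } := by
  have hb := h.base_le
  refine ⟨h.width, h.zone, h.nr, fun b => ?_, fun z k => ?_, h.nsub, fun z k h1 h2 => ?_,
    h.base_le, h.idx_le, h.cap⟩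
  · simp only [Function.update_apply, St.setR, Fin.val_inj, h.rr]
  · dsimp only
    rw [Function.update_of_ne (by lia)]
    exact h.arr z k
  · dsimp only
    rw [Function.update_of_ne (by lia)]
    exact h.fresh z k h1 h2

theorem setA (h : Rep W base idx s M) (z : Fin 3) (k : ℕ) (v : ℝ) :
    Rep W base idx (s.setA z k v)
      { M with real := Function.update M.real (base + W * k + zoneOf idx z) v } := by
  have hb := h.base_le
  have hi := h.idx_le
  refine ⟨h.width, h.zone, h.nr, fun b => ?_, fun z' k' => ?_, h.nsub, fun z' k' h1 h2 => ?_,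
    h.base_le, h.idx_le, h.cap⟩
  · dsimp only
    rw [Function.update_of_ne (by lia)]
    exact h.rr b
  · by_cases hz : z' = z
    · subst hz
      by_cases hk : k' = k
      · subst hk
        simp [St.setA]
      · dsimp only
        rw [Function.update_of_ne fun e =>
          hk (zone_injective (h.zoneOf_lt _) (h.zoneOf_lt _) e).1, h.arr]
        simp [St.setA, hk]
    · have hne : zoneOf idx z' ≠ zoneOf idx z := by
        unfold zoneOf
        split_ifs <;> lia
      dsimp only
      rw [Function.update_of_ne fun e =>
          hne (zone_injective (h.zoneOf_lt _) (h.zoneOf_lt _) e).2, h.arr]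
      simp [St.setA, hz]
  · have hne : z' ≠ zoneOf idx z := by
      unfold zoneOf
      split_ifs <;> lia
    dsimp only
    rw [Function.update_of_ne fun e => hne (zone_injective h2 (h.zoneOf_lt _) e).2]
    exact h.fresh z' k' h1 h2

theorem setS (h : Rep W base idx s M) (k v : ℕ) :
    Rep W base idx (s.setS k v)
      { M with nat := Function.update M.nat (base + W * k + idx) v } := by
  have hb := h.base_le
  have hi := h.idx_le
  refine ⟨?_, fun z => ?_, fun b => ?_, h.rr, h.arr, fun k' => ?_, fun z' k' h1 h2 => ?_,
    h.base_le, h.idx_le, h.cap⟩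
  · dsimp only
    rw [Function.update_of_ne (by lia)]
    exact h.width
  · dsimp only
    rw [Function.update_of_ne (by lia)]
    exact h.zone z
  · dsimp only
    rw [Function.update_of_ne (by lia)]
    exact h.nr b
  · by_cases hk : k' = k
    · subst hk
      simp [St.setS]
    · dsimp only
      rw [Function.update_of_ne fun e => hk (zone_injective h.idx_lt h.idx_lt e).1, h.nsub]
      simp [St.setS, hk]
  · dsimp only
    rw [Function.update_of_ne fun e => by
      have := (zone_injective h2 h.idx_lt e).2
      lia]
    exact h.fresh z' k' h1 h2

/-- Zones beyond `idx` have never been written to and still contain zeros, so an empty memory is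
obtained by moving to the next zone, without clearing what an earlier call has left behind. -/
theorem renew (h : Rep W base idx s M) (hc : 0 < s.cap) :
    Rep W base (idx + 1) s.renew
      { M with nat := Function.update M.nat 44 (base + (idx + 1)) } := by
  have hb := h.base_le
  have hi := h.idx_le
  have hcap := h.cap
  refine ⟨?_, fun z => ?_, fun b => ?_, h.rr, fun z k => ?_, fun k => ?_, fun z k h1 h2 => ?_,
    h.base_le, by lia, by simp only [St.renew]; lia⟩
  · simp [h.width]
  · by_cases hz : z = 2
    · subst hz
      simp [zoneOf]
    · dsimp only
      rw [Function.update_of_ne (by lia), h.zone]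
      simp [zoneOf, hz]
  · dsimp only
    rw [Function.update_of_ne (by lia)]
    exact h.nr b
  · by_cases hz : z = 2
    · subst hz
      simpa [zoneOf, St.renew] using (h.fresh (idx + 1) k (by lia) (by lia)).1
    · have := h.arr z k
      simp only [zoneOf, hz, if_false] at this
      simp only [zoneOf, hz, if_false, this, St.renew]
      rw [Function.update_of_ne hz]
  · dsimp only
    rw [Function.update_of_ne (by lia)]
    exact (h.fresh (idx + 1) k (by lia) (by lia)).2
  · dsimp only
    rw [Function.update_of_ne (by lia)]
    exact h.fresh z k (by lia) h2

end Rep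

/-- Computation of the address used by an instruction. -/
def HOp.prep : HOp → List Op
  | .nload _ b => [.natMul 40 41 b, .natAdd 40 40 44]
  | .nstore a _ => [.natMul 40 41 a, .natAdd 40 40 44]
  | .rload z _ b => [.natMul 40 41 b, .natAdd 40 40 (42 + z)]
  | .rstore z a _ => [.natMul 40 41 a, .natAdd 40 40 (42 + z)]
  | .fresh => [.natConst 40 1]
  | _ => []

/-- The instruction of the real RAM that has the effect of an instruction of the register machine
after its address has been computed. -/
def HOp.main : HOp → Op
  | .nconst a k => .natConst a k
  | .nadd a b c => .natAdd a b c
  | .nmonus a b c => .natSub a b c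
  | .nmul a b c => .natMul a b c
  | .nload a _ => .natLoad a 40
  | .nstore _ b => .natStore 40 b
  | .rofnat a b => .realOfNat a b
  | .radd a b c => .realAdd a b c
  | .rsub a b c => .realSub a b c
  | .rmul a b c => .realMul a b c
  | .rdiv a b c => .realDiv a b c
  | .rload _ a _ => .realLoad a 40
  | .rstore _ _ b => .realStore 40 b
  | .gauss a => .gauss a
  | .unif a => .unif a
  | .fresh => .natAdd 44 44 40

/-- The content of the address register before the main instruction. -/
def HOp.address (W base idx : ℕ) (s : St) : HOp → ℕ → Prop
  | .nload _ b, v => v = base + W * s.nr b + idx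
  | .nstore a _, v => v = base + W * s.nr a + idx
  | .rload z _ b, v => v = base + W * s.nr b + zoneOf idx z
  | .rstore z a _, v => v = base + W * s.nr a + zoneOf idx z
  | .fresh, v => v = 1
  | _, _ => True

theorem HOp.prep_sure {W base idx : ℕ} {s : St} {M : Memory} (h : Rep W base idx s M) (a : HOp) :
    (Cmd.block a.prep : Cmd Op Test).Sure ram M 2
      (fun M' => Rep W base idx s M' ∧ a.address W base idx s (M'.nat 40)) := by
  have hz2 : M.nat 44 = base + idx := by simpa [zoneOf] using h.zone 2
  have hw := h.width
  have hd : ∀ o ∈ a.prep, ram.Det o := by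
    cases a <;> simp [HOp.prep, Machine.Det, ram, Op.eval]
  have hp : ram.pres a.prep M := by
    cases a <;> simp [HOp.prep, Machine.pres, ram]
  refine (Cmd.Sure.block hd hp).mono ?_ ?_
  · cases a <;> simp [HOp.prep]
  · rintro M' rfl
    cases a with
    | nload a b =>
      refine ⟨(h.tmp _).tmp _, ?_⟩
      simp [HOp.address, HOp.prep, Machine.exec, ram, Op.eval, hw, hz2, h.nr]
      lia
    | nstore a b =>
      refine ⟨(h.tmp _).tmp _, ?_⟩
      simp [HOp.address, HOp.prep, Machine.exec, ram, Op.eval, hw, hz2, h.nr]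
      lia
    | rload z a b =>
      refine ⟨(h.tmp _).tmp _, ?_⟩
      have h42 : 42 + (z : ℕ) ≠ 40 := by lia
      simp [HOp.address, HOp.prep, Machine.exec, ram, Op.eval, hw, h.zone, h.nr,
        Function.update_of_ne h42]
      lia
    | rstore z a b =>
      refine ⟨(h.tmp _).tmp _, ?_⟩
      have h42 : 42 + (z : ℕ) ≠ 40 := by lia
      simp [HOp.address, HOp.prep, Machine.exec, ram, Op.eval, hw, h.zone, h.nr,
        Function.update_of_ne h42]
      lia
    | fresh =>
      refine ⟨h.tmp _, ?_⟩
      simp [HOp.address, HOp.prep, Machine.exec, ram, Op.eval]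
    | _ => exact ⟨h, trivial⟩

theorem HOp.main_rep {W base idx : ℕ} {s : St} {M : Memory} (h : Rep W base idx s M) (a : HOp)
    (ha : a.address W base idx s (M.nat 40)) (hp : hl.pre a s) (x : ℝ × ℝ) :
    ∃ idx', Rep W base idx' (hl.ev a x s) (a.main.eval x M) := by
  have hz2 : M.nat 44 = base + idx := by simpa [zoneOf] using h.zone 2
  cases a with
  | nconst a k => exact ⟨_, h.setN a k⟩
  | nadd a b c => exact ⟨_, by simpa [hl, HOp.ev, HOp.main, Op.eval, h.nr] using h.setN a _⟩
  | nmonus a b c => exact ⟨_, by simpa [hl, HOp.ev, HOp.main, Op.eval, h.nr] using h.setN a _⟩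
  | nmul a b c => exact ⟨_, by simpa [hl, HOp.ev, HOp.main, Op.eval, h.nr] using h.setN a _⟩
  | nload a b =>
    simp only [HOp.address] at ha
    exact ⟨_, by simpa [hl, HOp.ev, HOp.main, Op.eval, ha, h.nsub] using h.setN a _⟩
  | nstore a b =>
    simp only [HOp.address] at ha
    exact ⟨_, by simpa [hl, HOp.ev, HOp.main, Op.eval, ha, h.nr] using h.setS _ _⟩
  | rofnat a b => exact ⟨_, by simpa [hl, HOp.ev, HOp.main, Op.eval, h.nr] using h.setR a _⟩
  | radd a b c => exact ⟨_, by simpa [hl, HOp.ev, HOp.main, Op.eval, h.rr] using h.setR a _⟩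
  | rsub a b c => exact ⟨_, by simpa [hl, HOp.ev, HOp.main, Op.eval, h.rr] using h.setR a _⟩
  | rmul a b c => exact ⟨_, by simpa [hl, HOp.ev, HOp.main, Op.eval, h.rr] using h.setR a _⟩
  | rdiv a b c => exact ⟨_, by simpa [hl, HOp.ev, HOp.main, Op.eval, h.rr] using h.setR a _⟩
  | rload z a b =>
    simp only [HOp.address] at ha
    exact ⟨_, by simpa [hl, HOp.ev, HOp.main, Op.eval, ha, h.arr] using h.setR a _⟩
  | rstore z a b =>
    simp only [HOp.address] at ha
    exact ⟨_, by simpa [hl, HOp.ev, HOp.main, Op.eval, ha, h.rr] using h.setA z _ _⟩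
  | gauss a => exact ⟨_, h.setR a x.1⟩
  | unif a => exact ⟨_, h.setR a x.2⟩
  | fresh =>
    simp only [HOp.address] at ha
    refine ⟨idx + 1, ?_⟩
    have := h.renew hp
    simpa [hl, HOp.ev, HOp.main, Op.eval, ha, hz2, add_assoc] using this

/-- The test of the real RAM corresponding to a test of the register machine. -/
def HTest.toTest : HTest → Test
  | .nle a b => .natLe a b
  | .rle a b => .realLe a b

/-- Translation of commands of the register machine. -/
def Cmd.toRam : Cmd HOp HTest → Cmd Op Test
  | .skip => .skip
  | .op a => .seq (.block a.prep) (.op a.main)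
  | .seq c d => .seq c.toRam d.toRam
  | .ite b c d => .ite b.toTest c.toRam d.toRam
  | .loop b c => .loop b.toTest c.toRam

/-- The continuation on memories corresponding to a continuation on states, when `r` additional
steps have to be made. -/
def Cont.lift (W base r : ℕ) (K : Cont St) : Cont Memory :=
  fun M t p => ∃ s t₀ idx, Rep W base idx s M ∧ K s t₀ p ∧ 3 * t₀ + r ≤ t

theorem HTest.holds_iff {W base idx : ℕ} {s : St} {M : Memory} (h : Rep W base idx s M)
    (b : HTest) : ram.holds b.toTest M ↔ hl.holds b s := by
  cases b with
  | nle a b => simp [ram, hl, HTest.toTest, Test.holds, h.nr]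
  | rle a b => simp [ram, hl, HTest.toTest, Test.holds, h.rr]

/-- An instruction becomes at most two address computations and one main instruction, hence the
factor `3` in `Cont.lift`. The offset `r` is the time reserved for what follows the command. -/
theorem Cmd.wp_toRam {W base r : ℕ} (c : Cmd HOp HTest) : ∀ (K : Cont St) (M : Memory) (t : ℕ)
    (p : ℝ≥0∞), (c.wp hl K).lift W base r M t p → c.toRam.wp ram (K.lift W base r) M t p := by
  induction c with
  | skip =>
    rintro K M t p ⟨s, t₀, idx, hM, ⟨u, hu, q, hq, hK⟩, ht⟩
    exact ⟨t, le_rfl, q, hq, s, u, idx, hM, hK, by lia⟩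
  | op a =>
    rintro K M t p ⟨s, t₀, idx, hM, ⟨hpre, u, h, hu, hK, hh⟩, ht⟩
    have := (HOp.prep_sure hM a).wp (K := (Cmd.op a.main).wp ram (K.lift W base r))
      (Cmd.wp_mono _ _) (t := 3 * u + r + 1) (p := p) ?_
    · exact Cmd.wp_mono _ _ _ _ _ _ _ (by lia) le_rfl this
    · rintro M' ⟨hM', ha⟩
      refine ⟨trivial, 3 * u + r, h, le_rfl, fun x => ?_, hh⟩
      obtain ⟨idx', h'⟩ := HOp.main_rep hM' a ha hpre x
      exact ⟨_, u, idx', h', hK x, le_rfl⟩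
  | seq c d ihc ihd =>
    intro K M t p h
    exact c.toRam.wp_conseq (ihd K) _ _ _ (ihc _ M t p h)
  | ite b c d ihc ihd =>
    rintro K M t p ⟨s, t₀, idx, hM, ⟨u, hu, h1, h2⟩, ht⟩
    refine ⟨3 * u + r, by lia, fun hb => ?_, fun hb => ?_⟩
    · exact ihc K M _ p ⟨s, u, idx, hM, h1 ((HTest.holds_iff hM b).1 hb), le_rfl⟩
    · exact ihd K M _ p ⟨s, u, idx, hM, h2 fun h => hb ((HTest.holds_iff hM b).2 h), le_rfl⟩
  | loop b c ih =>
    rintro K M t p ⟨s, t₀, idx, hM, ⟨k, hk⟩, ht⟩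
    refine ⟨k, ?_⟩
    have key : ∀ k M t p, (iterLoop (hl.holds b) (c.wp hl) K k).lift W base r M t p →
        iterLoop (ram.holds b.toTest) (c.toRam.wp ram) (K.lift W base r) k M t p := by
      intro k
      induction k with
      | zero =>
        rintro M t p ⟨s, t₀, idx, hM, hk, ht⟩
        exact hk.elim
      | succ k ihk =>
        rintro M t p ⟨s, t₀, idx, hM, ⟨u, hu, h1, h2⟩, ht⟩
        refine ⟨3 * u + r, by lia, fun hb => ?_, fun hb => ?_⟩
        · exact c.toRam.wp_conseq ihk _ _ _ (ih _ M _ p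
            ⟨s, u, idx, hM, h1 ((HTest.holds_iff hM b).1 hb), le_rfl⟩)
        · obtain ⟨v, hv, q, hq, hK⟩ := h2 fun h => hb ((HTest.holds_iff hM b).2 h)
          exact ⟨3 * v + r, by lia, q, hq, s, v, idx, hM, hK, le_rfl⟩
    exact key k M t p ⟨s, t₀, idx, hM, hk, ht⟩

/-- Specifications of commands of the register machine hold for their implementations. -/
theorem Cmd.Spec.toRam {c : Cmd HOp HTest} {s : St} {T : ℕ} {I G : St → Prop} {δ : ℝ≥0∞}
    (h : c.Spec hl s T I G δ) {W base idx : ℕ} {M : Memory} (hM : Rep W base idx s M)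
    {G' : Memory → Prop} (hG : ∀ s' idx' M', Rep W base idx' s' M' → G s' → G' M') :
    c.toRam.Spec ram M (3 * T) (fun _ => True) G' δ := by
  intro K hK t a b hb0 ha hb
  have h1 := h (fun s' _ p' => (G s' ∧ a ≤ p') ∨ a + b ≤ p')
    (fun _ _ _ _ _ _ hp h => h.imp (fun h => ⟨h.1, h.2.trans hp⟩) fun h => h.trans hp) 0 a b hb0
    (fun s' _ g => Or.inl ⟨g, le_rfl⟩) (fun s' _ => Or.inr le_rfl)
  refine Cmd.wp_conseq _ ?_ _ _ _
    (Cmd.wp_toRam (r := t) c _ M (3 * T + t) _ ⟨s, T + 0, idx, hM, h1, by lia⟩)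
  rintro M' t' p' ⟨s', t₀, idx', hM', h', ht'⟩
  rcases h' with ⟨g, hp⟩ | hp
  · exact hK _ _ _ _ _ (by lia) hp (ha M' trivial (hG _ _ _ hM' g))
  · exact hK _ _ _ _ _ (by lia) hp (hb M' trivial)

/-! ## Calling a program as a subroutine -/

/-- Turns a bound on a failure probability into the form `a + δ * b` required by `Cmd.Spec`. -/
theorem Program.Good.affine {P : Program} {bad : Memory → ℝ≥0∞} {a b : ℝ≥0∞} (hb : b ≠ ∞) {t : ℕ}
    {s : Config P.Label} {p : ℝ≥0∞} (h : P.Good bad t s p) :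
    P.Good (fun M => a + b * bad M) t s (a + b * p) := by
  induction t generalizing s p with
  | zero => exact ⟨h.1, by have := h.2; dsimp only; gcongr⟩
  | succ t ih =>
    rcases h with h | ⟨hpc, h, h1, h2⟩
    · exact Or.inl ⟨h.1, by have := h.2; dsimp only; gcongr⟩
    · refine Or.inr ⟨hpc, fun x => a + b * h x, fun x => ih (h1 x), ?_⟩
      rw [lintegral_add_left measurable_const, lintegral_const_mul' _ _ hb]
      simp only [lintegral_const, measure_univ, mul_one]
      gcongr

/-- The part of the state that is not touched by a subroutine. -/
structure Frame (s₀ s : St) : Prop where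
  cap : s.cap = s₀.cap
  inp : s.arr 0 = s₀.arr 0
  sys : s.arr 1 = s₀.arr 1
  nr : ∀ a : Fin 32, a.val < 25 → s.nr a = s₀.nr a
  rr : ∀ a : Fin 16, a.val < 13 → s.rr a = s₀.rr a

theorem Frame.refl (s : St) : Frame s s := ⟨rfl, rfl, rfl, fun _ _ => rfl, fun _ _ => rfl⟩

theorem Frame.trans {s₀ s₁ s₂ : St} (h : Frame s₀ s₁) (h' : Frame s₁ s₂) : Frame s₀ s₂ :=
  ⟨h'.cap.trans h.cap, h'.inp.trans h.inp, h'.sys.trans h.sys,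
    fun a ha => (h'.nr a ha).trans (h.nr a ha), fun a ha => (h'.rr a ha).trans (h.rr a ha)⟩

theorem Frame.setN (s : St) {a : Fin 32} (ha : 25 ≤ a.val) (v : ℕ) : Frame s (s.setN a v) :=
  ⟨rfl, rfl, rfl, fun b hb => Function.update_of_ne (by rintro rfl; lia) _ _, fun _ _ => rfl⟩

theorem Frame.setR (s : St) {a : Fin 16} (ha : 13 ≤ a.val) (v : ℝ) : Frame s (s.setR a v) :=
  ⟨rfl, rfl, rfl, fun _ _ => rfl, fun b hb => Function.update_of_ne (by rintro rfl; lia) _ _⟩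

theorem Frame.setA (s : St) (k : ℕ) (v : ℝ) : Frame s (s.setA 2 k v) :=
  ⟨rfl, by simp [St.setA], by simp [St.setA], fun _ _ => rfl, fun _ _ => rfl⟩

theorem Frame.setS (s : St) (k v : ℕ) : Frame s (s.setS k v) :=
  ⟨rfl, rfl, rfl, fun _ _ => rfl, fun _ _ => rfl⟩

/-- The memory of the subroutine. -/
def St.subMem (s : St) : Memory := ⟨s.nsub, s.arr 2⟩

/-- Simulation of an instruction on the memory of the subroutine: the first instruction. -/
def Op.simHead : Op → HOp
  | .natConst a _ => .nconst 26 a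
  | .natAdd _ b _ => .nconst 26 b
  | .natSub _ b _ => .nconst 26 b
  | .natMul _ b _ => .nconst 26 b
  | .natLoad _ b => .nconst 26 b
  | .natStore _ b => .nconst 26 b
  | .realOfNat _ b => .nconst 26 b
  | .realAdd _ b _ => .nconst 26 b
  | .realSub _ b _ => .nconst 26 b
  | .realMul _ b _ => .nconst 26 b
  | .realDiv _ b _ => .nconst 26 b
  | .realLoad _ b => .nconst 26 b
  | .realStore _ b => .nconst 26 b
  | .gauss _ => .gauss 13
  | .unif _ => .unif 13

/-- Simulation of an instruction on the memory of the subroutine: the remaining instructions. -/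
def Op.simTail : Op → List HOp
  | .natConst _ k => [.nconst 27 k, .nstore 26 27]
  | .natAdd a _ c => [.nload 27 26, .nconst 26 c, .nload 28 26, .nadd 27 27 28, .nconst 26 a,
      .nstore 26 27]
  | .natSub a _ c => [.nload 27 26, .nconst 26 c, .nload 28 26, .nmonus 27 27 28, .nconst 26 a,
      .nstore 26 27]
  | .natMul a _ c => [.nload 27 26, .nconst 26 c, .nload 28 26, .nmul 27 27 28, .nconst 26 a,
      .nstore 26 27]
  | .natLoad a _ => [.nload 26 26, .nload 27 26, .nconst 26 a, .nstore 26 27]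
  | .natStore a _ => [.nload 27 26, .nconst 26 a, .nload 26 26, .nstore 26 27]
  | .realOfNat a _ => [.nload 27 26, .rofnat 13 27, .nconst 26 a, .rstore 2 26 13]
  | .realAdd a _ c => [.rload 2 13 26, .nconst 26 c, .rload 2 14 26, .radd 13 13 14, .nconst 26 a,
      .rstore 2 26 13]
  | .realSub a _ c => [.rload 2 13 26, .nconst 26 c, .rload 2 14 26, .rsub 13 13 14, .nconst 26 a,
      .rstore 2 26 13]
  | .realMul a _ c => [.rload 2 13 26, .nconst 26 c, .rload 2 14 26, .rmul 13 13 14, .nconst 26 a,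
      .rstore 2 26 13]
  | .realDiv a _ c => [.rload 2 13 26, .nconst 26 c, .rload 2 14 26, .rdiv 13 13 14, .nconst 26 a,
      .rstore 2 26 13]
  | .realLoad a _ => [.nload 26 26, .rload 2 13 26, .nconst 26 a, .rstore 2 26 13]
  | .realStore a _ => [.rload 2 13 26, .nconst 26 a, .nload 26 26, .rstore 2 26 13]
  | .gauss a => [.nconst 26 a, .rstore 2 26 13]
  | .unif a => [.nconst 26 a, .rstore 2 26 13]

theorem HOp.det_of_ne {a : HOp} (h1 : ∀ r, a ≠ .gauss r) (h2 : ∀ r, a ≠ .unif r) : hl.Det a := by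
  intro x y s
  cases a with
  | gauss r => exact (h1 r rfl).elim
  | unif r => exact (h2 r rfl).elim
  | _ => rfl

theorem Op.det_simTail (o : Op) : ∀ a ∈ o.simTail, hl.Det a := by
  intro a ha
  apply HOp.det_of_ne
  all_goals
    rintro r rfl
    cases o <;> simp [Op.simTail] at ha

theorem Op.pres_simTail (o : Op) (s : St) : hl.pres o.simTail s := by
  cases o <;> simp [Op.simTail, Machine.pres, hl]

theorem Op.sim_frame (o : Op) (x : ℝ × ℝ) (s : St) :
    Frame s (hl.exec o.simTail (hl.ev o.simHead x s)) := by
  have hN {s₁ : St} {a : Fin 32} (v : ℕ) (ha : 25 ≤ a.val) (h : Frame s s₁) :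
    Frame s (s₁.setN a v) := h.trans (Frame.setN _ ha _)
  have hR {s₁ : St} {a : Fin 16} (v : ℝ) (ha : 13 ≤ a.val) (h : Frame s s₁) :
    Frame s (s₁.setR a v) := h.trans (Frame.setR _ ha _)
  have hA {s₁ : St} (k : ℕ) (v : ℝ) (h : Frame s s₁) : Frame s (s₁.setA 2 k v) :=
    h.trans (Frame.setA _ _ _)
  have hS {s₁ : St} (k v : ℕ) (h : Frame s s₁) : Frame s (s₁.setS k v) :=
    h.trans (Frame.setS _ _ _)
  cases o <;>
  · dsimp only [Op.simTail, Op.simHead, Machine.exec, hl, HOp.ev]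
    repeat' first
      | exact Frame.refl _
      | refine hN _ (by decide) ?_
      | refine hR _ (by decide) ?_
      | refine hA _ _ ?_
      | refine hS _ _ ?_

theorem Op.sim_eval (o : Op) (x : ℝ × ℝ) (s : St) :
    (hl.exec o.simTail (hl.ev o.simHead x s)).subMem = o.eval x s.subMem := by
  cases o <;>
    simp [Op.simTail, Op.simHead, Machine.exec, hl, HOp.ev, St.subMem, Op.eval, St.setN, St.setR,
      St.setA, St.setS]

/-- Only the first instruction may be random. This is why the simulation of an instruction is split
into `Op.simHead` and the deterministic `Op.simTail`. -/
theorem Cmd.wp_cons_block {a : HOp} {l : List HOp} (hl' : ∀ a ∈ l, hl.Det a) {K : Cont St}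
    (hK : K.Mono) {s : St} {t : ℕ} {p : ℝ≥0∞} {h : ℝ × ℝ → ℝ≥0∞} (ha : hl.pre a s)
    (hp : ∀ s, hl.pres l s) (h1 : ∀ x, K (hl.exec l (hl.ev a x s)) t (h x))
    (h2 : ∫⁻ x, h x ∂sampleLaw ≤ p) :
    (Cmd.seq (.op a) (.block l) : Cmd HOp HTest).wp hl K s (l.length + 1 + t) p := by
  refine ⟨ha, l.length + t, h, by lia, fun x => ?_, h2⟩
  exact (Cmd.Sure.block hl' (hp _)).wp hK fun s' e => e ▸ h1 x

/-- Execution of the command whose number is one less than the content of register `25`. -/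
def dispatch : List (Cmd HOp HTest) → ℕ → Cmd HOp HTest
  | [], _ => .skip
  | c :: cs, j => .seq (.op (.nconst 26 (j + 1))) (.ite (.nle 25 26) c (dispatch cs (j + 1)))

theorem dispatch_wp (cs : List (Cmd HOp HTest)) (j i : ℕ) (hi : i < cs.length) {K : Cont St}
    {s : St} {t : ℕ} {p : ℝ≥0∞} (hs : s.nr 25 = j + i + 1)
    (h : ∀ v, (cs[i]).wp hl K (s.setN 26 v) t p) :
    (dispatch cs j).wp hl K s (2 * cs.length + t) p := by
  induction cs generalizing j i s with
  | nil => simp at hi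
  | cons c cs ih =>
    refine ⟨trivial, 2 * cs.length + t + 1, fun _ => p, by simp; lia, fun x => ?_, by simp⟩
    refine ⟨2 * cs.length + t, le_rfl, fun hb => ?_, fun hb => ?_⟩
    · have : i = 0 := by
        simp [hl, HOp.ev, St.setN, hs] at hb
        lia
      subst this
      exact Cmd.wp_mono _ _ _ _ _ _ _ (by lia) le_rfl (h (j + 1))
    · have hi0 : i ≠ 0 := by
        rintro rfl
        simp [hl, HOp.ev, St.setN, hs] at hb
      obtain ⟨i, rfl⟩ := Nat.exists_eq_succ_of_ne_zero hi0
      refine ih (j + 1) i (by simpa using hi) ?_ fun v => ?_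
      · simp [hl, HOp.ev, St.setN, hs]
        lia
      · have : (hl.ev (HOp.nconst 26 (j + 1)) x s).setN 26 v = s.setN 26 v := by
          simp [hl, HOp.ev, St.setN]
        rw [this]
        exact h v

section Subroutine

variable (P : Program)

/-- The number of labels. -/
def Program.numLabels : ℕ := (Finite.exists_equiv_fin (α := P.Label) (h := P.finite_label)).choose

/-- A numbering of the labels. -/
def Program.labelEquiv : P.Label ≃ Fin P.numLabels :=
  (Finite.exists_equiv_fin (α := P.Label) (h := P.finite_label)).choose_spec.some

/-- The encoding of program counters: `0` means that the machine has halted. -/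
def Program.encPc : Option P.Label → ℕ
  | none => 0
  | some l => P.labelEquiv l + 1

/-- Simulation of an instruction of a program. -/
def Program.simInstr : Instr P.Label → Cmd HOp HTest
  | .exec o k => .seq (.seq (.op o.simHead) (.block o.simTail)) (.op (.nconst 25 (P.encPc k)))
  | .branch (.natLe a b) k k' =>
      .seq (.block [.nconst 26 a, .nload 27 26, .nconst 26 b, .nload 28 26])
        (.ite (.nle 27 28) (.op (.nconst 25 (P.encPc k))) (.op (.nconst 25 (P.encPc k'))))
  | .branch (.realLe a b) k k' =>
      .seq (.block [.nconst 26 a, .rload 2 13 26, .nconst 26 b, .rload 2 14 26])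
        (.ite (.rle 13 14) (.op (.nconst 25 (P.encPc k))) (.op (.nconst 25 (P.encPc k'))))

/-- Simulation of all the instructions. -/
def Program.simTable : List (Cmd HOp HTest) :=
  List.ofFn fun i => P.simInstr (P.code (P.labelEquiv.symm i))

/-- Execution of a program on the memory of the subroutine. -/
def Program.call : Cmd HOp HTest :=
  .seq (.op (.nconst 25 (P.encPc (some P.start))))
    (.seq (.op (.nconst 26 1))
      (.loop (.nle 26 25) (.seq (dispatch P.simTable 0) (.op (.nconst 26 1)))))

theorem Op.simTail_length (o : Op) : o.simTail.length ≤ 6 := by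
  cases o <;> simp [Op.simTail]

/-- `s` represents the configuration `c`, and differs from `s₀` only in the subroutine. -/
structure SimRel (s₀ s : St) (c : Config P.Label) : Prop where
  frame : Frame s₀ s
  mem : s.subMem = c.mem
  pc : s.nr 25 = P.encPc c.pc

variable {P}

theorem Program.simInstr_wp {s₀ s : St} {l : P.Label} {M : Memory}
    (hs : SimRel P s₀ s ⟨some l, M⟩) {K : Cont St} {t : ℕ} {p : ℝ≥0∞}
    {h : ℝ × ℝ → ℝ≥0∞} (h1 : ∀ x s', SimRel P s₀ s' (P.step x ⟨some l, M⟩) → K s' t (h x))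
    (h2 : ∫⁻ x, h x ∂sampleLaw ≤ p) : (P.simInstr (P.code l)).wp hl K s (8 + t) p := by
  have hmem := hs.mem
  dsimp only at hmem
  cases hc : P.code l with
  | exec o k =>
    have hlen := o.simTail_length
    refine Cmd.wp_mono _ _ _ _ _ _ _ (show o.simTail.length + 1 + (t + 1) ≤ 8 + t by lia) le_rfl
      (Cmd.wp_cons_block o.det_simTail (Cmd.wp_mono _ _) ?_ (o.pres_simTail) (h := h) ?_ h2)
    · cases o <;> trivial
    · intro x
      refine ⟨trivial, t, fun _ => h x, le_rfl, fun y => h1 x _ ?_, by simp⟩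
      rw [Program.step_exec hc]
      refine ⟨(hs.frame.trans (o.sim_frame x s)).trans (Frame.setN _ (by decide) _), ?_, ?_⟩
      · exact (o.sim_eval x s).trans (by rw [hmem])
      · simp [hl, HOp.ev, St.setN]
  | branch b k k' =>
    classical
    have key : ∀ s₁ : St, Frame s s₁ → s₁.subMem = s.subMem → ∀ k'', (∀ x, P.step x ⟨some l, M⟩ =
        ⟨k'', M⟩) →
        (Cmd.op (HOp.nconst 25 (P.encPc k'')) : Cmd HOp HTest).wp hl K s₁ (1 + t) p := by
      intro s₁ hf hm k'' hk
      refine ⟨trivial, t, h, by lia, fun x => h1 x _ ?_, h2⟩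
      rw [hk x]
      refine ⟨(hs.frame.trans hf).trans (Frame.setN _ (by decide) _), hm.trans hmem, ?_⟩
      simp [hl, HOp.ev, St.setN]
    have hstep : ∀ x, P.step x ⟨some l, M⟩ = ⟨if b.holds M then k else k', M⟩ := by
      intro x
      by_cases hb : b.holds M
      · simp only [Program.step_yes hc x hb, hb, if_true]
      · simp only [Program.step_no hc x hb, hb, if_false]
    have hite : ∀ (l : List HOp) (b' : HTest), l.length = 4 → (∀ a ∈ l, hl.Det a) → hl.pres l s →
        Frame s (hl.exec l s) → (hl.exec l s).subMem = s.subMem →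
        (hl.holds b' (hl.exec l s) ↔ b.holds M) →
        (Cmd.seq (.block l) (.ite b' (.op (.nconst 25 (P.encPc k)))
          (.op (.nconst 25 (P.encPc k')))) : Cmd HOp HTest).wp hl K s (8 + t) p := by
      intro l b' hlen hdet hpres hf hm hb'
      refine Cmd.wp_mono _ _ _ _ _ _ _ (show l.length + (2 + t) ≤ 8 + t by lia) le_rfl
        ((Cmd.Sure.block hdet hpres).wp (Cmd.wp_mono _ _) ?_)
      rintro s' rfl
      refine ⟨1 + t, by lia, fun hb => ?_, fun hb => ?_⟩
      · exact key _ hf hm _ fun x => by rw [hstep, if_pos (hb'.1 hb)]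
      · exact key _ hf hm _ fun x => by rw [hstep, if_neg fun h => hb (hb'.2 h)]
    have hN {s₁ : St} {a : Fin 32} (v : ℕ) (ha : 25 ≤ a.val) (h : Frame s s₁) :
      Frame s (s₁.setN a v) := h.trans (Frame.setN _ ha _)
    have hR {s₁ : St} {a : Fin 16} (v : ℝ) (ha : 13 ≤ a.val) (h : Frame s s₁) :
      Frame s (s₁.setR a v) := h.trans (Frame.setR _ ha _)
    have hmem' : s.nsub = M.nat ∧ s.arr 2 = M.real := by
      rw [← hmem]
      exact ⟨rfl, rfl⟩
    cases b with
    | natLe a b =>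
      refine hite _ _ rfl ?_ ?_ ?_ rfl ?_
      · simp [Machine.Det, hl, HOp.ev]
      · simp [Machine.pres, hl]
      · exact hN _ (by decide) (hN _ (by decide) (hN _ (by decide) (hN _ (by decide) (.refl _))))
      · simp [Machine.exec, hl, HOp.ev, St.setN, Test.holds, hmem']
    | realLe a b =>
      refine hite _ _ rfl ?_ ?_ ?_ rfl ?_
      · simp [Machine.Det, hl, HOp.ev]
      · simp [Machine.pres, hl]
      · exact hR _ (by decide) (hN _ (by decide) (hR _ (by decide) (hN _ (by decide) (.refl _))))
      · simp [Machine.exec, hl, HOp.ev, St.setN, St.setR, Test.holds, hmem']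

/-- One simulated step costs `2 * P.numLabels` for finding the instruction in the table, `8` for its
simulation, one for restoring the constant `1` in register `26`, and one for the loop test. That
test asks whether the encoded program counter is at least `1`, which means that the simulated
machine has not halted. -/
theorem Program.loop_wp {bad : Memory → ℝ≥0∞} {s₀ : St} {K : Cont St} {u : ℕ}
    (hend : ∀ s M p, SimRel P s₀ s ⟨none, M⟩ → bad M ≤ p → K s u p) {t : ℕ} {c : Config P.Label}
    {p : ℝ≥0∞} (h : P.Good bad t c p) {s : St} (hs : SimRel P s₀ s c) (h26 : s.nr 26 = 1) :
    iterLoop (hl.holds (.nle 26 25)) ((Cmd.seq (dispatch P.simTable 0) (.op (.nconst 26 1))).wp hl)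
      K (t + 1) s (t * (2 * P.numLabels + 10) + 1 + u) p := by
  have halted : ∀ (c : Config P.Label) s p t, SimRel P s₀ s c → s.nr 26 = 1 → c.pc = none →
      bad c.mem ≤ p →
      iterLoop (hl.holds (.nle 26 25))
        ((Cmd.seq (dispatch P.simTable 0) (.op (.nconst 26 1))).wp hl)
        K (t + 1) s (t * (2 * P.numLabels + 10) + 1 + u) p := by
    intro c s p t hs h26 hpc hp
    have h25 : s.nr 25 = 0 := by
      rw [hs.pc, hpc]
      rfl
    refine ⟨t * (2 * P.numLabels + 10) + u, by lia, fun hb => ?_, fun _ =>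
      ⟨u, by lia, p, le_rfl, hend s c.mem p ?_ hp⟩⟩
    · simp [hl, h25, h26] at hb
    · obtain ⟨pc, mem⟩ := c
      subst hpc
      exact hs
  induction t generalizing c s p with
  | zero => exact halted _ _ _ 0 hs h26 h.1 h.2
  | succ t ih =>
    rcases h with h | ⟨hpc, h, h1, h2⟩
    · exact halted _ _ _ _ hs h26 h.1 h.2
    obtain ⟨pc, M⟩ := c
    cases pc with
    | none => exact (hpc rfl).elim
    | some l =>
      refine ⟨2 * P.numLabels + 8 + (1 + (t * (2 * P.numLabels + 10) + 1 + u)), by ring_nf; lia,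
        fun hb => ?_, fun hb => ?_⟩
      · have hlen : P.simTable.length = P.numLabels := by simp [Program.simTable]
        have := dispatch_wp P.simTable 0 (P.labelEquiv l) (by rw [hlen]; exact (P.labelEquiv l).2)
          (K := (Cmd.op (.nconst 26 1) : Cmd HOp HTest).wp hl
            (iterLoop (hl.holds (.nle 26 25))
              ((Cmd.seq (dispatch P.simTable 0) (.op (.nconst 26 1))).wp hl) K (t + 1)))
          (s := s) (t := 8 + (1 + (t * (2 * P.numLabels + 10) + 1 + u))) (p := p)
          (by rw [hs.pc]; simp [Program.encPc]) ?_
        · exact Cmd.wp_mono _ _ _ _ _ _ _ (by rw [hlen]; lia) le_rfl this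
        · intro v
          have hcode : P.simTable[(P.labelEquiv l : ℕ)]'(by
              rw [hlen]; exact (P.labelEquiv l).2) = P.simInstr (P.code l) := by
            simp [Program.simTable]
          rw [hcode]
          refine Program.simInstr_wp (s₀ := s₀) (M := M) ?_ (h := h) ?_ h2
          · exact ⟨hs.frame.trans (Frame.setN _ (by decide) _), hs.mem, by
              simp [St.setN, hs.pc]⟩
          · intro x s' hs'
            refine ⟨trivial, t * (2 * P.numLabels + 10) + 1 + u, fun _ => h x, by lia,
              fun y => ?_, by simp⟩
            refine ih (h1 x) ⟨hs'.frame.trans (Frame.setN _ (by decide) _), hs'.mem, ?_⟩ ?_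
            · simp [hl, HOp.ev, St.setN, hs'.pc]
            · simp [hl, HOp.ev, St.setN]
      · simp [hl, h26, hs.pc, Program.encPc] at hb

/-- The specification of a subroutine call. -/
theorem Program.call_spec {s : St} {T : ℕ} {B : Set Memory} {δ : ℝ≥0∞}
    (hhalt : ∀ ξ, (P.run s.subMem ξ T).pc = none)
    (hB : tapeLaw {ξ | (P.run s.subMem ξ T).mem ∈ B} ≤ δ) :
    P.call.Spec hl s (T * (2 * P.numLabels + 10) + 3) (Frame s) (fun s' => s'.subMem ∉ B) δ := by
  intro K hK t a b hb0 ha hb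
  simp only [Program.run_eq_runFrom] at hhalt hB
  have hgood := ((P.good_of_halts B hhalt).mono le_rfl hB).affine (a := a) hb0
  refine ⟨trivial, T * (2 * P.numLabels + 10) + 2 + t, fun _ => a + δ * b, by lia, fun x => ?_,
    by simp⟩
  refine ⟨trivial, T * (2 * P.numLabels + 10) + 1 + t, fun _ => a + δ * b, by lia, fun x => ?_,
    by simp⟩
  refine ⟨T + 1, ?_⟩
  rw [mul_comm δ b]
  refine Program.loop_wp (s₀ := s) ?_ hgood ⟨?_, rfl, ?_⟩ ?_
  · intro s' M p hs' hp
    have hM : s'.subMem = M := hs'.mem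
    subst hM
    by_cases hM : s'.subMem ∈ B
    · refine hK _ _ _ _ _ le_rfl hp ?_
      simpa [hM] using hb s' hs'.frame
    · refine hK _ _ _ _ _ le_rfl hp ?_
      simpa [hM] using ha s' hs'.frame hM
  · exact (Frame.setN _ (by decide) _).trans (Frame.setN _ (by decide) _)
  · simp [hl, HOp.ev, St.setN]
  · simp [hl, HOp.ev, St.setN]

end Subroutine

/-! ## Drawing an array of uniform samples -/

/-- The uniform distribution on `[0,1]`. -/
def unifLaw : Measure ℝ := (volume : Measure ℝ).restrict (Set.Icc 0 1)

instance : IsProbabilityMeasure unifLaw := by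
  unfold unifLaw
  infer_instance

theorem lintegral_sampleLaw_snd_le (h : ℝ → ℝ≥0∞) :
    ∫⁻ x, h x.2 ∂sampleLaw ≤ ∫⁻ y, h y ∂unifLaw := by
  refine (lintegral_prod_le _).trans ?_
  simp [unifLaw]

/-- Iterated integral over the entries `k, …, k + m - 1` of a sequence. -/
def iterUnif (f : (ℕ → ℝ) → ℝ≥0∞) : ℕ → ℕ → (ℕ → ℝ) → ℝ≥0∞
  | _, 0, w => f w
  | k, m + 1, w => ∫⁻ x, iterUnif f (k + 1) m (Function.update w k x) ∂unifLaw

/-- The half of Tonelli's theorem that holds for arbitrary sets, again by a measurable hull. -/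
theorem lintegral_section_le {α β : Type*} [MeasurableSpace α] [MeasurableSpace β]
    (μ : Measure α) [SFinite μ]
    (ν : Measure β) [SFinite ν] (S : Set (α × β)) :
    ∫⁻ x, ν (Prod.mk x ⁻¹' S) ∂μ ≤ μ.prod ν S := by
  rw [← measure_toMeasurable S, Measure.prod_apply (measurableSet_toMeasurable _ S)]
  exact lintegral_mono fun x => measure_mono fun y h => subset_toMeasurable _ _ h

/-- Replacement of `m` entries of a sequence, starting at position `k`. -/
def patch (k m : ℕ) (v : Fin m → ℝ) (w : ℕ → ℝ) (j : ℕ) : ℝ :=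
  if h : k ≤ j ∧ j < k + m then v ⟨j - k, by lia⟩ else w j

theorem patch_cons (k m : ℕ) (v : Fin (m + 1) → ℝ) (w : ℕ → ℝ) :
    patch (k + 1) m (fun i => v i.succ) (Function.update w k (v 0)) = patch k (m + 1) v w := by
  funext j
  unfold patch
  by_cases hj : j = k
  · subst hj
    simp
  · by_cases h : k ≤ j ∧ j < k + (m + 1)
    · rw [dif_pos h, dif_pos (by lia)]
      exact congrArg v (Fin.ext (by simp; lia))
    · rw [dif_neg h, dif_neg (by lia), Function.update_of_ne hj]

theorem iterUnif_le (S : Set (ℕ → ℝ)) (k m : ℕ) (w : ℕ → ℝ) :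
    iterUnif (S.indicator 1) k m w ≤
      Measure.pi (fun _ : Fin m => unifLaw) {v | patch k m v w ∈ S} := by
  induction m generalizing k w with
  | zero =>
    have : ∀ v : Fin 0 → ℝ, patch k 0 v w = w := fun v => by
      funext j
      simp [patch]
    simp only [iterUnif, this]
    by_cases h : w ∈ S
    · simp [h]
    · simp [h]
  | succ m ih =>
    have hmp := measurePreserving_piFinSuccAbove (fun _ : Fin (m + 1) => unifLaw) 0
    have heq : Measure.pi (fun _ : Fin (m + 1) => unifLaw) {v | patch k (m + 1) v w ∈ S} =
        (unifLaw.prod (Measure.pi fun _ : Fin m => unifLaw))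
          {z | patch (k + 1) m z.2 (Function.update w k z.1) ∈ S} := by
      rw [← hmp.measure_preimage_equiv]
      congr 1
      ext v
      simp only [Set.mem_ofPred_eq, Set.mem_preimage, ← patch_cons k m v w]
      rfl
    rw [heq]
    refine le_trans (lintegral_mono fun x => ih (k + 1) (Function.update w k x)) ?_
    exact lintegral_section_le unifLaw (Measure.pi fun _ : Fin m => unifLaw)
      {z | patch (k + 1) m z.2 (Function.update w k z.1) ∈ S}

theorem iterUnif_zero_le (n : ℕ) (S : Set (Fin n → ℝ)) (w : ℕ → ℝ) :
    iterUnif ({w : ℕ → ℝ | (fun i : Fin n => w i) ∈ S}.indicator 1) 0 n w ≤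
      Measure.pi (fun _ : Fin n => unifLaw) S := by
  refine (iterUnif_le _ _ _ _).trans (le_of_eq ?_)
  congr 1
  ext v
  simp [patch]

/-- A loop that draws a uniform sample in each of its `n` rounds. -/
theorem Cmd.Spec.draw_loop {b : HTest} {r : Fin 16} {d : Cmd HOp HTest} {T n : ℕ}
    (Inv : (ℕ → ℝ) → ℕ → St → Prop)
    (hb : ∀ w k s, k < n → Inv w k s → hl.holds b s)
    (hd : ∀ w k s, k < n → Inv w k s → ∀ x,
      d.Sure hl (s.setR r x) T (Inv (Function.update w k x) (k + 1)))
    (h0 : ∀ w s, Inv w n s → ¬ hl.holds b s) (w : ℕ → ℝ) (s : St) (hs : Inv w 0 s)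
    (S : Set (Fin n → ℝ)) :
    (Cmd.loop b (.seq (.op (.unif r)) d)).Spec hl s (n * (T + 2) + 1) (fun s' => ∃ w, Inv w n s')
      (fun s' => ∃ w : ℕ → ℝ, (fun i : Fin n => w i) ∉ S ∧ Inv w n s')
      (Measure.pi (fun _ : Fin n => unifLaw) S) := by
  intro K hK t p q hq0 hp hq
  set B : Set (ℕ → ℝ) := {w : ℕ → ℝ | (fun i : Fin n => w i) ∈ S} with hB
  -- With `m` draws to go, the budget contains the iterated integral over those draws: the
  -- probability of `S` conditional on the `k` samples already stored in `w`.
  have key : ∀ m k w s, k + m = n → Inv w k s →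
      iterLoop (hl.holds b) ((Cmd.seq (.op (.unif r)) d).wp hl) K (m + 1) s
        (m * (T + 2) + 1 + t) (p + iterUnif (B.indicator 1) k m w * q) := by
    intro m
    induction m with
    | zero =>
      intro k w s hk hs
      simp only [add_zero] at hk
      subst hk
      refine ⟨t, by lia, fun hb => (h0 w s hs hb).elim,
        fun _ => ⟨t, le_rfl, p + iterUnif (B.indicator 1) k 0 w * q, le_rfl, ?_⟩⟩
      by_cases hw : w ∈ B
      · simpa [iterUnif, hw] using hq s ⟨w, hs⟩
      · simpa [iterUnif, hw] using hp s ⟨w, hs⟩ ⟨w, hw, hs⟩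
    | succ m ih =>
      intro k w s hk hs
      refine ⟨T + 1 + (m * (T + 2) + 1 + t), by ring_nf; lia, fun _ => ?_,
        fun h => (h (hb w k s (by lia) hs)).elim⟩
      refine ⟨trivial, T + (m * (T + 2) + 1 + t),
        fun x => p + iterUnif (B.indicator 1) (k + 1) m (Function.update w k x.2) * q, by lia,
        fun x => ?_, ?_⟩
      · exact (hd w k s (by lia) hs x.2).wp (iterLoop_mono (fun K => Cmd.wp_mono _ K) _)
          fun s' hs' => ih (k + 1) _ s' (by lia) hs'
      · rw [lintegral_add_left measurable_const, lintegral_mul_const' _ _ hq0]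
        simp only [lintegral_const, measure_univ, mul_one, iterUnif]
        gcongr
        exact lintegral_sampleLaw_snd_le
          fun x => iterUnif (B.indicator 1) (k + 1) m (Function.update w k x)
  refine ⟨n + 1, iterLoop_mono (fun K => Cmd.wp_mono _ K) _ _ _ _ _ _ le_rfl ?_
    (key n 0 w s (by lia) hs)⟩
  gcongr
  exact iterUnif_zero_le n S w

/-! ## The linear systems -/

/-- Numerical data of the rank finding algorithm: the number `n` of columns of the input, the
number of unknowns minus one, the size of the block containing the input, the number of bits, the
input and the accuracy. -/
structure Dat where
  n : ℕ
  N₁ : ℕ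
  h : ℕ
  ell : ℕ
  inp : ℕ → ℝ
  th : ℝ

/-- The number of unknowns. -/
def Dat.N (d : Dat) : ℕ := d.N₁ + 1

/-- Entry `(i, j)` of the linear system with random entries `w`. -/
def Dat.entry (d : Dat) (e : ℕ) (x : ℝ) (i j : ℕ) : ℝ :=
  -- For index blocks of sizes `h`, `e - h`, `N₁ - e` and `1` the block rows are `(A, U, 0, g)`,
  -- `(V, I, 0, g')`, `(0, 0, I, g'')`, `(0, 0, 0, th²)`. One sample `x` is drawn for every position
  -- and ignored where the entry is not random.
  if d.N₁ ≤ i then (if d.N₁ ≤ j then d.th * d.th else 0)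
  else if d.N₁ ≤ j then x
  else if d.h ≤ i then
    if d.h ≤ j then (if i = j then 1 else 0)
    else if e ≤ i then 0 else x
  else if d.h ≤ j then (if e ≤ j then 0 else x)
  else if d.n ≤ j then 0 else d.inp (d.n * i + j)

/-- The row-major list of the entries of the linear system. -/
def Dat.flat (d : Dat) (e : ℕ) (w : ℕ → ℝ) (k : ℕ) : ℝ := d.entry e (w k) (k / d.N) (k % d.N)

/-- The registers with the data of the algorithm. -/
structure Dat.Ctx (d : Dat) (s : St) : Prop where
  n : s.nr 1 = d.n
  N : s.nr 2 = d.N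
  N₁ : s.nr 3 = d.N₁
  h : s.nr 4 = d.h
  ell : s.nr 5 = d.ell
  L : s.nr 6 = d.ell * d.ell
  one : s.nr 7 = 1
  th : s.rr 0 = d.th
  tau : s.rr 1 = d.th * d.th
  tau2 : s.rr 2 = d.th * d.th * (d.th * d.th)
  rzero : s.rr 3 = 0
  rone : s.rr 4 = 1
  inp : s.arr 0 = d.inp

/-- Agreement on the input, the first five real registers and the first `k` natural-number
registers. -/
structure Same (k : ℕ) (s₀ s : St) : Prop where
  nr : ∀ a : Fin 32, a.val < k → s.nr a = s₀.nr a
  rr : ∀ a : Fin 16, a.val < 5 → s.rr a = s₀.rr a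
  inp : s.arr 0 = s₀.arr 0

namespace Same

variable {k k' : ℕ} {s₀ s s' : St}

theorem refl (s : St) : Same k s s := ⟨fun _ _ => rfl, fun _ _ => rfl, rfl⟩

theorem trans (h : Same k s₀ s) (h' : Same k s s') : Same k s₀ s' :=
  ⟨fun a ha => (h'.nr a ha).trans (h.nr a ha), fun a ha => (h'.rr a ha).trans (h.rr a ha),
    h'.inp.trans h.inp⟩

theorem mono (h : Same k s₀ s) (hk : k' ≤ k) : Same k' s₀ s :=
  ⟨fun a ha => h.nr a (by lia), h.rr, h.inp⟩

theorem setN (h : Same k s₀ s) {a : Fin 32} (ha : k ≤ a.val) (v : ℕ) : Same k s₀ (s.setN a v) :=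
  ⟨fun b hb => (Function.update_of_ne (by rintro rfl; lia) _ _).trans (h.nr b hb), h.rr, h.inp⟩

theorem setR (h : Same k s₀ s) {a : Fin 16} (ha : 5 ≤ a.val) (v : ℝ) : Same k s₀ (s.setR a v) :=
  ⟨h.nr, fun b hb => (Function.update_of_ne (by rintro rfl; lia) _ _).trans (h.rr b hb), h.inp⟩

theorem setA (h : Same k s₀ s) {z : Fin 3} (hz : z ≠ 0) (i : ℕ) (v : ℝ) :
    Same k s₀ (s.setA z i v) :=
  ⟨h.nr, h.rr, (Function.update_of_ne hz.symm _ _).trans h.inp⟩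

theorem setS (h : Same k s₀ s) (i v : ℕ) : Same k s₀ (s.setS i v) := ⟨h.nr, h.rr, h.inp⟩

theorem renew (h : Same k s₀ s) : Same k s₀ s.renew :=
  ⟨h.nr, h.rr, by simp [St.renew, h.inp]⟩

theorem frame (h : Same k s₀ s) (hk : k ≤ 25) (h' : Frame s s') : Same k s₀ s' :=
  ⟨fun a ha => (h'.nr a (by lia)).trans (h.nr a ha),
    fun a ha => (h'.rr a (by lia)).trans (h.rr a ha), h'.inp.trans h.inp⟩

theorem ctx (h : Same k s₀ s) (hk : 8 ≤ k) {d : Dat} (hd : d.Ctx s₀) : d.Ctx s := by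
  have hn (a : Fin 32) (ha : a.val < 8) := h.nr a (by lia)
  refine ⟨?_, ?_, ?_, ?_, ?_, ?_, ?_, ?_, ?_, ?_, ?_, ?_, h.inp.trans hd.inp⟩
  · rw [hn _ (by decide), hd.n]
  · rw [hn _ (by decide), hd.N]
  · rw [hn _ (by decide), hd.N₁]
  · rw [hn _ (by decide), hd.h]
  · rw [hn _ (by decide), hd.ell]
  · rw [hn _ (by decide), hd.L]
  · rw [hn _ (by decide), hd.one]
  · rw [h.rr _ (by decide), hd.th]
  · rw [h.rr _ (by decide), hd.tau]
  · rw [h.rr _ (by decide), hd.tau2]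
  · rw [h.rr _ (by decide), hd.rzero]
  · rw [h.rr _ (by decide), hd.rone]

end Same

/-! ## Setting up a random linear system -/

/-- Straight-line code of the register machine. -/
theorem HOp.block_sure {l : List HOp} (s : St) {I : St → Prop} {T : ℕ} (hT : l.length ≤ T)
    (hl' : ∀ a ∈ l, (∀ r, a ≠ .gauss r) ∧ (∀ r, a ≠ .unif r) ∧ a ≠ .fresh)
    (hI : I (hl.exec l s)) : (Cmd.block l : Cmd HOp HTest).Sure hl s T I := by
  have hp : ∀ l : List HOp, (∀ a ∈ l, a ≠ HOp.fresh) → ∀ s, hl.pres l s := by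
    intro l
    induction l with
    | nil => exact fun _ _ => trivial
    | cons a l ih =>
      intro h s
      refine ⟨?_, ih (fun a ha => h a (by simp [ha])) _⟩
      have := h a (by simp)
      cases a <;> trivial
  refine (Cmd.Sure.block (fun a ha => HOp.det_of_ne (hl' a ha).1 (hl' a ha).2.1)
    (hp l (fun a ha => (hl' a ha).2.2) s)).mono hT ?_
  rintro s' rfl
  exact hI

/-- Computation of the value of an entry of the system. -/
def entryCmd : Cmd HOp HTest :=
  .ite (.nle 3 16)
    (.ite (.nle 3 17) (.block [.radd 6 1 3]) (.block [.radd 6 3 3]))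
    (.ite (.nle 3 17) (.block [.radd 6 5 3])
      (.ite (.nle 4 16)
        (.ite (.nle 4 17)
          (.ite (.nle 16 17)
            (.ite (.nle 17 16) (.block [.radd 6 4 3]) (.block [.radd 6 3 3]))
            (.block [.radd 6 3 3]))
          (.ite (.nle 10 16) (.block [.radd 6 3 3]) (.block [.radd 6 5 3])))
        (.ite (.nle 4 17)
          (.ite (.nle 10 17) (.block [.radd 6 3 3]) (.block [.radd 6 5 3]))
          (.ite (.nle 1 17) (.block [.radd 6 3 3])
            (.block [.nmul 20 1 16, .nadd 20 20 17, .rload 0 6 20])))))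

theorem entryCmd_sure {d : Dat} {s : St} (hd : d.Ctx s) :
    entryCmd.Sure hl s 8 (fun s' => ∃ v, s' = (s.setN 20 v).setR 6
      (d.entry (s.nr 10) (s.rr 5) (s.nr 16) (s.nr 17))) := by
  obtain ⟨hn, -, hN₁, hh, -, -, -, -, htau, -, hz, ho, hinp⟩ := hd
  simp only [Dat.entry, ← hn, ← hN₁, ← hh, ← htau, ← hinp, le_antisymm_iff (a := s.nr 16)]
  clear hn hN₁ hh htau hinp
  have hholds : ∀ a b, hl.holds (.nle a b) s = (s.nr a ≤ s.nr b) := fun _ _ => rfl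
  repeat' refine Cmd.Sure.ite (fun h => ?_) fun h => ?_
  all_goals
    refine HOp.block_sure s (by decide) (by simp) ?_
    rw [hholds] at *
    first
      | refine ⟨s.nr 20, ?_⟩
        simp [Machine.exec, hl, HOp.ev, St.setN, St.setR, *]
        done
      | refine ⟨s.nr 1 * s.nr 16 + s.nr 17, ?_⟩
        simp [Machine.exec, hl, HOp.ev, St.setN, St.setR, *]

/-- One round of the loop filling the system, after a sample has been drawn. -/
def fillStep : Cmd HOp HTest :=
  .seq entryCmd
    (.seq (.block [.rstore 1 18 6, .rstore 2 18 6, .nadd 18 18 7, .nadd 17 17 7, .nmonus 19 19 7])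
      (.ite (.nle 2 17) (.block [.nconst 17 0, .nadd 16 16 7]) .skip))

/-- The state after `k` entries of the system have been written. -/
structure Dat.Filled (d : Dat) (s₀ : St) (w : ℕ → ℝ) (k : ℕ) (s : St) : Prop where
  same : Same 14 s₀ s
  row : s.nr 16 = k / d.N
  col : s.nr 17 = k % d.N
  pos : s.nr 18 = k
  cnt : s.nr 19 = d.N * d.N - k
  sys : ∀ j < k, s.arr 1 j = d.flat (s₀.nr 10) w j
  sub : ∀ j, s.arr 2 j = if j < k then d.flat (s₀.nr 10) w j else 0
  nsub : s.nsub = fun _ => 0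
  cap : s.cap = s₀.cap

theorem Dat.Filled.step {d : Dat} {s₀ s : St} (hd : d.Ctx s₀) {w : ℕ → ℝ} {k : ℕ}
    (hs : d.Filled s₀ w k s) (x : ℝ) :
    fillStep.Sure hl (s.setR 5 x) 16 (d.Filled s₀ (Function.update w k x) (k + 1)) := by
  have hN0 : 0 < d.N := Nat.succ_pos _
  have hctx : d.Ctx (s.setR 5 x) := (hs.same.setR (by decide) x).ctx (by decide) hd
  have h10 : s.nr 10 = s₀.nr 10 := hs.same.nr _ (by decide)
  have h7 : s.nr 7 = 1 := hctx.one
  have h2 : s.nr 2 = d.N := hctx.N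
  have hflat : ∀ j < k, d.flat (s₀.nr 10) (Function.update w k x) j = d.flat (s₀.nr 10) w j := by
    intro j hj
    rw [Dat.flat, Function.update_of_ne (by lia), Dat.flat]
  have hval : d.entry (s.nr 10) x (k / d.N) (k % d.N) =
      d.flat (s₀.nr 10) (Function.update w k x) k := by
    simp [Dat.flat, h10]
  refine (Cmd.Sure.seq (T₂ := 8) (entryCmd_sure hctx) ?_).mono (by lia) fun _ h => h
  rintro s₁ ⟨v, rfl⟩
  have hcol := Nat.mod_lt k hN0
  have hdm := Nat.div_add_mod k d.N
  refine Cmd.Sure.seq (T₁ := 5) (T₂ := 3) (I₁ := fun s' => Same 14 s₀ s' ∧ s'.nr 16 = k / d.N ∧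
    s'.nr 17 = k % d.N + 1 ∧ s'.nr 18 = k + 1 ∧ s'.nr 19 = d.N * d.N - (k + 1) ∧
    (∀ j < k + 1, s'.arr 1 j = d.flat (s₀.nr 10) (Function.update w k x) j) ∧
    (∀ j, s'.arr 2 j = if j < k + 1 then d.flat (s₀.nr 10) (Function.update w k x) j else 0) ∧
    s'.nsub = (fun _ => 0) ∧ s'.cap = s₀.cap) ?_ ?_
  · refine HOp.block_sure _ (by simp) (by simp) ?_
    refine ⟨?_, ?_, ?_, ?_, ?_, ?_, ?_, hs.nsub, hs.cap⟩
    · exact ((((((((hs.same.setR (by decide) _).setN (by decide) _).setR (by decide) _).setA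
        (by decide) _ _).setA (by decide) _ _).setN (by decide) _).setN (by decide) _).setN
        (by decide) _)
    · simp [Machine.exec, hl, HOp.ev, St.setN, St.setR, St.setA, hs.row]
    · simp [Machine.exec, hl, HOp.ev, St.setN, St.setR, St.setA, hs.col, h7]
    · simp [Machine.exec, hl, HOp.ev, St.setN, St.setR, St.setA, hs.pos, h7]
    · simp [Machine.exec, hl, HOp.ev, St.setN, St.setR, St.setA, hs.cnt, h7]
      lia
    · intro j hj
      simp [Machine.exec, hl, HOp.ev, St.setN, St.setR, St.setA, hs.row, hs.col, hs.pos, hval,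
        Function.update_apply]
      split_ifs with hjk
      · rw [hjk]
      · rw [hs.sys j (by lia), hflat j (by lia)]
    · intro j
      simp [Machine.exec, hl, HOp.ev, St.setN, St.setR, St.setA, hs.row, hs.col, hs.pos, hval,
        Function.update_apply]
      split_ifs with hjk hj hj
      · rw [hjk]
      · lia
      · rw [hs.sub j, if_pos (by lia), hflat j (by lia)]
      · rw [hs.sub j, if_neg (by lia)]
  · rintro s₂ ⟨g1, g2, g3, g4, g5, g6, g7, g8, g9⟩
    have h7' : s₂.nr 7 = 1 := (g1.ctx (by decide) hd).one
    have h2' : s₂.nr 2 = d.N := (g1.ctx (by decide) hd).N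
    refine Cmd.Sure.ite (T := 2) (fun hb => ?_) fun hb => ?_
    · simp only [hl, h2', g3] at hb
      have hk : k + 1 = d.N * (k / d.N + 1) := by
        rw [mul_add]
        lia
      refine HOp.block_sure _ (by simp) (by simp) ⟨(g1.setN (by decide) _).setN (by decide) _,
        ?_, ?_, g4, g5, g6, g7, g8, g9⟩
      · rw [hk, Nat.mul_div_cancel_left _ hN0]
        simp [Machine.exec, hl, HOp.ev, St.setN, g2, h7']
      · rw [hk, Nat.mul_mod_right]
        simp [Machine.exec, hl, HOp.ev, St.setN]
    · simp only [hl, h2', g3, not_le] at hb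
      refine Cmd.Sure.skip.mono (by lia) ?_
      rintro s' rfl
      have hk : k + 1 = (k % d.N + 1) + d.N * (k / d.N) := by lia
      refine ⟨g1, ?_, ?_, g4, g5, g6, g7, g8, g9⟩
      · rw [g2]
        conv_rhs => rw [hk, Nat.add_mul_div_left _ _ hN0, Nat.div_eq_of_lt hb, zero_add]
      · rw [g3]
        conv_rhs => rw [hk, Nat.add_mul_mod_self_left, Nat.mod_eq_of_lt hb]

/-- Filling the system with random entries. -/
def fillCmd : Cmd HOp HTest :=
  .seq (.op .fresh) (.seq (.block [.nconst 16 0, .nconst 17 0, .nconst 18 0, .nmul 19 2 2])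
    (.loop (.nle 7 19) (.seq (.op (.unif 5)) fillStep)))

theorem fillCmd_spec {d : Dat} {s : St} (hd : d.Ctx s) (hcap : 0 < s.cap)
    (S : Set (Fin (d.N * d.N) → ℝ)) :
    fillCmd.Spec hl s (d.N * d.N * 18 + 6)
      (fun s' => ∃ w, d.Filled s.renew w (d.N * d.N) s')
      (fun s' => ∃ w : ℕ → ℝ, (fun i : Fin (d.N * d.N) => w i) ∉ S ∧
        d.Filled s.renew w (d.N * d.N) s')
      (Measure.pi (fun _ : Fin (d.N * d.N) => unifLaw) S) := by
  have hd' : d.Ctx s.renew := (Same.refl s).renew.ctx (k := 14) (by decide) hd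
  refine Cmd.Spec.mono (Cmd.Sure.seq_spec (T₁ := 1) (T₂ := d.N * d.N * 18 + 5)
    (I₁ := fun s' => s' = s.renew) (Cmd.Sure.op hcap fun _ => rfl) ?_) (by lia) (fun _ h => h)
    (fun _ _ h => h) le_rfl
  rintro s₁ rfl
  refine Cmd.Spec.mono (Cmd.Sure.seq_spec (T₁ := 4) (T₂ := d.N * d.N * 18 + 1)
    (I₁ := d.Filled s.renew (fun _ => 0) 0) ?_ fun s₂ hs₂ => ?_) (by lia) (fun _ h => h)
    (fun _ _ h => h) le_rfl
  · refine HOp.block_sure _ (by simp) (by simp) ⟨((((Same.refl _).setN (by decide) _).setN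
      (by decide) _).setN (by decide) _).setN (by decide) _, ?_, ?_, ?_, ?_, ?_, ?_, rfl, rfl⟩
    · simp [Machine.exec, hl, HOp.ev, St.setN]
    · simp [Machine.exec, hl, HOp.ev, St.setN]
    · simp [Machine.exec, hl, HOp.ev, St.setN]
    · simp [Machine.exec, hl, HOp.ev, St.setN, hd'.N]
    · simp
    · simp [Machine.exec, hl, HOp.ev, St.setN, St.renew]
  · refine Cmd.Spec.draw_loop (T := 16) (d.Filled s.renew) ?_ ?_ ?_ _ s₂ hs₂ S
    · intro w k s' hk h
      have h7 := (h.same.ctx (by decide) hd').one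
      simp only [hl, h7, h.cnt]
      lia
    · intro w k s' hk h x
      exact h.step hd' x
    · intro w s' h
      have h7 := (h.same.ctx (by decide) hd').one
      simp [hl, h7, h.cnt]

/-! ## Checking the output of the subroutine -/

/-- The test applied to the output `x` of the subroutine: all equations but the last one hold
approximately, and the last unknown is not too small. -/
def Dat.Accept (d : Dat) (e : ℕ) (w x : ℕ → ℝ) : Prop :=
  (∑ i ∈ Finset.range d.N₁, (∑ j ∈ Finset.range d.N, d.flat e w (d.N * i + j) * x j) ^ 2) ≤
    d.th * d.th * (d.th * d.th) ∧ d.th ≤ x d.N₁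

/-- One step of the computation of a scalar product. -/
def dotStep : Cmd HOp HTest :=
  .block [.rload 1 9 18, .rload 2 10 17, .rmul 9 9 10, .radd 8 8 9, .nadd 18 18 7, .nadd 17 17 7,
    .nmonus 21 21 7]

/-- Addition of the square of one residual. -/
def residualStep : Cmd HOp HTest :=
  .seq (.block [.radd 8 3 3, .nconst 17 0, .nmul 21 2 7])
    (.seq (.loop (.nle 7 21) dotStep) (.block [.rmul 8 8 8, .radd 7 7 8, .nmonus 19 19 7]))

/-- Setting the flag if the output of the subroutine is accepted. -/
def checkCmd : Cmd HOp HTest :=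
  .seq (.block [.radd 7 3 3, .nconst 18 0, .nmul 19 3 7])
    (.seq (.loop (.nle 7 19) residualStep)
      (.seq (.block [.rload 2 9 3])
        (.ite (.rle 7 2) (.ite (.rle 0 9) (.block [.nconst 13 1]) .skip) .skip)))

/-- States that differ from `s₀` only in scratch registers. -/
structure Scratch (s₀ s : St) : Prop where
  same : Same 14 s₀ s
  sys : s.arr 1 = s₀.arr 1
  sub : s.arr 2 = s₀.arr 2
  cap : s.cap = s₀.cap

theorem Scratch.refl (s : St) : Scratch s s := ⟨Same.refl s, rfl, rfl, rfl⟩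

theorem Scratch.setN {s₀ s : St} (h : Scratch s₀ s) {a : Fin 32} (ha : 14 ≤ a.val) (v : ℕ) :
    Scratch s₀ (s.setN a v) := ⟨h.same.setN ha v, h.sys, h.sub, h.cap⟩

theorem Scratch.setR {s₀ s : St} (h : Scratch s₀ s) {a : Fin 16} (ha : 5 ≤ a.val) (v : ℝ) :
    Scratch s₀ (s.setR a v) := ⟨h.same.setR ha v, h.sys, h.sub, h.cap⟩

/-- The state after `j` steps of the computation of the scalar product with row `i`. -/
structure DotInv (d : Dat) (s₀ : St) (acc : ℝ) (i j : ℕ) (s : St) : Prop where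
  scratch : Scratch s₀ s
  acc : s.rr 7 = acc
  sum : s.rr 8 = ∑ k ∈ Finset.range j, s₀.arr 1 (d.N * i + k) * s₀.arr 2 k
  col : s.nr 17 = j
  pos : s.nr 18 = d.N * i + j
  cnt : s.nr 21 = d.N - j
  rows : s.nr 19 = d.N₁ - i

theorem DotInv.step {d : Dat} {s₀ s : St} (hd : d.Ctx s₀) {acc : ℝ} {i j : ℕ}
    (h : DotInv d s₀ acc i j s) : dotStep.Sure hl s 7 (DotInv d s₀ acc i (j + 1)) := by
  have h7 := (h.scratch.same.ctx (by decide) hd).one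
  refine HOp.block_sure _ (by simp) (by simp) ⟨?_, h.acc, ?_, ?_, ?_, ?_, h.rows⟩
  · exact ((((((h.scratch.setR (by decide) _).setR (by decide) _).setR (by decide) _).setR
      (by decide) _).setN (by decide) _).setN (by decide) _).setN (by decide) _
  · rw [Finset.sum_range_succ]
    simp [Machine.exec, hl, HOp.ev, St.setN, St.setR, h.sum, h.col, h.pos, h.scratch.sys,
      h.scratch.sub]
  · simp [Machine.exec, hl, HOp.ev, St.setN, St.setR, h.col, h7]
  · simp [Machine.exec, hl, HOp.ev, St.setN, St.setR, h.pos, h7]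
    lia
  · simp [Machine.exec, hl, HOp.ev, St.setN, St.setR, h.cnt, h7]
    lia

/-- The state after the residuals of `i` equations have been added. -/
structure ResInv (d : Dat) (s₀ : St) (i : ℕ) (s : St) : Prop where
  scratch : Scratch s₀ s
  acc : s.rr 7 = ∑ r ∈ Finset.range i,
    (∑ k ∈ Finset.range d.N, s₀.arr 1 (d.N * r + k) * s₀.arr 2 k) ^ 2
  pos : s.nr 18 = d.N * i
  rows : s.nr 19 = d.N₁ - i

theorem ResInv.step {d : Dat} {s₀ s : St} (hd : d.Ctx s₀) {i : ℕ}
    (h : ResInv d s₀ i s) : residualStep.Sure hl s (d.N * 8 + 7) (ResInv d s₀ (i + 1)) := by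
  have hc := h.scratch.same.ctx (by decide) hd
  refine (Cmd.Sure.seq (T₁ := 3) (T₂ := d.N * 8 + 4) (I₁ := DotInv d s₀ (s.rr 7) i 0) ?_
    fun s₁ h₁ => ?_).mono (by lia) fun _ h => h
  · refine HOp.block_sure _ (by simp) (by simp) ⟨?_, rfl, ?_, ?_, ?_, ?_, h.rows⟩
    · exact ((h.scratch.setR (by decide) _).setN (by decide) _).setN (by decide) _
    · simp [Machine.exec, hl, HOp.ev, St.setN, St.setR, hc.rzero]
    · simp [Machine.exec, hl, HOp.ev, St.setN, St.setR]
    · simp [Machine.exec, hl, HOp.ev, St.setN, St.setR, h.pos]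
    · simp [Machine.exec, hl, HOp.ev, St.setN, St.setR, hc.N, hc.one]
  · refine (Cmd.Sure.seq (T₁ := d.N * 8 + 1) (T₂ := 3) (I₁ := DotInv d s₀ (s.rr 7) i d.N) ?_
      fun s₂ h₂ => ?_).mono (by lia) fun _ h => h
    · refine (Cmd.Sure.loop (T := 7) (fun n s' => n ≤ d.N ∧ DotInv d s₀ (s.rr 7) i (d.N - n) s')
        ?_ ?_ ?_ d.N s₁ ⟨le_rfl, by simpa using h₁⟩).mono le_rfl fun s' h => by simpa using h.2
      · rintro n s' ⟨hn, h'⟩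
        have h7 := (h'.scratch.same.ctx (by decide) hd).one
        simp only [hl, h7, h'.cnt]
        lia
      · rintro n s' ⟨hn, h'⟩
        refine (h'.step hd).mono le_rfl fun s'' h'' => ⟨by lia, ?_⟩
        rwa [show d.N - (n + 1) + 1 = d.N - n by lia] at h''
      · rintro s' ⟨hn, h'⟩
        have h7 := (h'.scratch.same.ctx (by decide) hd).one
        simp [hl, h7, h'.cnt]
    · have h7 := (h₂.scratch.same.ctx (by decide) hd).one
      refine HOp.block_sure _ (by simp) (by simp) ⟨?_, ?_, ?_, ?_⟩
      · exact ((h₂.scratch.setR (by decide) _).setR (by decide) _).setN (by decide) _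
      · rw [Finset.sum_range_succ]
        simp [Machine.exec, hl, HOp.ev, St.setN, St.setR, h₂.acc, h.acc, h₂.sum, sq]
      · simp [Machine.exec, hl, HOp.ev, St.setN, St.setR, h₂.pos, mul_add]
      · simp [Machine.exec, hl, HOp.ev, St.setN, St.setR, h₂.rows, h7]
        lia

open Classical in
theorem checkCmd_sure {d : Dat} {s : St} (hd : d.Ctx s) {w : ℕ → ℝ}
    (hsys : ∀ j < d.N * d.N, s.arr 1 j = d.flat (s.nr 10) w j) :
    checkCmd.Sure hl s (d.N₁ * (d.N * 8 + 8) + 8) (fun s' => Same 13 s s' ∧ s'.cap = s.cap ∧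
      s'.nr 13 = if d.Accept (s.nr 10) w (s.arr 2) then 1 else s.nr 13) := by
  refine (Cmd.Sure.seq (T₁ := 3) (T₂ := d.N₁ * (d.N * 8 + 8) + 5) (I₁ := ResInv d s 0) ?_
    fun s₁ h₁ => ?_).mono (by lia) fun _ h => h
  · refine HOp.block_sure _ (by simp) (by simp) ⟨?_, ?_, ?_, ?_⟩
    · exact (((Scratch.refl s).setR (by decide) _).setN (by decide) _).setN (by decide) _
    · simp [Machine.exec, hl, HOp.ev, St.setN, St.setR, hd.rzero]
    · simp [Machine.exec, hl, HOp.ev, St.setN, St.setR]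
    · simp [Machine.exec, hl, HOp.ev, St.setN, St.setR, hd.N₁, hd.one]
  refine (Cmd.Sure.seq (T₁ := d.N₁ * (d.N * 8 + 8) + 1) (T₂ := 4) (I₁ := ResInv d s d.N₁) ?_
    fun s₂ h₂ => ?_).mono (by lia) fun _ h => h
  · refine (Cmd.Sure.loop (T := d.N * 8 + 7) (fun n s' => n ≤ d.N₁ ∧ ResInv d s (d.N₁ - n) s')
      ?_ ?_ ?_ d.N₁ s₁ ⟨le_rfl, by simpa using h₁⟩).mono le_rfl fun s' h => by simpa using h.2
    · rintro n s' ⟨hn, h'⟩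
      have h7 := (h'.scratch.same.ctx (by decide) hd).one
      simp only [hl, h7, h'.rows]
      lia
    · rintro n s' ⟨hn, h'⟩
      refine (h'.step hd).mono le_rfl fun s'' h'' => ⟨by lia, ?_⟩
      rwa [show d.N₁ - (n + 1) + 1 = d.N₁ - n by lia] at h''
    · rintro s' ⟨hn, h'⟩
      have h7 := (h'.scratch.same.ctx (by decide) hd).one
      simp [hl, h7, h'.rows]
  have hc₂ := h₂.scratch.same.ctx (by decide) hd
  refine (Cmd.Sure.seq (T₁ := 1) (T₂ := 3) (I₁ := fun s' => Scratch s s' ∧ s'.rr 7 = s₂.rr 7 ∧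
    s'.rr 9 = s.arr 2 d.N₁) ?_ fun s₃ h₃ => ?_).mono (by lia) fun _ h => h
  · refine HOp.block_sure _ (by simp) (by simp) ⟨h₂.scratch.setR (by decide) _, rfl, ?_⟩
    simp [Machine.exec, hl, HOp.ev, St.setR, hc₂.N₁, h₂.scratch.sub]
  obtain ⟨h₃, hacc, hz⟩ := h₃
  have hc₃ := h₃.same.ctx (by decide) hd
  have haccept : d.Accept (s.nr 10) w (s.arr 2) ↔
      s₃.rr 7 ≤ s₃.rr 2 ∧ s₃.rr 0 ≤ s₃.rr 9 := by
    rw [hacc, h₂.acc, hc₃.tau2, hc₃.th, hz, Dat.Accept]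
    refine and_congr_left fun _ => ?_
    refine Eq.to_iff (congrArg (· ≤ _) (Finset.sum_congr rfl fun i hi => ?_))
    congr 1
    refine Finset.sum_congr rfl fun j hj => ?_
    rw [hsys]
    rw [Finset.mem_range] at hi hj
    have : i + 1 ≤ d.N := by
      unfold Dat.N
      lia
    nlinarith
  have h13 : s₃.nr 13 = s.nr 13 := h₃.same.nr _ (by decide)
  refine Cmd.Sure.ite (T := 2) (fun hb => ?_) fun hb => ?_
  · refine Cmd.Sure.ite (T := 1) (fun hb' => ?_) fun hb' => ?_
    · refine HOp.block_sure _ (by simp) (by simp)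
        ⟨(h₃.same.mono (by lia)).setN (by decide) _, h₃.cap, ?_⟩
      rw [if_pos (haccept.2 ⟨hb, hb'⟩)]
      simp [Machine.exec, hl, HOp.ev, St.setN]
    · refine Cmd.Sure.skip.mono (by lia) ?_
      rintro s' rfl
      exact ⟨h₃.same.mono (by lia), h₃.cap, by
        rw [if_neg fun h => hb' (haccept.1 h).2, h13]⟩
  · refine Cmd.Sure.skip.mono (by lia) ?_
    rintro s' rfl
    exact ⟨h₃.same.mono (by lia), h₃.cap, by rw [if_neg fun h => hb (haccept.1 h).1, h13]⟩

/-! ## One trial -/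

/-- The matrix of the linear system. -/
def Dat.mat (d : Dat) (e : ℕ) (w : ℕ → ℝ) : Matrix (Fin d.N) (Fin d.N) ℝ :=
  Matrix.of fun i j => d.flat e w (d.N * i + j)

/-- The right-hand side of the linear system. -/
def Dat.rhs (d : Dat) : Fin d.N → ℝ := fun j => if (j : ℕ) = d.N₁ then d.th * d.th else 0

/-- Completing the input of the subroutine. -/
def prepCmd : Cmd HOp HTest :=
  .block [.nadd 20 18 3, .rstore 2 20 1, .nconst 20 0, .nstore 20 2, .nstore 7 2]

/-- Setting up a random system, solving it and checking the solution. -/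
def trialCmd (P : Program) : Cmd HOp HTest := .seq fillCmd (.seq prepCmd (.seq P.call checkCmd))

theorem prepCmd_sure {d : Dat} {s₀ s : St} (hd : d.Ctx s₀) {w : ℕ → ℝ}
    (hs : d.Filled s₀ w (d.N * d.N) s) :
    prepCmd.Sure hl s 5 (fun s' => Same 14 s₀ s' ∧ s'.cap = s₀.cap ∧ s'.arr 1 = s.arr 1 ∧
      s'.subMem = encodeSystem (d.mat (s₀.nr 10) w) d.rhs) := by
  have hc := hs.same.ctx (by decide) hd
  have hN0 : 0 < d.N := Nat.succ_pos _
  refine HOp.block_sure _ (by simp) (by simp) ⟨?_, hs.cap, ?_, ?_⟩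
  · exact ((((hs.same.setN (by decide) _).setA (by decide) _ _).setN (by decide) _).setS _ _).setS
      _ _
  · simp [Machine.exec, hl, HOp.ev, St.setN, St.setA, St.setS]
  · simp only [St.subMem, encodeSystem, Memory.mk.injEq]
    constructor
    · funext k
      simp [Machine.exec, hl, HOp.ev, St.setN, St.setA, St.setS, hs.nsub, hc.one, hc.N, dims,
        Function.update_apply]
      split_ifs <;> rfl
    · funext k
      simp [Machine.exec, hl, HOp.ev, St.setN, St.setA, St.setS, hs.pos, hc.tau, hc.N₁,
        Function.update_apply, hs.sub]
      by_cases hk : k < d.N * d.N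
      · rw [if_neg (by lia), if_pos hk, if_pos hk, rowMajor, dif_pos hk]
        simp [Dat.mat, finProdFinEquiv, Fin.divNat, Fin.modNat, Nat.div_add_mod]
      · rw [if_neg hk, if_neg hk, vecList]
        by_cases hk' : k = d.N * d.N + d.N₁
        · subst hk'
          simp [Dat.rhs, Dat.N]
        · rw [if_neg hk']
          split_ifs with h
          · simp only [Dat.rhs]
            rw [if_neg (by lia)]
          · rfl

/-- The time bound for a trial. -/
def trialTime (P : Program) (N T : ℕ) : ℕ :=
  N * N * 26 + 30 + T * (2 * P.numLabels + 10)

/-- The sure effects of a trial. -/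
def TrialInv (s s' : St) : Prop :=
  Same 13 s s' ∧ s'.cap + 1 = s.cap ∧ (s'.nr 13 = s.nr 13 ∨ s'.nr 13 = 1)

/-- `S` collects the bad draws of the system and `B w` the bad outputs of the subroutine on the
system drawn from `w`; the two error probabilities add up. Of the program `P` only termination and
the bound on `B` are used, so the same statement serves systems of large and of small rank. -/
theorem trialCmd_aux {P : Program} {T : ℕ} {d : Dat} {s : St} (hd : d.Ctx s)
    (hhalt : ∀ w ξ, (P.run (encodeSystem (d.mat (s.nr 10) w) d.rhs) ξ T).pc = none)
    (hcap : 0 < s.cap) (S : Set (Fin (d.N * d.N) → ℝ)) (B : (ℕ → ℝ) → Set Memory) {δ : ℝ≥0∞}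
    (hB : ∀ w : ℕ → ℝ, (fun i : Fin (d.N * d.N) => w i) ∉ S →
      tapeLaw {ξ | (P.run (encodeSystem (d.mat (s.nr 10) w) d.rhs) ξ T).mem ∈ B w} ≤ δ) :
    (trialCmd P).Spec hl s (trialTime P d.N T) (TrialInv s)
      (fun s' => ∃ w : ℕ → ℝ, (fun i : Fin (d.N * d.N) => w i) ∉ S ∧ ∃ M, M ∉ B w ∧
        (d.Accept (s.nr 10) w M.real → s'.nr 13 = 1) ∧
        (¬ d.Accept (s.nr 10) w M.real → s'.nr 13 = s.nr 13))
      (δ + Measure.pi (fun _ : Fin (d.N * d.N) => unifLaw) S) := by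
  have hd' : d.Ctx s.renew := (Same.refl s).renew.ctx (k := 14) (by decide) hd
  have h10 : s.renew.nr 10 = s.nr 10 := rfl
  have htime : d.N * d.N * 18 + 6 + (5 + ((T * (2 * P.numLabels + 10) + 3) +
      (d.N₁ * (d.N * 8 + 8) + 8))) ≤ trialTime P d.N T := by
    have : d.N₁ * (d.N * 8 + 8) + 8 ≤ d.N * d.N * 8 + 8 := by
      have : d.N = d.N₁ + 1 := rfl
      rw [this]
      nlinarith
    unfold trialTime
    lia
  have hrest : ∀ w s₁, d.Filled s.renew w (d.N * d.N) s₁ → ∀ (B' : Set Memory) (δ' : ℝ≥0∞),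
      tapeLaw {ξ | (P.run (encodeSystem (d.mat (s.nr 10) w) d.rhs) ξ T).mem ∈ B'} ≤ δ' →
      (Cmd.seq prepCmd (.seq P.call checkCmd)).Spec hl s₁
        (5 + ((T * (2 * P.numLabels + 10) + 3) + (d.N₁ * (d.N * 8 + 8) + 8))) (TrialInv s)
        (fun s' => ∃ M, M ∉ B' ∧
          (d.Accept (s.nr 10) w M.real → s'.nr 13 = 1) ∧
          (¬ d.Accept (s.nr 10) w M.real → s'.nr 13 = s.nr 13)) δ' := by
    classical
    intro w s₁ h₁ B' δ' hδ'
    refine Cmd.Sure.seq_spec (prepCmd_sure hd' h₁) ?_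
    rintro s₂ ⟨hsame, hcap₂, hsys, hmem⟩
    have hcheck : ∀ s₃, Frame s₂ s₃ → checkCmd.Sure hl s₃ (d.N₁ * (d.N * 8 + 8) + 8)
        (fun s' => Same 13 s s' ∧ s'.cap + 1 = s.cap ∧
          s'.nr 13 = if d.Accept (s.nr 10) w (s₃.arr 2) then 1 else s.nr 13) := by
      intro s₃ hf
      have hs₃ : Same 14 s s₃ := ((Same.refl s).renew.trans hsame).frame (by decide) hf
      have e10 : s₃.nr 10 = s.nr 10 := hs₃.nr _ (by decide)
      have e13 : s₃.nr 13 = s.nr 13 := hs₃.nr _ (by decide)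
      refine (checkCmd_sure (w := w) (hs₃.ctx (by decide) hd) fun j hj => ?_).mono le_rfl ?_
      · rw [hf.sys, hsys, h₁.sys j hj, e10, h10]
      · rintro s' ⟨g1, g2, g3⟩
        refine ⟨(hs₃.mono (by lia)).trans g1, ?_, ?_⟩
        · rw [g2, hf.cap, hcap₂]
          simp only [St.renew]
          lia
        · rw [g3, e10, e13]
    have hcall : P.call.Spec hl s₂ (T * (2 * P.numLabels + 10) + 3) (Frame s₂)
        (fun s' => s'.subMem ∉ B') δ' := by
      refine Program.call_spec ?_ ?_
      · rw [hmem, h10]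
        exact hhalt w
      · rw [hmem, h10]
        exact hδ'
    have hinv : ∀ s' (x : ℕ → ℝ), (Same 13 s s' ∧ s'.cap + 1 = s.cap ∧
        s'.nr 13 = if d.Accept (s.nr 10) w x then 1 else s.nr 13) → TrialInv s s' := by
      rintro s' x ⟨g1, g2, g3⟩
      refine ⟨g1, g2, ?_⟩
      rw [g3]
      split_ifs <;> simp
    refine Cmd.Spec.seq_sure hcall (fun s₃ hf => (hcheck s₃ hf).mono le_rfl fun s' h =>
      hinv s' _ h) fun s₃ hf hg => (hcheck s₃ hf).mono le_rfl fun s' h => ⟨hinv s' _ h, ?_⟩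
    refine ⟨s₃.subMem, hg, fun ha => ?_, fun ha => ?_⟩
    · rw [h.2.2]
      exact if_pos ha
    · rw [h.2.2]
      exact if_neg ha
  refine Cmd.Spec.mono (Cmd.Spec.seq (fillCmd_spec hd hcap S) (I := TrialInv s) (δ₂ := δ)
    (G := fun s' => ∃ w : ℕ → ℝ, (fun i : Fin (d.N * d.N) => w i) ∉ S ∧ ∃ M, M ∉ B w ∧
        (d.Accept (s.nr 10) w M.real → s'.nr 13 = 1) ∧
        (¬ d.Accept (s.nr 10) w M.real → s'.nr 13 = s.nr 13)) ?_ ?_) htime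
    (fun _ h => h) (fun _ _ h => h) le_rfl
  · rintro s₁ - ⟨w, hw, h₁⟩
    exact Cmd.Spec.mono (hrest w s₁ h₁ (B w) δ (hB w hw)) le_rfl (fun _ h => h)
      (fun s' _ h => ⟨w, hw, h⟩) le_rfl
  · rintro s₁ ⟨w, h₁⟩
    exact (hrest w s₁ h₁ ∅ 0 (by simp)).sure

/-! ## The outcome of a trial -/

/-- The probability that uniform random entries satisfy `Q`. -/
def Dat.prob (d : Dat) (Q : (ℕ → ℝ) → Prop) : ℝ≥0∞ :=
  -- The image consists of the finite draws with some extension satisfying `Q`, so a draw outside it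
  -- excludes `Q` for every extension. Its measurability is not needed; the value is an outer
  -- measure.
  Measure.pi (fun _ : Fin (d.N * d.N) => unifLaw)
    ((fun (w : ℕ → ℝ) (i : Fin (d.N * d.N)) => w i) '' {w | Q w})

/-- The right-hand side has norm `th²`, so the residual has norm at most `(1 - th) * th²`. The last
equation alone gives `th² * x d.N₁ ≥ th² - (1 - th) * th² = th³`, hence the lower bound on the last
unknown; the other equations contribute at most `th⁴` to the squared norm. -/
theorem Dat.accept_of_isApproxSolution {d : Dat} {e : ℕ} {w x : ℕ → ℝ} {ε : ℝ} (hth : 0 < d.th)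
    (hε : ε + d.th ≤ 1) (h : IsApproxSolution ε (d.mat e w) d.rhs fun j => x j) :
    d.Accept e w x := by
  have hτ : 0 < d.th * d.th := by positivity
  have hnorm (v : Fin d.N → ℝ) : ‖WithLp.toLp 2 v‖ ^ 2 = ∑ i : Fin (d.N₁ + 1), v i ^ 2 := by
    rw [EuclideanSpace.norm_sq_eq]
    exact Finset.sum_congr rfl fun i _ => by rw [Real.norm_eq_abs, sq_abs]
  have hrhs : ‖WithLp.toLp 2 d.rhs‖ = d.th * d.th := by
    refine (sq_eq_sq₀ (norm_nonneg _) hτ.le).1 ?_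
    rw [hnorm, Fin.sum_univ_castSucc]
    simp only [Dat.rhs, Fin.val_castSucc, Fin.val_last, if_true]
    rw [Finset.sum_eq_zero, zero_add]
    intro i _
    rw [if_neg (by lia)]
    simp
  have hle : ε * (d.th * d.th) ≤ (1 - d.th) * (d.th * d.th) :=
    mul_le_mul_of_nonneg_right (by linarith) hτ.le
  have hmv (i : Fin d.N) : (d.mat e w).mulVec (fun j => x j) i =
      ∑ j ∈ Finset.range d.N, d.flat e w (d.N * i + j) * x j := by
    rw [Matrix.mulVec, dotProduct,
      ← Fin.sum_univ_eq_sum_range (fun j => d.flat e w (d.N * i + j) * x j)]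
    rfl
  unfold IsApproxSolution at h
  rw [hrhs] at h
  have hsq : ∑ i : Fin (d.N₁ + 1), ((∑ j ∈ Finset.range d.N, d.flat e w (d.N * i + j) * x j) -
      if (i : ℕ) = d.N₁ then d.th * d.th else 0) ^ 2 ≤ ((1 - d.th) * (d.th * d.th)) ^ 2 := by
    have h' := pow_le_pow_left₀ (norm_nonneg _) (h.trans hle) 2
    rw [hnorm] at h'
    refine le_trans (le_of_eq (Finset.sum_congr rfl fun i _ => ?_)) h'
    rw [← hmv i]
    rfl
  rw [Fin.sum_univ_castSucc] at hsq
  simp only [Fin.val_castSucc, Fin.val_last, if_true] at hsq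
  have hsum : ∑ i : Fin d.N₁, ((∑ j ∈ Finset.range d.N, d.flat e w (d.N * i + j) * x j) -
      if (i : ℕ) = d.N₁ then d.th * d.th else 0) ^ 2 =
      ∑ i ∈ Finset.range d.N₁, (∑ j ∈ Finset.range d.N, d.flat e w (d.N * i + j) * x j) ^ 2 := by
    rw [← Fin.sum_univ_eq_sum_range
      (fun i => (∑ j ∈ Finset.range d.N, d.flat e w (d.N * i + j) * x j) ^ 2)]
    refine Finset.sum_congr rfl fun i _ => ?_
    rw [if_neg (by lia), sub_zero]
  rw [hsum] at hsq
  have hlast : ∑ j ∈ Finset.range d.N, d.flat e w (d.N * d.N₁ + j) * x j =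
      d.th * d.th * x d.N₁ := by
    rw [Finset.sum_eq_single d.N₁]
    · congr 1
      simp [Dat.flat, Dat.entry, Nat.mul_add_div, Dat.N]
    · intro j hj hne
      rw [Finset.mem_range] at hj
      have hj' : j < d.N₁ := by
        unfold Dat.N at hj
        lia
      have h1 : (d.N * d.N₁ + j) / d.N = d.N₁ := by
        rw [Nat.mul_add_div (by lia), Nat.div_eq_of_lt hj, add_zero]
      have h2 : (d.N * d.N₁ + j) % d.N = j := by
        rw [Nat.mul_add_mod, Nat.mod_eq_of_lt hj]
      rw [Dat.flat, h1, h2, Dat.entry, if_pos le_rfl, if_neg (by lia), zero_mul]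
    · intro h
      exact (h (by simp [Dat.N])).elim
  rw [hlast] at hsq
  have hpos : 0 ≤ ∑ i ∈ Finset.range d.N₁,
      (∑ j ∈ Finset.range d.N, d.flat e w (d.N * i + j) * x j) ^ 2 :=
    Finset.sum_nonneg fun _ _ => sq_nonneg _
  have hth1 : 0 ≤ 1 - d.th := by
    by_contra hneg
    have := (norm_nonneg _).trans (h.trans hle)
    nlinarith
  constructor
  · have h1 : ((1 - d.th) * (d.th * d.th)) ^ 2 ≤ (1 * (d.th * d.th)) ^ 2 :=
      pow_le_pow_left₀ (by positivity) (mul_le_mul_of_nonneg_right (by linarith) hτ.le) 2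
    nlinarith [sq_nonneg (d.th * d.th * x d.N₁ - d.th * d.th)]
  · have h1 : (d.th * d.th * x d.N₁ - d.th * d.th) ^ 2 ≤ ((1 - d.th) * (d.th * d.th)) ^ 2 := by
      linarith
    have h2 := (abs_le_of_sq_le_sq' h1 (by positivity)).1
    have h3 : d.th * d.th * d.th ≤ d.th * d.th * x d.N₁ := by linarith
    exact le_of_mul_le_mul_left h3 hτ

section

variable {P : Program} {T : ℕ → ℕ} {err ε : ℕ → ℝ} {d : Dat} {s : St}

theorem trialCmd_sure (hP : (approxLinearSearchSquareFullRank ε).SolvedBy err P T)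
    (hd : d.Ctx s) (hcap : 0 < s.cap) :
    (trialCmd P).Sure hl s (trialTime P d.N (T d.N)) (TrialInv s) :=
  (trialCmd_aux hd (fun w => (hP ⟨d.N, d.mat (s.nr 10) w, d.rhs⟩).1) hcap Set.univ
    (fun _ => Set.univ) (δ := 0) (fun _ h => (h trivial).elim)).sure

/-- Singular draws have probability `0`. A nonsingular system meets the promise, so the subroutine
returns an approximate solution with probability at least `2 / 3`, and such a solution passes the
test. -/
theorem trialCmd_yes (hP : (approxLinearSearchSquareFullRank ε).SolvedBy err P T)
    (hd : d.Ctx s) (hcap : 0 < s.cap) (hth : 0 < d.th) (hε : ε d.N + d.th ≤ 1)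
    (herr : err d.N ≤ 1 / 3) (hdet : d.prob (fun w => (d.mat (s.nr 10) w).det = 0) = 0) :
    (trialCmd P).Spec hl s (trialTime P d.N (T d.N)) (TrialInv s) (fun s' => s'.nr 13 = 1)
      (ENNReal.ofReal (1 / 3)) := by
  refine Cmd.Spec.mono (trialCmd_aux hd (fun w => (hP ⟨d.N, d.mat (s.nr 10) w, d.rhs⟩).1) hcap
    _ (fun w => {M | ¬ IsApproxSolution (ε d.N) (d.mat (s.nr 10) w) d.rhs fun j => M.real j})
    (δ := ENNReal.ofReal (1 / 3)) fun w hw => ?_) le_rfl (fun _ h => h) ?_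
    (le_of_eq (by rw [← Dat.prob, hdet, add_zero]))
  · refine ((hP ⟨d.N, d.mat (s.nr 10) w, d.rhs⟩).2 ?_).trans (ENNReal.ofReal_le_ofReal herr)
    refine (Matrix.rank_of_isUnit _ ?_).trans (Fintype.card_fin _)
    rw [Matrix.isUnit_iff_isUnit_det, isUnit_iff_ne_zero]
    exact fun h0 => hw ⟨w, h0, rfl⟩
  · rintro s' - ⟨w, -, M, hM, h1, -⟩
    rw [Set.mem_ofPred_eq, not_not] at hM
    exact h1 (Dat.accept_of_isApproxSolution hth hε hM)

/-- Outside an event of probability `δ` no vector whatsoever passes the test, so no output of the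
subroutine counts as bad (`B` is empty) and only its termination matters. -/
theorem trialCmd_no (hP : (approxLinearSearchSquareFullRank ε).SolvedBy err P T)
    (hd : d.Ctx s) (hcap : 0 < s.cap) {δ : ℝ≥0∞}
    (hacc : d.prob (fun w => ∃ x, d.Accept (s.nr 10) w x) ≤ δ) :
    (trialCmd P).Spec hl s (trialTime P d.N (T d.N)) (TrialInv s)
      (fun s' => s'.nr 13 = s.nr 13) δ := by
  refine Cmd.Spec.mono (trialCmd_aux hd (fun w => (hP ⟨d.N, d.mat (s.nr 10) w, d.rhs⟩).1) hcap
    _ (fun _ => ∅) (δ := 0) fun w hw => by simp) le_rfl (fun _ h => h) ?_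
    (by rw [zero_add]; exact hacc)
  rintro s' - ⟨w, hw, M, -, -, h2⟩
  exact h2 fun ha => hw ⟨w, ⟨_, ha⟩, rfl⟩

/-! ## Repeated trials -/

/-- Repeated trials; the flag tells whether one of them was successful. -/
def testCmd (P : Program) : Cmd HOp HTest :=
  .seq (.block [.nconst 13 0, .nmul 12 6 7])
    (.loop (.nle 7 12) (.seq (.block [.nmonus 12 12 7]) (trialCmd P)))

/-- The time bound for a test. -/
def testTime (P : Program) (L N T : ℕ) : ℕ := L * (trialTime P N T + 2) + 3

/-- The state before the last `n` trials. -/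
structure TestInv (d : Dat) (s₀ : St) (n : ℕ) (s : St) : Prop where
  same : Same 12 s₀ s
  rep : s.nr 12 = n
  cap : s.cap + d.ell * d.ell = s₀.cap + n

theorem TestInv.step {n : ℕ} {s₀ : St} (hd : d.Ctx s₀) (hcap : d.ell * d.ell ≤ s₀.cap)
    (h : TestInv d s₀ (n + 1) s) :
    (Cmd.block [HOp.nmonus 12 12 7] : Cmd HOp HTest).Sure hl s 1 (fun s' =>
      d.Ctx s' ∧ 0 < s'.cap ∧ s'.nr 10 = s₀.nr 10 ∧ s'.nr 13 = s.nr 13 ∧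
        ∀ s'', TrialInv s' s'' → TestInv d s₀ n s'') := by
  have hs := h.same.setN (a := 12) (by decide) (s.nr 12 - s.nr 7)
  have h7 := (h.same.ctx (by decide) hd).one
  have hc := h.cap
  refine HOp.block_sure _ (by simp) (by simp) ⟨hs.ctx (by decide) hd, ?_, hs.nr _ (by decide), ?_,
    ?_⟩
  · change 0 < s.cap
    lia
  · simp [Machine.exec, hl, HOp.ev, St.setN]
  · rintro s'' ⟨g1, g2, -⟩
    refine ⟨hs.trans (g1.mono (by lia)), ?_, ?_⟩
    · rw [g1.nr _ (by decide)]
      simp [Machine.exec, hl, HOp.ev, St.setN, h.rep, h7]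
    · change s''.cap + 1 = s.cap at g2
      lia

theorem testCmd_init (hd : d.Ctx s) :
    (Cmd.block [HOp.nconst 13 0, HOp.nmul 12 6 7] : Cmd HOp HTest).Sure hl s 2 (fun s' =>
      TestInv d s (d.ell * d.ell) s' ∧ s'.nr 13 = 0) := by
  refine HOp.block_sure _ (by simp) (by simp) ⟨⟨?_, ?_, rfl⟩, ?_⟩
  · exact ((Same.refl s).setN (by decide) _).setN (by decide) _
  · simp [Machine.exec, hl, HOp.ev, St.setN, hd.L, hd.one]
  · simp [Machine.exec, hl, HOp.ev, St.setN]

theorem TestInv.holds_succ {n : ℕ} {s₀ : St} (hd : d.Ctx s₀) (h : TestInv d s₀ (n + 1) s) :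
    hl.holds (.nle 7 12) s := by
  have h7 := (h.same.ctx (by decide) hd).one
  simp only [hl, h7, h.rep]
  lia

theorem TestInv.not_holds_zero {s₀ : St} (hd : d.Ctx s₀) (h : TestInv d s₀ 0 s) :
    ¬ hl.holds (.nle 7 12) s := by
  have h7 := (h.same.ctx (by decide) hd).one
  simp only [hl, h7, h.rep]
  lia

theorem testTime_eq (P : Program) (L N T : ℕ) :
    2 + (L * (1 + trialTime P N T + 1) + 1) = testTime P L N T := by
  unfold testTime
  ring

/-- The flag is never reset, so one success among `ell²` independent trials suffices. -/
theorem testCmd_yes (hP : (approxLinearSearchSquareFullRank ε).SolvedBy err P T)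
    (hd : d.Ctx s) (hcap : d.ell * d.ell ≤ s.cap) (hth : 0 < d.th) (hε : ε d.N + d.th ≤ 1)
    (herr : err d.N ≤ 1 / 3) (hdet : d.prob (fun w => (d.mat (s.nr 10) w).det = 0) = 0) :
    (testCmd P).Spec hl s (testTime P (d.ell * d.ell) d.N (T d.N)) (TestInv d s 0)
      (fun s' => s'.nr 13 = 1) (ENNReal.ofReal (1 / 3) ^ (d.ell * d.ell)) := by
  rw [← testTime_eq]
  refine Cmd.Sure.seq_spec (testCmd_init hd) fun s₁ h₁ => ?_
  refine Cmd.Spec.loop_amplify ENNReal.ofReal_ne_top (TestInv d s) (fun s' => s'.nr 13 = 1)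
    (fun n s' h => h.holds_succ hd) (fun n s' h => ?_) (fun n s' h hg => ?_)
    (fun s' h => h.not_holds_zero hd) _ s₁ h₁.1
  · refine Cmd.Sure.seq_spec (h.step hd hcap) fun s₂ h₂ => ?_
    exact Cmd.Spec.mono (trialCmd_yes hP h₂.1 h₂.2.1 hth hε herr (by rwa [h₂.2.2.1])) le_rfl
      h₂.2.2.2.2 (fun _ _ h => h) le_rfl
  · refine Cmd.Sure.seq (h.step hd hcap) fun s₂ h₂ => ?_
    refine (trialCmd_sure hP h₂.1 h₂.2.1).mono le_rfl fun s₃ h₃ => ⟨h₂.2.2.2.2 _ h₃, ?_⟩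
    rcases h₃.2.2 with h | h
    · rw [h, h₂.2.2.2.1, hg]
    · exact h

/-- A wrong flag needs a wrong acceptance in one of the `ell²` trials. -/
theorem testCmd_no (hP : (approxLinearSearchSquareFullRank ε).SolvedBy err P T)
    (hd : d.Ctx s) (hcap : d.ell * d.ell ≤ s.cap) {δ : ℝ≥0∞}
    (hacc : d.prob (fun w => ∃ x, d.Accept (s.nr 10) w x) ≤ δ) :
    (testCmd P).Spec hl s (testTime P (d.ell * d.ell) d.N (T d.N)) (TestInv d s 0)
      (fun s' => s'.nr 13 = 0) ((d.ell * d.ell : ℕ) * δ) := by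
  rw [← testTime_eq]
  refine Cmd.Sure.seq_spec (testCmd_init hd) fun s₁ h₁ => ?_
  refine Cmd.Spec.loop (TestInv d s) (fun _ s' => s'.nr 13 = 0)
    (fun n s' h => h.holds_succ hd) (fun n s' h => ?_) (fun n s' h hg => ?_)
    (fun s' h => h.not_holds_zero hd) _ s₁ h₁.1 h₁.2
  · refine Cmd.Sure.seq (h.step hd hcap) fun s₂ h₂ => ?_
    exact (trialCmd_sure hP h₂.1 h₂.2.1).mono le_rfl h₂.2.2.2.2
  · refine Cmd.Sure.seq_spec (h.step hd hcap) fun s₂ h₂ => ?_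
    exact Cmd.Spec.mono (trialCmd_no hP h₂.1 h₂.2.1 (by rwa [h₂.2.2.1])) le_rfl
      h₂.2.2.2.2 (fun s₃ _ h => by rw [h, h₂.2.2.2.1, hg]) le_rfl

/-! ## Binary search for the rank -/

/-- Preparation of the next test. -/
def queryCmd : Cmd HOp HTest :=
  .seq (.block [.nmonus 8 8 7, .nmul 14 7 7, .nmul 15 8 7])
    (.seq (.loop (.nle 7 15) (.block [.nadd 14 14 14, .nmonus 15 15 7]))
      -- The candidate `k = nr 9 + 2 ^ n` is tested with `q = h - k`, so that `rank + q ≥ h` means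
      -- `k ≤ rank`. If `k > h`, the truncated difference gives `q = 0`; the test then still
      -- refuses, since the rank is less than `h`.
      (.block [.nadd 11 9 14, .nmonus 10 4 11, .nadd 10 4 10]))

/-- Binary search for the rank. -/
def searchCmd (P : Program) : Cmd HOp HTest :=
  .seq (.block [.nconst 9 0, .nmul 8 5 7])
    (.seq (.loop (.nle 7 8)
      (.seq queryCmd (.seq (testCmd P) (.ite (.nle 7 13) (.block [.nmul 9 11 7]) .skip))))
    (.block [.nmul 0 9 7]))

/-- The state before the last `n` rounds of the binary search. -/
structure SearchInv (d : Dat) (s₀ : St) (n : ℕ) (s : St) : Prop where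
  same : Same 8 s₀ s
  le : n ≤ d.ell
  cnt : s.nr 8 = n
  cap : s.cap + d.ell * (d.ell * d.ell) = s₀.cap + n * (d.ell * d.ell)

/-- The lower bound `s.nr 9` for the rank `r` is exact up to `2 ^ n`. -/
def Approx (r n : ℕ) (s : St) : Prop := s.nr 9 ≤ r ∧ r < s.nr 9 + 2 ^ n

theorem queryCmd_sure {n : ℕ} (hd : d.Ctx s) (hn : s.nr 8 = n + 1) (hle : n ≤ d.ell) :
    queryCmd.Sure hl s (d.ell * 3 + 7) (fun s' => Same 8 s s' ∧ s'.cap = s.cap ∧ s'.nr 8 = n ∧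
      s'.nr 9 = s.nr 9 ∧ s'.nr 11 = s.nr 9 + 2 ^ n ∧
      s'.nr 10 = d.h + (d.h - (s.nr 9 + 2 ^ n))) := by
  have hmul : n * 3 ≤ d.ell * 3 := by lia
  let Inv : ℕ → St → Prop := fun k s' => k ≤ n ∧ Same 8 s s' ∧ s'.cap = s.cap ∧ s'.nr 8 = n ∧
    s'.nr 9 = s.nr 9 ∧ s'.nr 14 = 2 ^ (n - k) ∧ s'.nr 15 = k
  refine (Cmd.Sure.seq (T₁ := 3) (T₂ := (n * 3 + 1) + 3) (I₁ := Inv n) ?_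
    fun s₁ h₁ => Cmd.Sure.seq (T₁ := n * 3 + 1) (T₂ := 3) (I₁ := Inv 0) ?_ fun s₂ h₂ => ?_).mono
    (by lia) fun _ h => h
  · refine HOp.block_sure _ (by simp) (by simp) ⟨le_rfl, ?_, rfl, ?_, ?_, ?_, ?_⟩
    · exact (((Same.refl s).setN (by decide) _).setN (by decide) _).setN (by decide) _
    all_goals simp [Machine.exec, hl, HOp.ev, St.setN, hd.one, hn]
  · refine Cmd.Sure.loop (T := 2) Inv ?_ ?_ ?_ n s₁ h₁
    · rintro k s' ⟨g1, g2, g3, g4, g5, g6, g7⟩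
      have h7 := (g2.ctx (by decide) hd).one
      simp only [hl, h7, g7]
      lia
    · rintro k s' ⟨g1, g2, g3, g4, g5, g6, g7⟩
      have h7 := (g2.ctx (by decide) hd).one
      refine HOp.block_sure _ (by simp) (by simp) ⟨by lia, ?_, g3, ?_, ?_, ?_, ?_⟩
      · exact (g2.setN (by decide) _).setN (by decide) _
      · simp [Machine.exec, hl, HOp.ev, St.setN, g4]
      · simp [Machine.exec, hl, HOp.ev, St.setN, g5]
      · simp [Machine.exec, hl, HOp.ev, St.setN, g6]
        rw [← two_mul, ← pow_succ']
        congr 1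
        lia
      · simp [Machine.exec, hl, HOp.ev, St.setN, g7, h7]
    · rintro s' ⟨g1, g2, g3, g4, g5, g6, g7⟩
      have h7 := (g2.ctx (by decide) hd).one
      simp [hl, h7, g7]
  · obtain ⟨g1, g2, g3, g4, g5, g6, g7⟩ := h₂
    have hh := (g2.ctx (by decide) hd).h
    refine HOp.block_sure _ (by simp) (by simp) ⟨?_, g3, ?_, ?_, ?_, ?_⟩
    · exact ((g2.setN (by decide) _).setN (by decide) _).setN (by decide) _
    · simp [Machine.exec, hl, HOp.ev, St.setN, g4]
    · simp [Machine.exec, hl, HOp.ev, St.setN, g5]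
    · simp [Machine.exec, hl, HOp.ev, St.setN, g5, g6]
    · simp [Machine.exec, hl, HOp.ev, St.setN, g5, g6, hh]

/-- The time bound for the binary search. -/
def searchTime (P : Program) (ell N T : ℕ) : ℕ :=
  ell * (ell * 3 + testTime P (ell * ell) N T + 10) + 4

theorem SearchInv.query {n : ℕ} {s₀ : St} (hd : d.Ctx s₀) (h : SearchInv d s₀ (n + 1) s)
    (hcap : d.ell * (d.ell * d.ell) ≤ s₀.cap) :
    queryCmd.Sure hl s (d.ell * 3 + 7) (fun s' => d.Ctx s' ∧ d.ell * d.ell ≤ s'.cap ∧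
      s'.nr 9 = s.nr 9 ∧ s'.nr 11 = s.nr 9 + 2 ^ n ∧
      s'.nr 10 = d.h + (d.h - (s.nr 9 + 2 ^ n)) ∧ ∀ s'', TestInv d s' 0 s'' →
      (Cmd.ite (.nle 7 13) (.block [.nmul 9 11 7]) .skip : Cmd HOp HTest).Sure hl s'' 2
        (fun s''' => SearchInv d s₀ n s''' ∧
          s'''.nr 9 = if 1 ≤ s''.nr 13 then s.nr 9 + 2 ^ n else s.nr 9)) := by
  have hle := h.le
  have hc := h.cap
  refine (queryCmd_sure (h.same.ctx (by decide) hd) h.cnt (by lia)).mono le_rfl ?_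
  rintro s' ⟨g1, g2, g3, g4, g5, g6⟩
  have hs' := h.same.trans g1
  have hmul : (n + 1) * (d.ell * d.ell) = n * (d.ell * d.ell) + d.ell * d.ell := by ring
  refine ⟨hs'.ctx (by decide) hd, by lia, g4, g5, g6, fun s'' ht => ?_⟩
  have hs'' := hs'.trans (ht.same.mono (by lia))
  have h7 := (hs''.ctx (by decide) hd).one
  have h8 : s''.nr 8 = n := (ht.same.nr _ (by decide)).trans g3
  have h11 : s''.nr 11 = s.nr 9 + 2 ^ n := (ht.same.nr _ (by decide)).trans g5
  have h9 : s''.nr 9 = s.nr 9 := (ht.same.nr _ (by decide)).trans g4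
  have hcap'' := ht.cap
  refine Cmd.Sure.ite (fun hb => ?_) fun hb => ?_
  · refine HOp.block_sure _ (by simp) (by simp) ⟨⟨hs''.setN (by decide) _, by lia, ?_, ?_⟩, ?_⟩
    · simp [Machine.exec, hl, HOp.ev, St.setN, h8]
    · change s''.cap + _ = _
      lia
    · simp only [hl, h7] at hb
      simp [Machine.exec, hl, HOp.ev, St.setN, h11, h7, hb]
  · refine Cmd.Sure.skip.mono (by lia) ?_
    rintro _ rfl
    simp only [hl, h7] at hb
    exact ⟨⟨hs'', by lia, h8, by lia⟩, by rw [if_neg hb, h9]⟩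

/-- Each round halves the interval of length `2 ^ n` known to contain `r`, and `hr'` makes the
initial interval `[0, 2 ^ ell)` correct. The error is a union bound over `ell` rounds, each with
error at most `δ'` in either direction. -/
theorem searchCmd_spec (hP : (approxLinearSearchSquareFullRank ε).SolvedBy err P T)
    (hd : d.Ctx s) (hcap : d.ell * (d.ell * d.ell) ≤ s.cap) (hth : 0 < d.th)
    (hε : ε d.N + d.th ≤ 1) (herr : err d.N ≤ 1 / 3) {r : ℕ} (hr : r < d.h) (hr' : r < 2 ^ d.ell)
    {δ δ' : ℝ≥0∞}
    (hdet : ∀ q, d.h ≤ r + q → q ≤ d.h → d.prob (fun w => (d.mat (d.h + q) w).det = 0) = 0)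
    (hacc : ∀ q, r + q < d.h → d.prob (fun w => ∃ x, d.Accept (d.h + q) w x) ≤ δ)
    (h1 : ENNReal.ofReal (1 / 3) ^ (d.ell * d.ell) ≤ δ') (h2 : (d.ell * d.ell : ℕ) * δ ≤ δ') :
    (searchCmd P).Spec hl s (searchTime P d.ell d.N (T d.N)) (fun _ => True)
      (fun s' => s'.nr 0 = r) (d.ell * δ') := by
  have hb : ∀ n s', SearchInv d s (n + 1) s' → hl.holds (.nle 7 8) s' := by
    intro n s' h
    have h7 := (h.same.ctx (by decide) hd).one
    simp only [hl, h7, h.cnt]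
    lia
  have h0 : ∀ s', SearchInv d s 0 s' → ¬ hl.holds (.nle 7 8) s' := by
    intro s' h
    have h7 := (h.same.ctx (by decide) hd).one
    simp [hl, h7, h.cnt]
  refine Cmd.Spec.mono (Cmd.Sure.seq_spec (T₁ := 2) (I₁ := fun s' => SearchInv d s d.ell s' ∧
    s'.nr 9 = 0) ?_ fun s₁ h₁ => Cmd.Spec.seq_sure (Cmd.Spec.loop (δ := δ')
      (T := (d.ell * 3 + 7) + (testTime P (d.ell * d.ell) d.N (T d.N) + 2))
      (SearchInv d s) (Approx r) hb ?_ ?_ h0 d.ell s₁ h₁.1 ?_)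
      (T₂ := 1) (I := fun _ => True) (G := fun s' => s'.nr 0 = r) ?_ ?_) ?_
      (fun _ h => h) (fun _ _ h => h) le_rfl
  · refine HOp.block_sure _ (by simp) (by simp) ⟨⟨?_, le_rfl, ?_, rfl⟩, ?_⟩
    · exact ((Same.refl s).setN (by decide) _).setN (by decide) _
    · simp [Machine.exec, hl, HOp.ev, St.setN, hd.ell, hd.one]
    · simp [Machine.exec, hl, HOp.ev, St.setN]
  · intro n s' h
    refine Cmd.Sure.seq (h.query hd hcap) fun s₂ h₂ => ?_
    refine Cmd.Sure.seq (I₁ := TestInv d s₂ 0) ?_ fun s₃ h₃ => (h₂.2.2.2.2.2 s₃ h₃).mono le_rfl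
      fun _ h => h.1
    exact (testCmd_no hP h₂.1 h₂.2.1 le_rfl).sure
  · intro n s' h hg
    refine Cmd.Sure.seq_spec (h.query hd hcap) fun s₂ h₂ => ?_
    obtain ⟨g1, g2, g3, g4, g5, g6⟩ := h₂
    by_cases hk : s'.nr 9 + 2 ^ n ≤ r
    · refine Cmd.Spec.seq_sure (Cmd.Spec.mono (testCmd_yes hP g1 g2 hth hε herr ?_) le_rfl
        (fun _ h => h) (fun _ _ h => h) h1) (fun s₃ h₃ => (g6 s₃ h₃).mono le_rfl
        fun _ h => h.1) fun s₃ h₃ e => (g6 s₃ h₃).mono le_rfl fun s₄ h => ⟨h.1, ?_⟩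
      · rw [g5]
        exact hdet _ (by lia) (by lia)
      · have := h.2
        rw [if_pos (by lia)] at this
        have hg2 := hg.2
        rw [pow_succ] at hg2
        exact ⟨by lia, by lia⟩
    · refine Cmd.Spec.seq_sure (Cmd.Spec.mono (testCmd_no hP g1 g2 ?_) le_rfl
        (fun _ h => h) (fun _ _ h => h) h2) (fun s₃ h₃ => (g6 s₃ h₃).mono le_rfl
        fun _ h => h.1) fun s₃ h₃ e => (g6 s₃ h₃).mono le_rfl fun s₄ h => ⟨h.1, ?_⟩
      · rw [g5]
        exact hacc _ (by lia)
      · have := h.2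
        rw [if_neg (by lia)] at this
        have hg1 := hg.1
        exact ⟨by lia, by lia⟩
  · exact ⟨by lia, by lia⟩
  · intro s' h
    exact HOp.block_sure _ (by simp) (by simp) trivial
  · intro s' h hg
    refine HOp.block_sure _ (by simp) (by simp) ⟨trivial, ?_⟩
    have h7 := (h.same.ctx (by decide) hd).one
    have := hg.1
    have := hg.2
    simp [Machine.exec, hl, HOp.ev, St.setN, h7]
    lia
  · unfold searchTime
    apply le_of_eq
    ring

end

/-! ## Setting up the registers -/

/-- The data of the algorithm for an input `x` with `n` columns. -/
def Dat.ofInput (D r κ h₁ n : ℕ) (x : ℕ → ℝ) : Dat where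
  n := n
  -- For fixed `r` the sizes `N` of the systems form one residue class modulo `D`; varying `r`
  -- reaches all large sizes.
  N₁ := D * n + r
  -- The summand `1` keeps the rank strictly below `h`.
  h := h₁ * n + 1
  ell := Nat.clog 2 (D * n + r + 1)
  inp := x
  th := (((2 : ℝ) ^ κ)⁻¹) ^ (Nat.clog 2 (D * n + r + 1) * Nat.clog 2 (D * n + r + 1))

/-- Setting up the registers. -/
def setupCmd (D r κ h₁ : ℕ) : Cmd HOp HTest :=
  .seq (.block [.nconst 7 1, .nconst 20 D, .nmul 3 20 1, .nconst 20 r, .nadd 3 3 20, .nadd 2 3 7,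
    .nconst 20 h₁, .nmul 4 20 1, .nadd 4 4 7, .nconst 14 1, .nadd 15 14 7, .nconst 5 0,
    .rofnat 4 7, .rsub 3 4 4, .nconst 20 (2 ^ κ), .rofnat 10 20, .rdiv 10 4 10, .radd 0 4 3])
  (.seq (.loop (.nle 15 2) (.block [.nadd 14 14 14, .nadd 15 14 7, .nadd 5 5 7]))
  (.seq (.block [.nmul 6 5 5, .nmul 15 6 7])
  (.seq (.loop (.nle 7 15) (.block [.rmul 0 0 10, .nmonus 15 15 7]))
    (.block [.rmul 1 0 0, .rmul 2 1 1]))))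

/-- The state of the registers during the setup. -/
structure SetupInv (D r κ h₁ : ℕ) (s₀ s : St) : Prop where
  arr : s.arr = s₀.arr
  cap : s.cap = s₀.cap
  n : s.nr 1 = s₀.nr 1
  N : s.nr 2 = D * s₀.nr 1 + r + 1
  N₁ : s.nr 3 = D * s₀.nr 1 + r
  h : s.nr 4 = h₁ * s₀.nr 1 + 1
  one : s.nr 7 = 1
  rzero : s.rr 3 = 0
  rone : s.rr 4 = 1
  base : s.rr 10 = ((2 : ℝ) ^ κ)⁻¹

/-- The logarithm is found by doubling until the power of two reaches `N`, and the tiny number `th`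
by `ell²` multiplications, so the setup takes polylogarithmic time. -/
theorem setupCmd_sure (D r κ h₁ : ℕ) (s : St) :
    (setupCmd D r κ h₁).Sure hl s (Nat.clog 2 (D * s.nr 1 + r + 1) * 4 +
      Nat.clog 2 (D * s.nr 1 + r + 1) * Nat.clog 2 (D * s.nr 1 + r + 1) * 3 + 24)
      (fun s' => (Dat.ofInput D r κ h₁ (s.nr 1) (s.arr 0)).Ctx s' ∧ s'.cap = s.cap) := by
  set N := D * s.nr 1 + r + 1 with hN
  set ell := Nat.clog 2 N with hell
  let I₁ : ℕ → St → Prop := fun k s' => SetupInv D r κ h₁ s s' ∧ k ≤ ell ∧ s'.nr 5 = ell - k ∧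
    s'.nr 14 = 2 ^ (ell - k) ∧ s'.nr 15 = s'.nr 14 + 1 ∧ s'.rr 0 = 1
  let I₂ : ℕ → St → Prop := fun k s' => SetupInv D r κ h₁ s s' ∧ k ≤ ell * ell ∧ s'.nr 5 = ell ∧
    s'.nr 6 = ell * ell ∧ s'.nr 15 = k ∧
    s'.rr 0 = (((2 : ℝ) ^ κ)⁻¹) ^ (ell * ell - k)
  refine (Cmd.Sure.seq (T₁ := 18) (I₁ := I₁ ell) ?_ fun s₁ h₁' =>
    Cmd.Sure.seq (T₁ := ell * 4 + 1) (I₁ := I₁ 0) ?_ fun s₂ h₂ =>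
    Cmd.Sure.seq (T₁ := 2) (I₁ := I₂ (ell * ell)) ?_ fun s₃ h₃ =>
    Cmd.Sure.seq (T₁ := ell * ell * 3 + 1) (T₂ := 2) (I₁ := I₂ 0) ?_ fun s₄ h₄ => ?_).mono
    (by lia) fun _ h => h
  · refine HOp.block_sure _ (by simp) (by simp) ⟨?_, le_rfl, ?_, ?_, ?_, ?_⟩
    · constructor <;> simp [Machine.exec, hl, HOp.ev, St.setN, St.setR]
    all_goals simp [Machine.exec, hl, HOp.ev, St.setN, St.setR]
  · refine Cmd.Sure.loop (T := 3) I₁ ?_ ?_ ?_ ell s₁ h₁'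
    · rintro k s' ⟨g1, g2, g3, g4, g5, g6⟩
      simp only [hl, g5, g4, g1.N]
      rw [Nat.succ_le_iff, ← hN, ← Nat.lt_clog_iff_pow_lt (by norm_num), ← hell]
      lia
    · rintro k s' ⟨g1, g2, g3, g4, g5, g6⟩
      refine HOp.block_sure _ (by simp) (by simp) ⟨?_, by lia, ?_, ?_, ?_, g6⟩
      · obtain ⟨i1, i2, i3, i4, i5, i6, i7, i8, i9, i10⟩ := g1
        constructor <;> simpa [Machine.exec, hl, HOp.ev, St.setN, St.setR]
      · simp [Machine.exec, hl, HOp.ev, St.setN, g1.one, g3]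
        lia
      · simp [Machine.exec, hl, HOp.ev, St.setN, g4]
        rw [← two_mul, ← pow_succ']
        congr 1
        lia
      · simp [Machine.exec, hl, HOp.ev, St.setN, g1.one]
    · rintro s' ⟨g1, g2, g3, g4, g5, g6⟩
      simp only [hl, g5, g4, g1.N]
      rw [Nat.succ_le_iff, ← hN, ← Nat.lt_clog_iff_pow_lt (by norm_num), ← hell]
      lia
  · obtain ⟨g1, g2, g3, g4, g5, g6⟩ := h₂
    refine HOp.block_sure _ (by simp) (by simp) ⟨?_, le_rfl, ?_, ?_, ?_, ?_⟩
    · obtain ⟨i1, i2, i3, i4, i5, i6, i7, i8, i9, i10⟩ := g1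
      constructor <;> simpa [Machine.exec, hl, HOp.ev, St.setN, St.setR]
    · simp [Machine.exec, hl, HOp.ev, St.setN, g3]
    · simp [Machine.exec, hl, HOp.ev, St.setN, g3]
    · simp [Machine.exec, hl, HOp.ev, St.setN, g3, g1.one]
    · simp [Machine.exec, hl, HOp.ev, St.setN, g6]
  · refine Cmd.Sure.loop (T := 2) I₂ ?_ ?_ ?_ _ s₃ h₃
    · rintro k s' ⟨g1, g2, g3, g4, g5, g6⟩
      simp only [hl, g5, g1.one]
      lia
    · rintro k s' ⟨g1, g2, g3, g4, g5, g6⟩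
      refine HOp.block_sure _ (by simp) (by simp) ⟨?_, by lia, ?_, ?_, ?_, ?_⟩
      · obtain ⟨i1, i2, i3, i4, i5, i6, i7, i8, i9, i10⟩ := g1
        constructor <;> simpa [Machine.exec, hl, HOp.ev, St.setN, St.setR]
      · simp [Machine.exec, hl, HOp.ev, St.setN, St.setR, g3]
      · simp [Machine.exec, hl, HOp.ev, St.setN, St.setR, g4]
      · simp [Machine.exec, hl, HOp.ev, St.setN, St.setR, g5, g1.one]
      · simp only [Machine.exec, hl, HOp.ev, St.setN, St.setR, Function.update_self, g6, g1.base]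
        rw [← pow_succ]
        congr 1
        lia
    · rintro s' ⟨g1, g2, g3, g4, g5, g6⟩
      simp [hl, g5, g1.one]
  · obtain ⟨g1, g2, g3, g4, g5, g6⟩ := h₄
    rw [Nat.sub_zero] at g6
    obtain ⟨i1, i2, i3, i4, i5, i6, i7, i8, i9, i10⟩ := g1
    refine HOp.block_sure _ (by simp) (by simp) ⟨?_, ?_⟩
    · have e1 : (Dat.ofInput D r κ h₁ (s.nr 1) (s.arr 0)).ell = ell := rfl
      have e2 : (Dat.ofInput D r κ h₁ (s.nr 1) (s.arr 0)).th = s₄.rr 0 := g6.symm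
      constructor
      · simpa [Machine.exec, hl, HOp.ev, St.setR]
      · simpa [Machine.exec, hl, HOp.ev, St.setR]
      · simpa [Machine.exec, hl, HOp.ev, St.setR]
      · simpa [Machine.exec, hl, HOp.ev, St.setR]
      · simpa [Machine.exec, hl, HOp.ev, St.setR]
      · simpa [Machine.exec, hl, HOp.ev, St.setR]
      · simpa [Machine.exec, hl, HOp.ev, St.setR]
      · simp [Machine.exec, hl, HOp.ev, St.setR, e2]
      · simp [Machine.exec, hl, HOp.ev, St.setR, e2]
      · simp [Machine.exec, hl, HOp.ev, St.setR, e2]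
      · simpa [Machine.exec, hl, HOp.ev, St.setR]
      · simpa [Machine.exec, hl, HOp.ev, St.setR]
      · simp [Machine.exec, hl, HOp.ev, St.setR, Dat.ofInput, i1]
    · simpa [Machine.exec, hl, HOp.ev, St.setR]

/-! ## Distributing the input over the memory -/

/-- Straight-line code of the real RAM. -/
theorem Op.block_sure {l : List Op} (M : Memory) {I : Memory → Prop} {T : ℕ} (hT : l.length ≤ T)
    (hl' : ∀ a ∈ l, (∀ r, a ≠ .gauss r) ∧ (∀ r, a ≠ .unif r))
    (hI : I (ram.exec l M)) : (Cmd.block l : Cmd Op Test).Sure ram M T I := by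
  have hp : ∀ (l : List Op) M, ram.pres l M := by
    intro l
    induction l with
    | nil => exact fun _ => trivial
    | cons a l ih => exact fun M => ⟨trivial, ih _⟩
  refine (Cmd.Sure.block (fun a ha => ?_) (hp l M)).mono hT ?_
  · intro x y s
    have := hl' a ha
    cases a <;> first | rfl | simp at this
  · rintro s' rfl
    exact hI

/-- The computation of the addresses. -/
def layoutCmd (D r : ℕ) : Cmd Op Test :=
  .block [.natMul 27 0 1, .natConst 20 50, .natAdd 26 27 20, .natConst 20 D, .natMul 23 20 1,
    .natConst 20 (r + 1), .natAdd 23 23 20, .natMul 24 23 23, .natMul 24 24 23, .natConst 20 3,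
    .natAdd 41 24 20, .natConst 25 0, .natAdd 42 26 25, .natAdd 43 26 7, .natAdd 44 43 7,
    .realStore 26 0]

/-- One step of the distribution of the input. -/
def spreadStep : Cmd Op Test :=
  .block [.natAdd 25 25 7, .natAdd 26 26 41, .realLoad 0 25, .realStore 26 0, .natSub 27 27 7]

/-- The state of the memory after the distribution of `j + 1` entries of the input `x`. -/
structure SpreadInv (W base n : ℕ) (x : ℕ → ℝ) (cnt j : ℕ) (M : Memory) : Prop where
  n : M.nat 1 = n
  one : M.nat 7 = 1
  width : M.nat 41 = W
  zone : ∀ z : Fin 3, M.nat (42 + z) = base + z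
  idx : M.nat 25 = j
  pos : M.nat 26 = base + W * j
  cnt : M.nat 27 = cnt
  nat : ∀ a, 50 ≤ a → M.nat a = 0
  src : ∀ i, 1 ≤ i → i < base → M.real i = x i
  dst : ∀ k z, z < W → M.real (base + W * k + z) = if z = 0 ∧ k ≤ j then x k else 0

theorem SpreadInv.step {W base n : ℕ} {x : ℕ → ℝ} {cnt j : ℕ} {M : Memory}
    (h : SpreadInv W base n x (cnt + 1) j M) (hj : j + 1 < base) (hb : 1 ≤ base) (hW : 0 < W) :
    spreadStep.Sure ram M 5 (SpreadInv W base n x cnt (j + 1)) := by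
  obtain ⟨h1, h2, h3, h4, h5, h6, h7, h8, h9, h10⟩ := h
  refine Op.block_sure _ (by simp) (by simp) ⟨?_, ?_, ?_, ?_, ?_, ?_, ?_, ?_, ?_, ?_⟩
  · simp [Machine.exec, ram, Op.eval, h1]
  · simp [Machine.exec, ram, Op.eval, h2]
  · simp [Machine.exec, ram, Op.eval, h3]
  · intro z
    have e1 : 42 + z.val ≠ 25 := by lia
    have e2 : 42 + z.val ≠ 26 := by lia
    have e3 : 42 + z.val ≠ 27 := by lia
    simp [Machine.exec, ram, Op.eval, h4, Function.update_of_ne, e1, e2, e3]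
  · simp [Machine.exec, ram, Op.eval, h5, h2]
  · simp [Machine.exec, ram, Op.eval, h6, h3, mul_add, add_assoc]
  · simp [Machine.exec, ram, Op.eval, h7, h2]
  · intro a ha
    have e1 : a ≠ 25 := by lia
    have e2 : a ≠ 26 := by lia
    have e3 : a ≠ 27 := by lia
    simp [Machine.exec, ram, Op.eval, h8 a ha, Function.update_of_ne, e1, e2, e3]
  · intro i hi hi'
    have e1 : i ≠ 0 := by lia
    have e2 : i ≠ base + W * j + W := by lia
    simp [Machine.exec, ram, Op.eval, h6, h3, h9 i hi hi', Function.update_of_ne, e1, e2]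
  · intro k z hz
    have e1 : base + W * k + z ≠ 0 := by lia
    have e2 : base + W * j + W = base + W * (j + 1) + 0 := by ring
    have e3 := h9 (j + 1) (by lia) hj
    simp [Machine.exec, ram, Op.eval, h6, h3, h5, h2, e3]
    rw [e2, Function.update_apply, Function.update_of_ne e1, h10 k z hz]
    by_cases hk : k = j + 1 ∧ z = 0
    · obtain ⟨rfl, rfl⟩ := hk
      simp
    · have e4 : base + W * k + z ≠ base + W * (j + 1) + 0 := fun e =>
        hk (zone_injective hz hW e)
      rw [if_neg e4]
      have : (z = 0 ∧ k ≤ j) ↔ (z = 0 ∧ k ≤ j + 1) := by lia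
      simp only [this]

/-- The zones start at `m * n + 50`, behind the input, so spreading the input never overwrites an
entry not yet read. Cell `0` of the real memory serves as transfer register; its entry is therefore
moved first, already here. -/
theorem layoutCmd_sure {D r m n : ℕ} {x : ℕ → ℝ} {M : Memory} (hx : ∀ i, m * n ≤ i → x i = 0)
    (hM : M = ⟨Function.update (dims m n) 7 1, x⟩) :
    (layoutCmd D r).Sure ram M 16 (SpreadInv ((D * n + r + 1) ^ 3 + 3) (m * n + 50) n x (m * n) 0)
    := by
  subst hM
  have d0 : dims m n 0 = m := rfl
  have d1 : dims m n 1 = n := rfl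
  refine Op.block_sure _ (by simp) (by simp) ⟨?_, ?_, ?_, ?_, ?_, ?_, ?_, ?_, ?_, ?_⟩
  · simp [Machine.exec, ram, Op.eval, d1]
  · simp [Machine.exec, ram, Op.eval]
  · simp [Machine.exec, ram, Op.eval, d1]
    ring
  · intro z
    fin_cases z <;> simp [Machine.exec, ram, Op.eval, d0, d1]
  · simp [Machine.exec, ram, Op.eval]
  · simp [Machine.exec, ram, Op.eval, d0, d1]
  · simp [Machine.exec, ram, Op.eval, d0, d1]
  · intro a ha
    have e (b : ℕ) (hb : b < 50) : a ≠ b := by lia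
    simp [Machine.exec, ram, Op.eval, Function.update_of_ne, e, dims]
  · intro i hi hi'
    have e : i ≠ m * n + 50 := by lia
    simp [Machine.exec, ram, Op.eval, Function.update_of_ne, e, d0, d1]
  · intro k z hz
    simp [Machine.exec, ram, Op.eval, d0, d1]
    by_cases hk : k = 0 ∧ z = 0
    · obtain ⟨rfl, rfl⟩ := hk
      simp
    · rw [if_neg (by tauto), Function.update_of_ne, hx _ (by lia)]
      intro e
      exact hk (zone_injective (base := m * n + 50) (k' := 0) (z' := 0) hz (by lia) (by lia))

/-- Initialization of the state of the register machine. -/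
def loadCmd (D r : ℕ) : Cmd Op Test := .seq (layoutCmd D r) (.loop (.natLe 7 27) spreadStep)

theorem loadCmd_sure {D r m n : ℕ} {x : ℕ → ℝ} {M : Memory} (hx : ∀ i, m * n ≤ i → x i = 0)
    (hM : M = ⟨Function.update (dims m n) 7 1, x⟩) :
    (loadCmd D r).Sure ram M (m * n * 6 + 17) (fun M' => ∃ s : St,
      Rep ((D * n + r + 1) ^ 3 + 3) (m * n + 50) 2 s M' ∧ s.nr 1 = n ∧ s.arr 0 = x ∧
        s.cap = (D * n + r + 1) ^ 3) := by
  set W := (D * n + r + 1) ^ 3 + 3 with hW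
  refine (Cmd.Sure.seq (T₂ := m * n * 6 + 1) (I₁ := SpreadInv W (m * n + 50) n x (m * n) 0)
    (layoutCmd_sure hx hM) fun M₁ h₁ => ?_).mono (by lia) fun _ h => h
  refine (Cmd.Sure.loop (T := 5) (fun k M' => k ≤ m * n ∧
    SpreadInv W (m * n + 50) n x k (m * n - k) M') ?_ ?_ ?_ (m * n) M₁
    ⟨le_rfl, by rwa [Nat.sub_self]⟩).mono le_rfl ?_
  · rintro k M' ⟨hk, h⟩
    simp only [ram, Test.holds, h.one, h.cnt]
    lia
  · rintro k M' ⟨hk, h⟩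
    refine (h.step (by lia) (by lia) (by lia)).mono le_rfl fun M'' h' => ⟨by lia, ?_⟩
    rwa [show m * n - (k + 1) + 1 = m * n - k by lia] at h'
  · rintro M' ⟨hk, h⟩
    simp [ram, Test.holds, h.one, h.cnt]
  · rintro M' ⟨-, h⟩
    rw [Nat.sub_zero] at h
    have hnat (k z : ℕ) : M'.nat (m * n + 50 + W * k + z) = 0 := h.nat _ (by lia)
    refine ⟨⟨fun a => M'.nat a, fun a => M'.real a, fun z => if z = 0 then x else fun _ => 0,
      fun _ => 0, (D * n + r + 1) ^ 3⟩, ⟨h.width, fun z => ?_, fun _ => rfl, fun _ => rfl,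
      fun z k => ?_, fun k => hnat k 2, fun z k h1 h2 => ⟨?_, hnat k z⟩, by lia, le_rfl,
      by dsimp only; lia⟩, h.n, rfl, rfl⟩
    · rw [h.zone]
      fin_cases z <;> rfl
    · have hz : zoneOf 2 z = z := by fin_cases z <;> rfl
      rw [hz, h.dst k z (by lia)]
      by_cases hz0 : z = 0
      · subst hz0
        simp only [Fin.val_zero, true_and, if_true]
        split_ifs with hk
        · rfl
        · exact (hx k (by lia)).symm
      · have : z.val ≠ 0 := fun e => hz0 (Fin.ext e)
        simp [this, hz0]
    · rw [h.dst k z h2, if_neg (by lia)]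

/-! ## The rank finding program -/

/-- The rank finding program. -/
def rankProgram (P : Program) (D r κ h₁ : ℕ) : Program :=
  (Cmd.seq (loadCmd D r) (Cmd.seq (setupCmd D r κ h₁) (searchCmd P)).toRam).toProgram
    (.natConst 7 1)

/-- The running time of the rank finding program. -/
def rankTime (P : Program) (D r m n T : ℕ) : ℕ :=
  m * n * 6 + 18 + 3 * (Nat.clog 2 (D * n + r + 1) * 4 +
      Nat.clog 2 (D * n + r + 1) * Nat.clog 2 (D * n + r + 1) * 3 + 24 +
      searchTime P (Nat.clog 2 (D * n + r + 1)) (D * n + r + 1) T)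

theorem rankProgram_spec {P : Program} {T : ℕ → ℕ} {err ε : ℕ → ℝ} {D r κ h₁ m n : ℕ}
    {A : Matrix (Fin m) (Fin n) ℝ} {d : Dat} (hd : d = Dat.ofInput D r κ h₁ n (rowMajor A))
    (hP : (approxLinearSearchSquareFullRank ε).SolvedBy err P T)
    (hε : ε d.N + d.th ≤ 1) (herr : err d.N ≤ 1 / 3) {k : ℕ} (hk : k < d.h) (hk' : k < 2 ^ d.ell)
    {δ δ' : ℝ≥0∞}
    (hdet : ∀ q, d.h ≤ k + q → q ≤ d.h → d.prob (fun w => (d.mat (d.h + q) w).det = 0) = 0)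
    (hacc : ∀ q, k + q < d.h → d.prob (fun w => ∃ x, d.Accept (d.h + q) w x) ≤ δ)
    (h1 : ENNReal.ofReal (1 / 3) ^ (d.ell * d.ell) ≤ δ') (h2 : (d.ell * d.ell : ℕ) * δ ≤ δ') :
    (∀ ξ, ((rankProgram P D r κ h₁).run ⟨dims m n, rowMajor A⟩ ξ
      (rankTime P D r m n (T d.N))).pc = none) ∧
    tapeLaw {ξ | ¬ ((rankProgram P D r κ h₁).run ⟨dims m n, rowMajor A⟩ ξ
      (rankTime P D r m n (T d.N))).mem.nat 0 = k} ≤ d.ell * δ' := by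
  refine Cmd.Spec.toProgram (I := fun _ => True) (G := fun M => M.nat 0 = k) ?_ ?_
  · have hx : ∀ i, m * n ≤ i → rowMajor A i = 0 := fun i hi => dif_neg (by lia)
    refine Cmd.Spec.mono (Cmd.Sure.seq_spec (T₁ := 1)
      (Cmd.Sure.op trivial fun _ => rfl : Cmd.Sure ram _ _ _ (fun M =>
        M = ⟨Function.update (dims m n) 7 1, rowMajor A⟩)) fun M hM =>
      Cmd.Sure.seq_spec (loadCmd_sure hx hM) (T₂ := 3 * (Nat.clog 2 (D * n + r + 1) * 4 +
        Nat.clog 2 (D * n + r + 1) * Nat.clog 2 (D * n + r + 1) * 3 + 24 +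
        searchTime P (Nat.clog 2 (D * n + r + 1)) (D * n + r + 1) (T d.N))) ?_) ?_
      (fun _ h => h) (fun _ _ h => h) le_rfl
    · rintro M₁ ⟨s, hs, hn, harr, hcap⟩
      have hset := setupCmd_sure D r κ h₁ s
      rw [hn, harr, ← hd] at hset
      refine Cmd.Spec.toRam (I := fun _ => True) (Cmd.Sure.seq_spec hset fun s' h' => ?_) hs
        fun s' idx' M' hM' hg => (hM'.nr 0).trans hg
      have hell : d.ell = Nat.clog 2 (D * n + r + 1) := by rw [hd]; rfl
      have hN : d.N = D * n + r + 1 := by rw [hd]; rfl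
      rw [← hell, ← hN]
      refine searchCmd_spec hP h'.1 ?_ ?_ hε herr hk hk' hdet hacc h1 h2
      · rw [h'.2, hcap]
        -- There are `ell` rounds of `ell²` trials, each consuming one fresh memory, and `N ^ 3` of
        -- them are available.
        have : d.ell ≤ D * n + r + 1 := by
          rw [hell]
          exact Nat.clog_le_of_le_pow Nat.lt_two_pow_self.le
        calc d.ell * (d.ell * d.ell) ≤ (D * n + r + 1) * ((D * n + r + 1) * (D * n + r + 1)) := by
              gcongr
          _ = _ := by ring
      · rw [hd]
        simp only [Dat.ofInput]
        positivity
    · unfold rankTime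
      lia
  · have h : Measurable fun M : Memory => M.nat 0 :=
      (measurable_pi_apply 0).comp (measurable_memory_iff.1 measurable_id).1
    exact measurableSet_eq_fun h measurable_const

/-! ## Zeros of polynomials at random points -/

theorem pi_prod_succAbove {n : ℕ} (k : Fin (n + 1)) (S : Set (Fin (n + 1) → ℝ)) :
    Measure.pi (fun _ => unifLaw) S = (unifLaw.prod (Measure.pi fun _ : Fin n => unifLaw))
      {z | k.insertNth (α := fun _ => ℝ) z.1 z.2 ∈ S} := by
  have hmp := measurePreserving_piFinSuccAbove (fun _ : Fin (n + 1) => unifLaw) k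
  rw [← hmp.measure_preimage_equiv]
  congr 1
  ext v
  simp only [Set.mem_ofPred_eq, Set.mem_preimage]
  rw [iff_comm]
  exact Eq.to_iff (congrArg (· ∈ S) (Fin.insertNth_self_removeNth k v))

theorem unifLaw_le (S : Set ℝ) : unifLaw S ≤ volume S := Measure.restrict_apply_le _ _

/-- If all the sections of `S` in the direction of a coordinate are small then so is `S`. -/
theorem pi_unifLaw_le_of_update {n : ℕ} (k : Fin n) {S : Set (Fin n → ℝ)} (hS : MeasurableSet S)
    {c : ℝ≥0∞} (h : ∀ v, volume {t | Function.update v k t ∈ S} ≤ c) :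
    Measure.pi (fun _ => unifLaw) S ≤ c := by
  obtain _ | n := n
  · exact k.elim0
  have hm : MeasurableSet {z : ℝ × (Fin n → ℝ) | k.insertNth (α := fun _ => ℝ) z.1 z.2 ∈ S} :=
    (MeasurableEquiv.piFinSuccAbove (fun _ : Fin (n + 1) => ℝ) k).symm.measurable hS
  rw [pi_prod_succAbove k, Measure.prod_apply_symm hm]
  refine (lintegral_mono (g := fun _ => c) fun v => ?_).trans (by simp)
  refine (unifLaw_le _).trans (le_trans (le_of_eq ?_) (h (k.insertNth (α := fun _ => ℝ) 0 v)))
  congr 1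
  ext t
  simp only [Set.mem_preimage, Set.mem_ofPred_eq, Fin.update_insertNth]

theorem measurable_eval_mvPolynomial {n : ℕ} (p : MvPolynomial (Fin n) ℝ) :
    Measurable fun v => MvPolynomial.eval v p := (MvPolynomial.continuous_eval p).measurable

/-- View `p` as a polynomial in the first variable. Some coefficient is a nonzero polynomial in the
others and by induction vanishes only on a null set; off that set the section is the finite set of
roots of a nonzero univariate polynomial. -/
theorem pi_zeros_mvPolynomial {n : ℕ} {p : MvPolynomial (Fin n) ℝ} (hp : p ≠ 0) :
    Measure.pi (fun _ => unifLaw) {v | MvPolynomial.eval v p = 0} = 0 := by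
  induction n with
  | zero =>
    have : {v | MvPolynomial.eval v p = 0} = ∅ := by
      ext v
      simp only [Set.mem_ofPred_eq, Set.mem_empty_iff_false, iff_false]
      rw [MvPolynomial.eq_C_of_isEmpty p] at hp ⊢
      simpa using hp
    rw [this, measure_empty]
  | succ n ih =>
    set q := MvPolynomial.finSuccEquiv ℝ n p with hq
    have hq0 : q ≠ 0 := by simpa [hq] using hp
    obtain ⟨i, hi⟩ : ∃ i, q.coeff i ≠ 0 := by
      by_contra! h
      exact hq0 (Polynomial.ext h)
    have hm : MeasurableSet {z : ℝ × (Fin n → ℝ) |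
        (0 : Fin (n + 1)).insertNth (α := fun _ => ℝ) z.1 z.2 ∈
          {v | MvPolynomial.eval v p = 0}} :=
      (MeasurableEquiv.piFinSuccAbove (fun _ : Fin (n + 1) => ℝ) 0).symm.measurable
        (measurableSet_eq_fun (measurable_eval_mvPolynomial p) measurable_const)
    rw [pi_prod_succAbove 0, Measure.prod_apply_symm hm, lintegral_eq_zero_iff'
      (measurable_measure_prodMk_right hm).aemeasurable]
    have hae : ∀ᵐ v ∂(Measure.pi fun _ : Fin n => unifLaw),
        MvPolynomial.eval v (q.coeff i) ≠ 0 := by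
      rw [ae_iff]
      simpa using ih hi
    filter_upwards [hae] with v hv
    refine le_antisymm ((unifLaw_le _).trans ?_) zero_le
    have hqv : q.map (MvPolynomial.eval v) ≠ 0 := fun h0 => hv (by
      have := congrArg (Polynomial.coeff · i) h0
      simpa using this)
    refine le_trans (measure_mono (t := ((q.map (MvPolynomial.eval v)).roots.toFinset : Set ℝ))
      fun t ht => ?_) (le_of_eq (Finset.measure_zero _ _))
    simp only [Set.mem_preimage, Set.mem_ofPred_eq, Fin.insertNth_zero'] at ht
    rw [MvPolynomial.eval_eq_eval_mv_eval'] at ht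
    simpa [hqv] using ht

/-! ## Closed relations with a compact fibre -/

/-- Projections of closed sets along a compact factor are closed. The universal condition fails
exactly on a countable union of such projections, one for each excess `1 / (n + 1)`. -/
theorem measurableSet_forall_le_of_compact {Y X : Type*} [TopologicalSpace Y] [CompactSpace Y]
    [TopologicalSpace X] [MeasurableSpace X] [BorelSpace X] {R : Set (Y × X)} (hR : IsClosed R)
    {φ : Y × X → ℝ} (hφ : Continuous φ) (c : ℝ) :
    MeasurableSet {x | (∃ y, (y, x) ∈ R) ∧ ∀ y, (y, x) ∈ R → φ (y, x) ≤ c} := by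
  have hproj : ∀ R : Set (Y × X), IsClosed R → MeasurableSet {x | ∃ y, (y, x) ∈ R} := by
    intro R hR
    have := (isClosedMap_snd_of_compactSpace (X := Y) (Y := X) R hR).measurableSet
    convert this using 1
    ext x
    simp
  have heq : {x | (∃ y, (y, x) ∈ R) ∧ ∀ y, (y, x) ∈ R → φ (y, x) ≤ c} =
      {x | ∃ y, (y, x) ∈ R} \
        ⋃ n : ℕ, {x | ∃ y, (y, x) ∈ R ∩ {z | c + 1 / ((n : ℝ) + 1) ≤ φ z}} := by
    ext x
    simp only [Set.mem_ofPred_eq, Set.mem_sdiff, Set.mem_iUnion, Set.mem_inter_iff]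
    refine and_congr_right fun _ => ?_
    constructor
    · rintro h ⟨n, y, hy, hn⟩
      have := h y hy
      have : 0 < 1 / ((n : ℝ) + 1) := by positivity
      linarith
    · intro h y hy
      by_contra! hlt
      obtain ⟨n, hn⟩ := exists_nat_one_div_lt (sub_pos.2 hlt)
      exact h ⟨n, y, hy, by linarith⟩
  rw [heq]
  exact (hproj R hR).diff (MeasurableSet.iUnion fun n => hproj _
    (hR.inter (isClosed_le continuous_const hφ)))

/-! ## Linear algebra -/

/-- A square matrix of rank at least `h - q` becomes invertible after a suitable change of rank
`q`. -/
theorem exists_sub_mul_injective {h q : ℕ} (M : Matrix (Fin h) (Fin h) ℝ) (hq : h ≤ M.rank + q) :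
    ∃ (U : Matrix (Fin h) (Fin q) ℝ) (V : Matrix (Fin q) (Fin h) ℝ),
      ∀ x, (M - U * V).mulVec x = 0 → x = 0 := by
  set f := M.mulVecLin with hf
  have hrank : M.rank = Module.finrank ℝ (LinearMap.range f) := rfl
  have hsum := LinearMap.finrank_range_add_finrank_ker f
  rw [Module.finrank_fin_fun] at hsum
  obtain ⟨R', hR'⟩ := Submodule.exists_isCompl (LinearMap.range f)
  have hsum' := Submodule.finrank_add_eq_of_isCompl hR'
  rw [Module.finrank_fin_fun] at hsum'
  let φ : LinearMap.ker f ≃ₗ[ℝ] R' := LinearEquiv.ofFinrankEq _ _ (by lia)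
  obtain ⟨π, hπ⟩ := (LinearMap.ker f).subtype.exists_leftInverse_of_injective
    (Submodule.ker_subtype _)
  obtain ⟨ι, hι⟩ := (finrank_le_iff_exists_linearMap (R := ℝ) (M := LinearMap.ker f)
    (M' := Fin q → ℝ)).1 (by rw [Module.finrank_fin_fun]; lia)
  obtain ⟨ρ, hρ⟩ := ι.exists_leftInverse_of_injective (LinearMap.ker_eq_bot.2 hι)
  -- `U V` is the map `φ ∘ π`, which projects onto the kernel of `f` and carries it isomorphically
  -- onto a complement `R'` of the range; it factors through `ℝ^q` since the kernel has dimension at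
  -- most `q`. If `f x = φ (π x)`, both sides lie in the range and in `R'`, so they vanish: `x` is
  -- in the kernel and `x = π x = 0`.
  refine ⟨LinearMap.toMatrix' (R'.subtype ∘ₗ φ.toLinearMap ∘ₗ ρ), LinearMap.toMatrix' (ι ∘ₗ π),
    fun x hx => ?_⟩
  rw [Matrix.sub_mulVec, ← Matrix.mulVec_mulVec, LinearMap.toMatrix'_mulVec,
    LinearMap.toMatrix'_mulVec, sub_eq_zero] at hx
  have hρι : ρ (ι (π x)) = π x := congrArg (fun g => g (π x)) hρ
  simp only [LinearMap.comp_apply, hρι] at hx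
  have h0 : f x ∈ LinearMap.range f ⊓ R' := by
    refine ⟨⟨x, rfl⟩, ?_⟩
    change M.mulVec x ∈ R'
    rw [hx]
    exact (φ (π x)).2
  rw [hR'.inf_eq_bot, Submodule.mem_bot] at h0
  have h1 : φ (π x) = 0 := by
    ext1
    exact hx.symm.trans h0
  have h2 : π x = 0 := φ.map_eq_zero_iff.1 h1
  have h3 : π x = ⟨x, h0⟩ := congrArg (fun g => g ⟨x, h0⟩) hπ
  rw [h2] at h3
  exact (congrArg Subtype.val h3).symm

/-- The matrix extended by zeros to an `h × h` matrix. -/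
def padded {m n : ℕ} (h : ℕ) (A : Matrix (Fin m) (Fin n) ℝ) : Matrix (Fin h) (Fin h) ℝ :=
  Matrix.of fun i j => if n ≤ j then 0 else rowMajor A (n * i + j)

theorem padded_apply {m n h : ℕ} (A : Matrix (Fin m) (Fin n) ℝ) (i j : Fin h) :
    padded h A i j = if hij : (i : ℕ) < m ∧ (j : ℕ) < n then A ⟨i, hij.1⟩ ⟨j, hij.2⟩ else 0 := by
  unfold padded
  rw [Matrix.of_apply]
  by_cases hj : n ≤ j
  · rw [if_pos hj, dif_neg (by lia)]
  · push Not at hj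
    rw [if_neg (by lia), rowMajor]
    by_cases hi : (i : ℕ) < m
    · have hlt : n * i + j < m * n := by nlinarith
      rw [dif_pos hlt, dif_pos ⟨hi, hj⟩]
      congr 1
      · ext
        simp [finProdFinEquiv, Fin.divNat, Nat.mul_add_div (show 0 < n by lia), Nat.div_eq_of_lt hj]
      · ext
        simp [finProdFinEquiv, Fin.modNat, Nat.mod_eq_of_lt hj]
    · have hlt : ¬ n * i + j < m * n := by nlinarith
      rw [dif_neg hlt, dif_neg (by lia)]

/-- The matrix of the inclusion, or of the projection, between coordinate spaces. -/
def inclusion (h m : ℕ) : Matrix (Fin h) (Fin m) ℝ :=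
  Matrix.of fun i j => if (i : ℕ) = j then 1 else 0

theorem inclusion_mul {h m k : ℕ} (A : Matrix (Fin m) (Fin k) ℝ) (i : Fin h) (j : Fin k) :
    (inclusion h m * A) i j = if hi : (i : ℕ) < m then A ⟨i, hi⟩ j else 0 := by
  rw [Matrix.mul_apply]
  split_ifs with hi
  · rw [Finset.sum_eq_single ⟨i, hi⟩]
    · simp [inclusion]
    · intro b _ hb
      have : (i : ℕ) ≠ b := fun e => hb (Fin.ext e.symm)
      simp [inclusion, this]
    · simp
  · refine Finset.sum_eq_zero fun b _ => ?_
    have : (i : ℕ) ≠ b := by lia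
    simp [inclusion, this]

theorem mul_inclusion {h m k : ℕ} (A : Matrix (Fin k) (Fin m) ℝ) (i : Fin k) (j : Fin h) :
    (A * inclusion m h) i j = if hj : (j : ℕ) < m then A i ⟨j, hj⟩ else 0 := by
  rw [Matrix.mul_apply]
  split_ifs with hj
  · rw [Finset.sum_eq_single ⟨j, hj⟩]
    · simp [inclusion]
    · intro b _ hb
      have : (b : ℕ) ≠ j := fun e => hb (Fin.ext e)
      simp [inclusion, this]
    · simp
  · refine Finset.sum_eq_zero fun b _ => ?_
    have : (b : ℕ) ≠ j := by lia
    simp [inclusion, this]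

/-- Each of the two matrices arises from the other by multiplication with inclusion matrices on both
sides. -/
theorem rank_padded {m n h : ℕ} (A : Matrix (Fin m) (Fin n) ℝ) (hm : m ≤ h) (hn : n ≤ h) :
    (padded h A).rank = A.rank := by
  have h1 : padded h A = inclusion h m * (A * inclusion n h) := by
    ext i j
    rw [padded_apply, inclusion_mul]
    by_cases hi : (i : ℕ) < m <;> by_cases hj : (j : ℕ) < n <;> simp [hi, hj, mul_inclusion]
  have h2 : A = inclusion m h * (padded h A * inclusion h n) := by
    ext i j
    rw [inclusion_mul, dif_pos (by lia), mul_inclusion, dif_pos (by lia), padded_apply,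
      dif_pos ⟨i.2, j.2⟩]
  apply le_antisymm
  · rw [h1]
    exact (Matrix.rank_mul_le_right _ _).trans (Matrix.rank_mul_le_left _ _)
  · conv_lhs => rw [h2]
    exact (Matrix.rank_mul_le_right _ _).trans (Matrix.rank_mul_le_left _ _)

/-! ## The random linear systems of large rank -/

/-- Extension of a finite list by zeros. -/
def extend {M : ℕ} (v : Fin M → ℝ) (k : ℕ) : ℝ := if h : k < M then v ⟨k, h⟩ else 0

theorem extend_restrict {M : ℕ} (w : ℕ → ℝ) {k : ℕ} (hk : k < M) :
    extend (fun i : Fin M => w i) k = w k := dif_pos hk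

namespace Dat

variable {d : Dat} {e : ℕ}

theorem flat_congr {w w' : ℕ → ℝ} {k : ℕ} (h : w k = w' k) : d.flat e w k = d.flat e w' k := by
  rw [flat, flat, h]

theorem flat_apply (w : ℕ → ℝ) (i : ℕ) {j : ℕ} (hj : j < d.N) :
    d.flat e w (d.N * i + j) = d.entry e (w (d.N * i + j)) i j := by
  rw [flat, Nat.mul_add_div (by lia), Nat.div_eq_of_lt hj, Nat.mul_add_mod, Nat.mod_eq_of_lt hj,
    add_zero]

theorem index_lt {i j : ℕ} (hi : i < d.N) (hj : j < d.N) : d.N * i + j < d.N * d.N := by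
  have : i + 1 ≤ d.N := hi
  nlinarith

theorem mat_extend (w : ℕ → ℝ) :
    d.mat e (extend fun i : Fin (d.N * d.N) => w i) = d.mat e w := by
  ext i j
  exact flat_congr (extend_restrict w (index_lt i.2 j.2))

theorem entry_affine (x : ℝ) (i j : ℕ) :
    d.entry e x i j = d.entry e 0 i j + x * (d.entry e 1 i j - d.entry e 0 i j) := by
  unfold entry
  split_ifs <;> simp

/-- The matrix of the linear system as a matrix of polynomials in the random entries. -/
def polyMat (d : Dat) (e : ℕ) :
    Matrix (Fin d.N) (Fin d.N) (MvPolynomial (Fin (d.N * d.N)) ℝ) :=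
  Matrix.of fun i j => MvPolynomial.C (d.entry e 0 i j) +
    MvPolynomial.X ⟨d.N * i + j, index_lt i.2 j.2⟩ *
      MvPolynomial.C (d.entry e 1 i j - d.entry e 0 i j)

theorem eval_det_polyMat (v : Fin (d.N * d.N) → ℝ) :
    MvPolynomial.eval v (d.polyMat e).det = (d.mat e (extend v)).det := by
  rw [RingHom.map_det]
  congr 1
  ext i j
  rw [RingHom.mapMatrix_apply, Matrix.map_apply, polyMat, Matrix.of_apply, mat, Matrix.of_apply,
    flat_apply _ _ j.2]
  simp [extend, index_lt i.2 j.2, ← entry_affine]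

/-- The determinant is a polynomial in the draws, and its value at `w₀` shows that it is not the
zero polynomial. -/
theorem prob_det_eq_zero {w₀ : ℕ → ℝ} (h : (d.mat e w₀).det ≠ 0) :
    d.prob (fun w => (d.mat e w).det = 0) = 0 := by
  have hp : (d.polyMat e).det ≠ 0 := by
    intro h0
    have := eval_det_polyMat (d := d) (e := e) fun i => w₀ i
    rw [h0, map_zero, mat_extend] at this
    exact h this.symm
  refine measure_mono_null ?_ (pi_zeros_mvPolynomial hp)
  rintro _ ⟨w, hw, rfl⟩
  rw [Set.mem_ofPred_eq, eval_det_polyMat, mat_extend]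
  exact hw

/-- The block of the linear system that contains the input. -/
def block (d : Dat) : Matrix (Fin d.h) (Fin d.h) ℝ :=
  Matrix.of fun i j => if d.n ≤ j then 0 else d.inp (d.n * i + j)

/-- The draws are chosen to contain the matrices `U`, `V` of `exists_sub_mul_injective` and zeros
elsewhere. For a kernel vector, the last row kills the last coordinate, the middle rows express the
middle coordinates through the first `h`, and substitution in the top rows leaves the Schur
complement `A - U V`, which is injective. -/
theorem exists_det_ne_zero {q : ℕ} (hth : d.th ≠ 0) (hN : 2 * d.h ≤ d.N₁) (hq : q ≤ d.h)
    (hrank : d.h ≤ d.block.rank + q) : ∃ w, (d.mat (d.h + q) w).det ≠ 0 := by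
  obtain ⟨U, V, hUV⟩ := exists_sub_mul_injective d.block hrank
  set f : ℕ → ℕ → ℝ := fun i j =>
    if hU : i < d.h ∧ d.h ≤ j ∧ j < d.h + q then U ⟨i, hU.1⟩ ⟨j - d.h, by lia⟩
    else if hV : j < d.h ∧ d.h ≤ i ∧ i < d.h + q then V ⟨i - d.h, by lia⟩ ⟨j, hV.1⟩ else 0 with hf
  set w : ℕ → ℝ := fun k => f (k / d.N) (k % d.N) with hw
  have hNN : d.N = d.N₁ + 1 := rfl
  have hwf (i j : ℕ) (hj : j < d.N) : w (d.N * i + j) = f i j := by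
    simp only [hw]
    rw [Nat.mul_add_div (by lia), Nat.div_eq_of_lt hj, Nat.mul_add_mod, Nat.mod_eq_of_lt hj,
      add_zero]
  refine ⟨w, fun hdet => ?_⟩
  obtain ⟨x, hx0, hx⟩ := Matrix.exists_mulVec_eq_zero_iff.2 hdet
  set y : ℕ → ℝ := extend x with hy
  have hyx (j : Fin d.N) : x j = y j := by rw [hy, extend, dif_pos j.2]
  have hrow (i : ℕ) (hi : i < d.N) :
      ∑ j ∈ Finset.range d.N, d.entry (d.h + q) (f i j) i j * y j = 0 := by
    have := congrFun hx ⟨i, hi⟩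
    rw [Matrix.mulVec, dotProduct] at this
    rw [← Fin.sum_univ_eq_sum_range (fun j => d.entry (d.h + q) (f i j) i j * y j)]
    refine Eq.trans ?_ this
    refine Finset.sum_congr rfl fun j _ => ?_
    rw [hyx, mat, Matrix.of_apply, flat_apply _ _ j.2, hwf _ _ j.2]
  have hlast : y d.N₁ = 0 := by
    have h1 := hrow d.N₁ (by lia)
    rw [Finset.sum_eq_single d.N₁] at h1
    · simpa [entry, hth] using h1
    · intro j hj hne
      rw [Finset.mem_range] at hj
      rw [entry, if_pos le_rfl, if_neg (by lia), zero_mul]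
    · simp [hNN]
  have hmid (i : ℕ) (hi : d.h ≤ i) (hi' : i < d.N₁) :
      y i = - ∑ j ∈ Finset.range d.h, f i j * y j := by
    have h1 := hrow i (by lia)
    have hsub : insert i (Finset.range d.h) ⊆ Finset.range d.N := by
      intro j
      simp only [Finset.mem_insert, Finset.mem_range]
      lia
    rw [← Finset.sum_subset hsub, Finset.sum_insert (by simpa using hi)] at h1
    · rw [entry, if_neg (by lia), if_neg (by lia), if_pos hi, if_pos hi, if_pos rfl, one_mul] at h1
      rw [eq_neg_iff_add_eq_zero, ← h1]
      congr 1
      refine Finset.sum_congr rfl fun j hj => ?_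
      rw [Finset.mem_range] at hj
      rw [entry, if_neg (by lia), if_neg (by lia), if_pos hi, if_neg (by lia)]
      split_ifs with he
      · simp only [hf]
        rw [dif_neg (by lia), dif_neg (by lia)]
      · rfl
    · intro j hj hj'
      simp only [Finset.mem_insert, Finset.mem_range, not_or, not_lt] at hj hj'
      rw [entry, if_neg (by lia)]
      by_cases hjN : d.N₁ ≤ j
      · rw [show j = d.N₁ by lia, hlast, mul_zero]
      · rw [if_neg hjN, if_pos hi, if_pos hj'.2, if_neg (by lia), zero_mul]
  have hfar (i : ℕ) (hi : d.h + q ≤ i) (hi' : i < d.N₁) : y i = 0 := by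
    rw [hmid i (by lia) hi', Finset.sum_eq_zero, neg_zero]
    intro j hj
    rw [Finset.mem_range] at hj
    simp only [hf]
    rw [dif_neg (by lia), dif_neg (by lia), zero_mul]
  have hq' (a : Fin q) : y (d.h + a) = - V.mulVec (fun j => y j) a := by
    rw [hmid _ (by lia) (by lia), Matrix.mulVec, dotProduct,
      ← Fin.sum_univ_eq_sum_range (fun j => f (d.h + a) j * y j)]
    congr 1
    refine Finset.sum_congr rfl fun j _ => ?_
    simp only [hf]
    rw [dif_neg (by lia), dif_pos (by lia)]
    simp
  have htop : (d.block - U * V).mulVec (fun j => y j) = 0 := by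
    ext i
    have h1 := hrow i (by lia)
    have hsplit : d.N = d.h + (q + (d.N - d.h - q)) := by lia
    rw [hsplit, Finset.sum_range_add, Finset.sum_range_add] at h1
    rw [Finset.sum_eq_zero (s := Finset.range (d.N - d.h - q)), add_zero] at h1
    · rw [Matrix.sub_mulVec, ← Matrix.mulVec_mulVec, Pi.sub_apply, Pi.zero_apply, ← h1,
        sub_eq_add_neg]
      congr 1
      · rw [Matrix.mulVec, dotProduct, ← Fin.sum_univ_eq_sum_range
          (fun j => d.entry (d.h + q) (f i j) i j * y j)]
        refine Finset.sum_congr rfl fun j _ => ?_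
        rw [entry, if_neg (by lia), if_neg (by lia), if_neg (by lia), if_neg (by lia)]
        rfl
      · rw [Matrix.mulVec, dotProduct, ← Finset.sum_neg_distrib, ← Fin.sum_univ_eq_sum_range
          (fun j => d.entry (d.h + q) (f i (d.h + j)) i (d.h + j) * y (d.h + j))]
        refine Finset.sum_congr rfl fun a _ => ?_
        rw [hq', entry, if_neg (by lia), if_neg (by lia), if_neg (by lia), if_pos (by lia),
          if_neg (by lia)]
        simp only [hf]
        rw [dif_pos (by lia)]
        simp
    · intro j hj
      rw [Finset.mem_range] at hj
      by_cases hjN : d.h + (q + j) = d.N₁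
      · rw [hjN, hlast, mul_zero]
      · rw [hfar _ (by lia) (by lia), mul_zero]
  have hzero := hUV _ htop
  have hlow (j : ℕ) (hj : j < d.h) : y j = 0 := congrFun hzero ⟨j, hj⟩
  refine hx0 (funext fun j => ?_)
  rw [hyx, Pi.zero_apply]
  by_cases h1 : (j : ℕ) < d.h
  · exact hlow _ h1
  by_cases h2 : (j : ℕ) = d.N₁
  · rw [h2, hlast]
  · rw [hmid _ (by lia) (by lia), Finset.sum_eq_zero, neg_zero]
    intro i hi
    rw [hlow i (Finset.mem_range.1 hi), mul_zero]

theorem prob_singular {q : ℕ} (hth : d.th ≠ 0) (hN : 2 * d.h ≤ d.N₁) (hq : q ≤ d.h)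
    (hrank : d.h ≤ d.block.rank + q) :
    d.prob (fun w => (d.mat (d.h + q) w).det = 0) = 0 := by
  obtain ⟨w, hw⟩ := exists_det_ne_zero hth hN hq hrank
  exact prob_det_eq_zero hw

/-! ## The random linear systems of small rank -/

/-- The vectors in the left kernel of the first rows of the linear system without its last
column. -/
def LeftKer (d : Dat) (e : ℕ) (w : ℕ → ℝ) (u : Fin d.h → ℝ) : Prop :=
  ∀ j < d.N₁, ∑ i : Fin d.h, u i * d.flat e w (d.N * i + j) = 0

/-- A dimension count: annihilating the input block imposes `rank` conditions on `u`, annihilating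
the `q` random columns imposes `q` more, and the remaining columns before the last are zero in these
rows. -/
theorem exists_leftKer {q : ℕ} (hN : 2 * d.h ≤ d.N₁) (hrank : d.block.rank + q < d.h)
    (w : ℕ → ℝ) : ∃ u ≠ 0, d.LeftKer (d.h + q) w u := by
  set f := d.block.transpose.mulVecLin with hf
  let g : (Fin d.h → ℝ) →ₗ[ℝ] (Fin q → ℝ) :=
    (Matrix.of fun (a : Fin q) (i : Fin d.h) => w (d.N * i + (d.h + a))).mulVecLin
  have hNN : d.N = d.N₁ + 1 := rfl
  have hlt : Module.finrank ℝ (LinearMap.range f × (Fin q → ℝ)) <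
      Module.finrank ℝ (Fin d.h → ℝ) := by
    rw [Module.finrank_prod, Module.finrank_fin_fun, Module.finrank_fin_fun]
    have : Module.finrank ℝ (LinearMap.range f) = d.block.rank := by
      rw [← Matrix.rank_transpose]
      rfl
    lia
  obtain ⟨u, hu, hu0⟩ := Submodule.exists_mem_ne_zero_of_ne_bot
    (LinearMap.ker_ne_bot_of_finrank_lt (f := f.rangeRestrict.prod g) hlt)
  rw [LinearMap.mem_ker] at hu
  have h1 : d.block.transpose.mulVec u = 0 := congrArg (fun z => (z.1 : Fin d.h → ℝ)) hu
  have h2 : g u = 0 := congrArg Prod.snd hu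
  refine ⟨u, hu0, fun j hj => ?_⟩
  by_cases hjh : j < d.h
  · refine Eq.trans ?_ (congrFun h1 ⟨j, hjh⟩)
    rw [Matrix.mulVec, dotProduct]
    refine Finset.sum_congr rfl fun i _ => ?_
    rw [flat_apply _ _ (by lia), entry, if_neg (by lia), if_neg (by lia), if_neg (by lia),
      if_neg (by lia), mul_comm]
    rfl
  · by_cases hjq : j < d.h + q
    · refine Eq.trans ?_ (congrFun h2 ⟨j - d.h, by lia⟩)
      refine Finset.sum_congr rfl fun i _ => ?_
      rw [flat_apply _ _ (by lia), entry, if_neg (by lia), if_neg (by lia), if_neg (by lia),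
        if_pos (by lia), if_neg (by lia), mul_comm]
      change _ = w (d.N * i + (d.h + (j - d.h))) * u i
      rw [show d.h + (j - d.h) = j by lia]
    · refine Finset.sum_eq_zero fun i _ => ?_
      rw [flat_apply _ _ (by lia), entry, if_neg (by lia), if_neg (by lia), if_neg (by lia),
        if_pos (by lia), if_pos (by lia), mul_zero]

/-- Pairing `u` with the first `h` rows of the product of the matrix and `x` leaves only `(u · g) *
x d.N₁`, where `g` is the last column. Each of these rows is at most `th²` in absolute value and `x
d.N₁ ≥ th`; dividing by `th` gives the bound. -/
theorem abs_le_of_accept {w x : ℕ → ℝ} (hth : 0 < d.th) (hN : d.h ≤ d.N₁) (h : d.Accept e w x)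
    {u : Fin d.h → ℝ} (hu : d.LeftKer e w u) (hu1 : ∀ i, |u i| ≤ 1) :
    |∑ i : Fin d.h, u i * w (d.N * i + d.N₁)| ≤ d.h * d.th := by
  obtain ⟨h1, h2⟩ := h
  have hNN : d.N = d.N₁ + 1 := rfl
  set row : ℕ → ℝ := fun i => ∑ j ∈ Finset.range d.N, d.flat e w (d.N * i + j) * x j with hrow
  have hle (i : Fin d.h) : |row i| ≤ d.th * d.th := by
    refine abs_le_of_sq_le_sq (le_trans ?_ (h1.trans (le_of_eq (sq _).symm))) (by positivity)
    exact Finset.single_le_sum (f := fun i => row i ^ 2) (fun i _ => sq_nonneg _)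
      (Finset.mem_range.2 (by lia))
  have hsum : ∑ i : Fin d.h, u i * row i =
      (∑ i : Fin d.h, u i * w (d.N * i + d.N₁)) * x d.N₁ := by
    have : ∀ i : Fin d.h, u i * row i = (∑ j ∈ Finset.range d.N₁,
        u i * d.flat e w (d.N * i + j) * x j) + u i * w (d.N * i + d.N₁) * x d.N₁ := by
      intro i
      simp only [hrow]
      rw [hNN, Finset.sum_range_succ, mul_add, Finset.mul_sum, ← hNN, flat_apply _ _ (by lia),
        entry, if_neg (by lia), if_pos le_rfl, mul_assoc]
      simp only [mul_assoc]
    rw [Finset.sum_congr rfl fun i _ => this i, Finset.sum_add_distrib, Finset.sum_comm,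
      Finset.sum_mul, add_eq_right]
    refine Finset.sum_eq_zero fun j hj => ?_
    rw [← Finset.sum_mul, hu j (Finset.mem_range.1 hj), zero_mul]
  have habs : |∑ i : Fin d.h, u i * row i| ≤ d.h * (d.th * d.th) := by
    refine (Finset.abs_sum_le_sum_abs _ _).trans ((Finset.sum_le_sum (g := fun _ => d.th * d.th)
      fun i _ => ?_).trans (by simp))
    rw [abs_mul]
    calc |u i| * |row i| ≤ 1 * (d.th * d.th) :=
          mul_le_mul (hu1 i) (hle i) (abs_nonneg _) zero_le_one
      _ = _ := one_mul _
  rw [hsum, abs_mul, abs_of_pos (hth.trans_le h2)] at habs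
  have : |∑ i : Fin d.h, u i * w (d.N * i + d.N₁)| * d.th ≤ (d.h * d.th) * d.th :=
    (mul_le_mul_of_nonneg_left h2 (abs_nonneg _)).trans (habs.trans (le_of_eq (by ring)))
  exact le_of_mul_le_mul_right this hth

theorem exists_normalized {h : ℕ} {u : Fin h → ℝ} (hu : u ≠ 0) :
    ∃ c : ℝ, ∃ i₀, c * u i₀ = 1 ∧ ∀ i, |c * u i| ≤ 1 := by
  obtain ⟨i₁, hi₁⟩ := Function.ne_iff.1 hu
  obtain ⟨i₀, -, hmax⟩ := Finset.exists_max_image Finset.univ (fun i => |u i|)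
    ⟨i₁, Finset.mem_univ _⟩
  have hpos : 0 < |u i₀| := (abs_pos.2 hi₁).trans_le (hmax i₁ (Finset.mem_univ _))
  refine ⟨(u i₀)⁻¹, i₀, inv_mul_cancel₀ (abs_pos.1 hpos), fun i => ?_⟩
  rw [abs_mul, abs_inv, inv_mul_le_iff₀ hpos, mul_one]
  exact hmax i (Finset.mem_univ _)

/-- The draws for which the normalized vectors in the left kernel are almost orthogonal to the last
column. -/
def Bad (d : Dat) (e : ℕ) (i₀ : Fin d.h) : Set (Fin (d.N * d.N) → ℝ) :=
  -- The bound is demanded of all normalized kernel vectors, not of one: any single vector can then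
  -- be used on an entire line of draws, and the set is measurable by
  -- `measurableSet_forall_le_of_compact`.
  {v | (∃ u : Set.Icc (-1 : Fin d.h → ℝ) 1, (u, v) ∈ {z : Set.Icc (-1 : Fin d.h → ℝ) 1 × _ |
      z.1.1 i₀ = 1 ∧ d.LeftKer e (extend z.2) z.1.1}) ∧
    ∀ u : Set.Icc (-1 : Fin d.h → ℝ) 1, (u, v) ∈ {z : Set.Icc (-1 : Fin d.h → ℝ) 1 × _ |
      z.1.1 i₀ = 1 ∧ d.LeftKer e (extend z.2) z.1.1} →
      |∑ i : Fin d.h, u.1 i * extend v (d.N * i + d.N₁)| ≤ d.h * d.th}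

theorem continuous_extend {M : ℕ} (k : ℕ) : Continuous fun v : Fin M → ℝ => extend v k := by
  unfold extend
  split_ifs with h
  · exact continuous_apply _
  · exact continuous_const

theorem measurableSet_bad (i₀ : Fin d.h) : MeasurableSet (d.Bad e i₀) := by
  refine measurableSet_forall_le_of_compact (Y := Set.Icc (-1 : Fin d.h → ℝ) 1)
    (X := Fin (d.N * d.N) → ℝ)
    (R := {z | z.1.1 i₀ = 1 ∧ d.LeftKer e (extend z.2) z.1.1}) ?_
    (φ := fun z => |∑ i : Fin d.h, z.1.1 i * extend z.2 (d.N * i + d.N₁)|) ?_ _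
  · have hu (i : Fin d.h) : Continuous
        fun z : Set.Icc (-1 : Fin d.h → ℝ) 1 × (Fin (d.N * d.N) → ℝ) => z.1.1 i :=
      (continuous_apply i).comp (continuous_subtype_val.comp continuous_fst)
    refine (isClosed_eq (hu i₀) continuous_const).inter ?_
    have heq : {z : Set.Icc (-1 : Fin d.h → ℝ) 1 × (Fin (d.N * d.N) → ℝ) |
        d.LeftKer e (extend z.2) z.1.1} = ⋂ j, ⋂ (_ : j < d.N₁),
          {z | ∑ i : Fin d.h, z.1.1 i * d.flat e (extend z.2) (d.N * i + j) = 0} := by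
      ext z
      simp [LeftKer]
    change IsClosed {z : Set.Icc (-1 : Fin d.h → ℝ) 1 × (Fin (d.N * d.N) → ℝ) |
      d.LeftKer e (extend z.2) z.1.1}
    rw [heq]
    refine isClosed_iInter fun j => isClosed_iInter fun _ => isClosed_eq ?_ continuous_const
    refine continuous_finsetSum _ fun i _ => (hu i).mul ?_
    simp only [flat]
    simp_rw [entry_affine (extend _ _)]
    exact continuous_const.add (((continuous_extend _).comp continuous_snd).mul continuous_const)
  · refine (continuous_finsetSum _ fun i _ => ?_).abs
    exact ((continuous_apply i).comp (continuous_subtype_val.comp continuous_fst)).mul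
      ((continuous_extend _).comp continuous_snd)

/-- Only the entry of the last column in row `i₀` is varied. The left kernel does not involve the
last column, so one vector `u` with `u i₀ = 1` works for all values `t` of this entry, and `|t + c|
≤ h * th` confines `t` to an interval of length `2 * (h * th)`. -/
theorem pi_bad_le (hN : d.h ≤ d.N₁) (i₀ : Fin d.h) :
    Measure.pi (fun _ => unifLaw) (d.Bad e i₀) ≤ ENNReal.ofReal (2 * (d.h * d.th)) := by
  have hNN : d.N = d.N₁ + 1 := rfl
  have hidx (i : Fin d.h) : d.N * i + d.N₁ < d.N * d.N := index_lt (by lia) (by lia)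
  refine pi_unifLaw_le_of_update ⟨_, hidx i₀⟩ (measurableSet_bad i₀) fun v => ?_
  by_cases hne : ∃ t₀, Function.update v ⟨_, hidx i₀⟩ t₀ ∈ d.Bad e i₀
  · obtain ⟨t₀, ⟨u, ⟨hu1, hu⟩⟩, -⟩ := hne
    set c := ∑ i ∈ Finset.univ.erase i₀, u.1 i * extend v (d.N * i + d.N₁) with hc
    refine (measure_mono (t := Set.Icc (-(d.h * d.th) - c) (d.h * d.th - c)) fun t ht => ?_).trans
      (le_of_eq (by rw [Real.volume_Icc]; congr 1; ring))
    have hext (t : ℝ) (k : ℕ) (hk : k ≠ d.N * i₀ + d.N₁) :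
        extend (Function.update v ⟨_, hidx i₀⟩ t) k = extend v k := by
      unfold extend
      split_ifs with h
      · exact Function.update_of_ne (fun e => hk (congrArg Fin.val e)) _ _
      · rfl
    have hmem : d.LeftKer e (extend (Function.update v ⟨_, hidx i₀⟩ t)) u.1 := by
      intro j hj
      rw [← hu j hj]
      refine Finset.sum_congr rfl fun i _ => ?_
      congr 1
      refine flat_congr ?_
      have : d.N * i + j ≠ d.N * i₀ + d.N₁ := by
        intro heq
        have := congrArg (· % d.N) heq
        simp only [Nat.mul_add_mod] at this
        rw [Nat.mod_eq_of_lt (by lia), Nat.mod_eq_of_lt (by lia)] at this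
        lia
      rw [hext _ _ this, hext _ _ this]
    have hle := ht.2 u ⟨hu1, hmem⟩
    rw [← Finset.add_sum_erase _ _ (Finset.mem_univ i₀), hu1, one_mul] at hle
    have h0 : extend (Function.update v ⟨_, hidx i₀⟩ t) (d.N * i₀ + d.N₁) = t := by
      rw [extend, dif_pos (hidx i₀), Function.update_self]
    have hc' : ∑ i ∈ Finset.univ.erase i₀,
        u.1 i * extend (Function.update v ⟨_, hidx i₀⟩ t) (d.N * i + d.N₁) = c := by
      refine Finset.sum_congr rfl fun i hi => ?_
      rw [hext]
      intro heq
      have : d.N * (i : ℕ) = d.N * i₀ := by lia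
      exact Finset.ne_of_mem_erase hi (Fin.ext (Nat.eq_of_mul_eq_mul_left (by lia) this))
    rw [h0, hc', abs_le] at hle
    exact ⟨by linarith [hle.1], by linarith [hle.2]⟩
  · refine le_trans (le_of_eq ?_) zero_le
    convert measure_empty (μ := volume)
    ext t
    simp only [Set.mem_ofPred_eq, Set.mem_empty_iff_false, iff_false]
    exact fun h => hne ⟨t, h⟩

/-- A kernel vector scaled to maximum norm `1` has some coordinate equal to `1`; the factor `d.h` is
the union bound over its position `i₀`. -/
theorem prob_accept_le {q : ℕ} (hth : 0 < d.th) (hN : 2 * d.h ≤ d.N₁)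
    (hrank : d.block.rank + q < d.h) :
    d.prob (fun w => ∃ x, d.Accept (d.h + q) w x) ≤
      d.h * ENNReal.ofReal (2 * (d.h * d.th)) := by
  have hNN : d.N = d.N₁ + 1 := rfl
  refine (measure_mono (t := ⋃ i₀, d.Bad (d.h + q) i₀) ?_).trans
    ((measure_iUnion_fintype_le _ _).trans ?_)
  · rintro _ ⟨w, ⟨x, hx⟩, rfl⟩
    obtain ⟨u, hu0, hu⟩ := exists_leftKer hN hrank w
    obtain ⟨c, i₀, hc1, hc⟩ := exists_normalized hu0
    have hflat (i : Fin d.h) (j : ℕ) (hj : j < d.N) :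
        extend (fun i : Fin (d.N * d.N) => w i) (d.N * i + j) = w (d.N * i + j) :=
      extend_restrict w (index_lt (by lia) hj)
    refine Set.mem_iUnion.2 ⟨i₀, ⟨⟨fun i => c * u i, fun i => (abs_le.1 (hc i)).1,
      fun i => (abs_le.1 (hc i)).2⟩, hc1, fun j hj => ?_⟩, ?_⟩
    · have := hu j hj
      rw [← mul_zero c, ← this, Finset.mul_sum]
      refine Finset.sum_congr rfl fun i _ => ?_
      rw [flat_congr (hflat i j (by lia)), mul_assoc]
    · rintro ⟨u', hu'⟩ ⟨-, hk⟩
      refine (abs_le_of_accept hth (by lia) hx (u := u') (fun j hj => ?_) fun i =>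
        abs_le.2 ⟨hu'.1 i, hu'.2 i⟩).trans' (le_of_eq ?_)
      · rw [← hk j hj]
        refine Finset.sum_congr rfl fun i _ => ?_
        rw [flat_congr (hflat i j (by lia))]
      · congr 1
        refine Finset.sum_congr rfl fun i _ => ?_
        rw [hflat i _ (by lia)]
  · refine (Finset.sum_le_sum fun i₀ _ => pi_bad_le (by lia) i₀).trans (le_of_eq ?_)
    simp

end Dat

/-! ## The error probability -/

theorem Program.run_of_halted {P : Program} {M : Memory} {ξ : Tape} {t t' : ℕ}
    (h : (P.run M ξ t).pc = none) (ht : t ≤ t') : P.run M ξ t' = P.run M ξ t := by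
  induction t', ht using Nat.le_induction with
  | base => rfl
  | succ t' _ ih => rw [Program.run, ih, P.step_of_halted _ h]

/-- The halting time may vary with the input, for rank finding through the number of rows; a halted
machine keeps its output until the uniform time bound. -/
theorem Problem.solvedBy_of_exists {Q : Problem} {err : ℕ → ℝ} {P : Program} {T' : ℕ → ℕ}
    (h : ∀ I : Q.Input, ∃ t ≤ T' (Q.size I),
      (∀ ξ : Tape, (P.run (Q.encode I) ξ t).pc = none) ∧
      (Q.Promise I → tapeLaw {ξ | ¬ Q.Correct I (P.run (Q.encode I) ξ t).mem} ≤
        ENNReal.ofReal (err (Q.size I)))) : Q.SolvedBy err P T' := by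
  intro I
  obtain ⟨t, ht, h1, h2⟩ := h I
  have (ξ : Tape) := Program.run_of_halted (h1 ξ) ht
  simp only [this]
  exact ⟨h1, h2⟩

theorem rpow_logb_le {n ell : ℕ} (hn : 2 * n ≤ 2 ^ ell) (hell : 1 ≤ ell) :
    (n : ℝ) ^ Real.logb 2 n ≤ 2 ^ ((ell - 1) * (ell - 1)) := by
  rcases Nat.eq_zero_or_pos n with rfl | hpos
  · simpa using one_le_pow₀ (by norm_num)
  have hle : (n : ℝ) ≤ (2 : ℝ) ^ (ell - 1) := by
    have : n ≤ 2 ^ (ell - 1) := by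
      obtain ⟨k, rfl⟩ : ∃ k, ell = k + 1 := ⟨ell - 1, by lia⟩
      rw [pow_succ] at hn
      rw [Nat.add_sub_cancel]
      lia
    exact_mod_cast this
  have h1 : (1 : ℝ) ≤ n := by exact_mod_cast hpos
  have hlog : Real.logb 2 n ≤ (ell - 1 : ℕ) := by
    rw [Real.logb_le_iff_le_rpow (by norm_num) (by linarith), Real.rpow_natCast]
    exact hle
  calc (n : ℝ) ^ Real.logb 2 n ≤ (n : ℝ) ^ ((ell - 1 : ℕ) : ℝ) :=
        Real.rpow_le_rpow_of_exponent_le h1 hlog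
    _ = (n : ℝ) ^ (ell - 1) := Real.rpow_natCast _ _
    _ ≤ ((2 : ℝ) ^ (ell - 1)) ^ (ell - 1) := by gcongr
    _ = _ := (pow_mul _ _ _).symm

/-- Since `log₂ n ≤ ell - 1`, the right-hand side is at least `2 ^ (-(ell - 1)²)`. The gap `ell² -
(ell - 1)² ≥ ell` between the exponents absorbs the factor `ell ≤ 2 ^ ell`. -/
theorem error_le {n ell : ℕ} (hn : 2 * n ≤ 2 ^ ell) (hell : 1 ≤ ell) :
    (ell : ℝ) * (1 / 3) ^ (ell * ell) ≤ 1 / (n : ℝ) ^ Real.logb 2 n := by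
  have hpos : 0 < (n : ℝ) ^ Real.logb 2 n := by
    rcases Nat.eq_zero_or_pos n with rfl | h
    · simp
    · exact Real.rpow_pos_of_pos (by exact_mod_cast h) _
  have h3 : (0 : ℝ) < 3 ^ (ell * ell) := by positivity
  rw [one_div_pow, mul_one_div, div_le_div_iff₀ h3 hpos, one_mul]
  have h2 : (ell : ℝ) ≤ 2 ^ ell := by exact_mod_cast Nat.lt_two_pow_self.le
  calc (ell : ℝ) * (n : ℝ) ^ Real.logb 2 n
      ≤ 2 ^ ell * 2 ^ ((ell - 1) * (ell - 1)) :=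
        mul_le_mul h2 (rpow_logb_le hn hell) hpos.le (by positivity)
    _ = 2 ^ (ell + (ell - 1) * (ell - 1)) := (pow_add _ _ _).symm
    _ ≤ 2 ^ (ell * ell) := by
        refine pow_le_pow_right₀ (by norm_num) ?_
        obtain ⟨k, rfl⟩ : ∃ k, ell = k + 1 := ⟨ell - 1, by lia⟩
        rw [Nat.add_sub_cancel]
        nlinarith
    _ ≤ 3 ^ (ell * ell) := by gcongr; norm_num

/-- Left is the error of `ell²` trials on a system of small rank. The factors before `th` are at
most `2 ^ (4 * ell + 1) ≤ 2 ^ (5 * ell²)`; with `κ ≥ 7` the product is at most `4 ^ (-ell²)`. -/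
theorem anticoncentration_le {h ell κ : ℕ} (hh : h ≤ 2 ^ ell) (hκ : 7 ≤ κ) (hell : 1 ≤ ell) :
    ((ell * ell : ℕ) : ℝ) * (h * (2 * (h * (((2 : ℝ) ^ κ)⁻¹) ^ (ell * ell)))) ≤
      (1 / 3) ^ (ell * ell) := by
  have h1 : (ell : ℝ) ≤ 2 ^ ell := by exact_mod_cast Nat.lt_two_pow_self.le
  have h2 : (h : ℝ) ≤ 2 ^ ell := by exact_mod_cast hh
  have hle : ((ell * ell : ℕ) : ℝ) * (h * (2 * h)) ≤ 2 ^ (5 * (ell * ell)) := by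
    calc ((ell * ell : ℕ) : ℝ) * (h * (2 * h)) = (ell * ell) * (h * (2 * h)) := by push_cast; ring
      _ ≤ (2 ^ ell * 2 ^ ell) * (2 ^ ell * (2 * 2 ^ ell)) := by gcongr
      _ = 2 ^ (4 * ell + 1) := by ring
      _ ≤ 2 ^ (5 * (ell * ell)) := pow_le_pow_right₀ (by norm_num) (by nlinarith)
  have hθ : (((2 : ℝ) ^ κ)⁻¹) ^ (ell * ell) ≤ ((2 : ℝ) ^ (7 * (ell * ell)))⁻¹ := by
    rw [inv_pow, ← pow_mul]
    gcongr
    norm_num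
  calc ((ell * ell : ℕ) : ℝ) * (h * (2 * (h * (((2 : ℝ) ^ κ)⁻¹) ^ (ell * ell))))
      = ((ell * ell : ℕ) : ℝ) * (h * (2 * h)) * (((2 : ℝ) ^ κ)⁻¹) ^ (ell * ell) := by ring
    _ ≤ 2 ^ (5 * (ell * ell)) * ((2 : ℝ) ^ (7 * (ell * ell)))⁻¹ := by gcongr
    _ = (1 / 4) ^ (ell * ell) := by
        rw [show 7 * (ell * ell) = 5 * (ell * ell) + 2 * (ell * ell) by ring, pow_add, mul_inv,
          ← mul_assoc, mul_inv_cancel₀ (by positivity), one_mul, pow_mul, ← inv_pow]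
        norm_num
    _ ≤ _ := by gcongr; norm_num

/-- Makes the accuracy `1 - 1 / N ^ c` sufficient for `Dat.accept_of_isApproxSolution`. -/
theorem threshold_le {N ell κ : ℕ} {c : ℝ} (hc : c ≤ κ) (hc0 : 0 ≤ c) (hN0 : 0 < N)
    (hN : N ≤ 2 ^ ell) : (((2 : ℝ) ^ κ)⁻¹) ^ (ell * ell) ≤ 1 / (N : ℝ) ^ c := by
  have h0 : (0 : ℝ) < N := by exact_mod_cast hN0
  rw [inv_pow, inv_eq_one_div]
  refine one_div_le_one_div_of_le (Real.rpow_pos_of_pos h0 _) ?_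
  have h1 : (N : ℝ) ≤ 2 ^ ell := by exact_mod_cast hN
  calc (N : ℝ) ^ c ≤ ((2 : ℝ) ^ ell) ^ c := Real.rpow_le_rpow h0.le h1 hc0
    _ ≤ ((2 : ℝ) ^ ell) ^ (κ : ℝ) :=
        Real.rpow_le_rpow_of_exponent_le (one_le_pow₀ (by norm_num)) hc
    _ = 2 ^ (ell * κ) := by rw [Real.rpow_natCast, ← pow_mul]
    _ ≤ 2 ^ (κ * (ell * ell)) := by
        refine pow_le_pow_right₀ (by norm_num) ?_
        rcases Nat.eq_zero_or_pos ell with rfl | h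
        · simp
        · nlinarith [Nat.zero_le κ, Nat.mul_le_mul_left (κ * ell) h]
    _ = _ := pow_mul _ _ _

/-- Rank finding by means of an algorithm for approximate linear search. -/
theorem rankFinding_solvedBy {P : Program} {T : ℕ → ℕ} {err : ℕ → ℝ} {c : ℝ} (hc : 0 ≤ c)
    (hP : (approxLinearSearchSquareFullRank fun n => 1 - 1 / (n : ℝ) ^ c).SolvedBy err P T)
    (C : ℕ) {r : ℕ} (hr : 2 ≤ r) (herr : ∀ n, r < n → err n ≤ 1 / 3) :
    ∃ P' : Program, (rankFinding C).SolvedBy (fun n => 1 / (n : ℝ) ^ Real.logb 2 n) P'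
      (fun n => rankTime P (2 * (C + 1)) r (C * n) n (T (2 * (C + 1) * n + r + 1))) := by
  obtain ⟨κ₀, hκ₀⟩ := exists_nat_ge c
  -- `κ ≥ c` serves `threshold_le`, and `κ ≥ 7` serves `anticoncentration_le`.
  set κ := max κ₀ 7 with hκ
  have hcκ : c ≤ κ := hκ₀.trans (by exact_mod_cast le_max_left _ _)
  refine ⟨rankProgram P (2 * (C + 1)) r κ (C + 1), Problem.solvedBy_of_exists ?_⟩
  rintro ⟨m, n, hmn, A⟩
  set d := Dat.ofInput (2 * (C + 1)) r κ (C + 1) n (rowMajor A) with hd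
  have hN : d.N = 2 * (C + 1) * n + r + 1 := rfl
  have hN₁ : d.N₁ = 2 * (C + 1) * n + r := rfl
  have hh : d.h = (C + 1) * n + 1 := rfl
  have hell : d.ell = Nat.clog 2 d.N := rfl
  have hth : d.th = (((2 : ℝ) ^ κ)⁻¹) ^ (d.ell * d.ell) := rfl
  have hth0 : 0 < d.th := by
    rw [hth]
    positivity
  have hpow : d.N ≤ 2 ^ d.ell := Nat.le_pow_clog (by norm_num) _
  have hell1 : 1 ≤ d.ell := Nat.clog_pos (by norm_num) (by lia)
  -- There must be room for `h` rows and up to `h` auxiliary unknowns; `r ≥ 2` pays for the two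
  -- summands `1` in `2 * h`.
  have h2h : 2 * d.h ≤ d.N₁ := by
    rw [hh, hN₁]
    ring_nf
    lia
  have hhN : d.h ≤ d.N := by lia
  have hnh : n < d.h := by
    rw [hh]
    nlinarith
  have hmh : m ≤ d.h := by
    rw [hh]
    nlinarith
  have hrk : A.rank ≤ n := by
    simpa using A.rank_le_width
  have hblock : d.block.rank = A.rank := rank_padded A hmh hnh.le
  have spec := rankProgram_spec (k := A.rank) (δ := d.h * ENNReal.ofReal (2 * (d.h * d.th)))
    (δ' := ENNReal.ofReal (1 / 3) ^ (d.ell * d.ell)) hd hP ?_ (herr _ (by lia)) (by lia) (by lia)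
    (fun q hq hq' => Dat.prob_singular hth0.ne' h2h hq' (by lia))
    (fun q hq => Dat.prob_accept_le hth0 h2h (by lia)) le_rfl ?_
  · refine ⟨_, ?_, spec.1, fun _ => spec.2.trans ?_⟩
    · change rankTime P (2 * (C + 1)) r m n (T d.N) ≤ rankTime P (2 * (C + 1)) r (C * n) n (T d.N)
      unfold rankTime
      gcongr
    · have h2n : 2 * n ≤ 2 ^ d.ell := by
        refine le_trans ?_ hpow
        rw [hN]
        nlinarith
      rw [← ENNReal.ofReal_pow (by norm_num), ← ENNReal.ofReal_natCast,
        ← ENNReal.ofReal_mul (by positivity)]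
      exact ENNReal.ofReal_le_ofReal (error_le h2n hell1)
  · have := threshold_le hcκ hc (show 0 < d.N by lia) hpow
    rw [← hth] at this
    linarith
  · rw [← ENNReal.ofReal_natCast, ← ENNReal.ofReal_natCast, ← ENNReal.ofReal_mul (by positivity),
      ← ENNReal.ofReal_mul (by positivity), ← ENNReal.ofReal_pow (by norm_num), hth]
    exact ENNReal.ofReal_le_ofReal
      (anticoncentration_le (hhN.trans hpow) (le_max_right _ _) hell1)

/-! ## Reading the input takes quadratic time -/

/-- Assignment to a cell of the real memory. -/
def Memory.put (M : Memory) (a : ℕ) (v : ℝ) : Memory := ⟨M.nat, Function.update M.real a v⟩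

/-- The cells of the real memory which an instruction reads or writes. -/
def Op.cells (N : ℕ → ℕ) : Op → List ℕ
  | .realOfNat a _ => [a]
  | .realAdd a b c => [a, b, c]
  | .realSub a b c => [a, b, c]
  | .realMul a b c => [a, b, c]
  | .realDiv a b c => [a, b, c]
  | .realLoad a b => [a, N b]
  | .realStore a b => [N a, b]
  | .gauss a => [a]
  | .unif a => [a]
  | _ => []

/-- The cells of the real memory which an instruction reads or writes. -/
def Instr.cells {Label : Type} (N : ℕ → ℕ) : Instr Label → List ℕ
  | .exec o _ => o.cells N
  | .branch (.realLe a b) _ _ => [a, b]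
  | .branch (.natLe _ _) _ _ => []

/-- The cells of the real memory which a program reads or writes in its next step. -/
def Program.cells (P : Program) (s : Config P.Label) : List ℕ :=
  match s.pc with
  | none => []
  | some l => (P.code l).cells s.mem.nat

theorem Op.eval_put {o : Op} {ξ : ℝ × ℝ} {M : Memory} {a : ℕ} (v : ℝ) (h : a ∉ o.cells M.nat) :
    o.eval ξ (M.put a v) = (o.eval ξ M).put a v := by
  cases o <;> simp only [Op.cells, List.mem_cons, List.not_mem_nil, or_false, not_or] at h <;>
    simp only [Op.eval, Memory.put, Memory.mk.injEq, true_and] <;>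
    first
    | exact trivial
    | rw [Function.update_of_ne (Ne.symm h.2.1), Function.update_of_ne (Ne.symm h.2.2),
        Function.update_comm (Ne.symm h.1)]
    | rw [Function.update_of_ne (Ne.symm h.2), Function.update_comm (Ne.symm h.1)]
    | rw [Function.update_comm (Ne.symm h)]

theorem Program.step_put {P : Program} {x : ℝ × ℝ} {s : Config P.Label} {a : ℕ} (v : ℝ)
    (h : a ∉ P.cells s) :
    P.step x ⟨s.pc, s.mem.put a v⟩ = ⟨(P.step x s).pc, (P.step x s).mem.put a v⟩ := by
  obtain ⟨pc, M⟩ := s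
  cases pc with
  | none => rfl
  | some l =>
    simp only [Program.cells] at h
    simp only [Program.step]
    cases hl : P.code l with
    | exec o k =>
      rw [hl] at h
      simp only [Instr.cells] at h
      dsimp only
      rw [Op.eval_put v h]
    | branch t k k' =>
      rw [hl] at h
      cases t with
      | natLe b c => rfl
      | realLe b c =>
        simp only [Instr.cells, List.mem_cons, List.not_mem_nil, or_false, not_or] at h
        simp only [Test.holds, Memory.put, Function.update_of_ne (Ne.symm h.1),
          Function.update_of_ne (Ne.symm h.2)]
        by_cases hbc : M.real b ≤ M.real c <;> simp [hbc]

/-- A cell that is neither read nor written does not influence the run, so changing its initial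
content only changes that cell at the end. -/
theorem Program.run_put {P : Program} {M : Memory} {ξ : Tape} {a : ℕ} (v : ℝ) {t : ℕ}
    (h : ∀ u < t, a ∉ P.cells (P.run M ξ u)) :
    P.run (M.put a v) ξ t = ⟨(P.run M ξ t).pc, (P.run M ξ t).mem.put a v⟩ := by
  induction t with
  | zero => rfl
  | succ t ih =>
    rw [Program.run, ih fun u hu => h u (by lia), Program.step_put v (h t (by lia)), Program.run]

theorem Instr.length_cells_le {Label : Type} (N : ℕ → ℕ) (i : Instr Label) :
    (i.cells N).length ≤ 3 := by
  cases i with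
  | exec o k => cases o <;> simp [Instr.cells, Op.cells]
  | branch t k k' => cases t <;> simp [Instr.cells]

theorem Instr.measurableSet_cells {Label : Type} (i : Instr Label) (a : ℕ) :
    MeasurableSet {N : ℕ → ℕ | a ∈ i.cells N} := by
  have h1 (b : ℕ) : MeasurableSet {N : ℕ → ℕ | a = N b} :=
    measurableSet_eq_fun measurable_const (measurable_pi_apply b)
  have h2 (p : Prop) : MeasurableSet {_N : ℕ → ℕ | p} := MeasurableSet.const p
  cases i with
  | exec o k =>
    cases o <;> simp only [Instr.cells, Op.cells, List.mem_cons, List.not_mem_nil, or_false] <;>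
      first
      | exact h2 _
      | exact (h2 _).union (h1 _)
      | exact (h1 _).union (h2 _)
  | branch t k k' =>
    cases t <;> simp only [Instr.cells] <;> exact h2 _

theorem Program.length_cells_le (P : Program) (s : Config P.Label) : (P.cells s).length ≤ 3 := by
  unfold Program.cells
  split
  · simp
  · exact Instr.length_cells_le _ _

theorem Program.measurableSet_cells (P : Program) (M : Memory) (t a : ℕ) :
    MeasurableSet {ξ | a ∈ P.cells (P.run M ξ t)} := by
  have := P.finite_label
  obtain ⟨h1, h2⟩ := P.measurable_runFrom ⟨some P.start, M⟩ t
  have heq : {ξ | a ∈ P.cells (P.run M ξ t)} = ⋃ l, {ξ | (P.run M ξ t).pc = some l} ∩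
      {ξ | a ∈ (P.code l).cells (P.run M ξ t).mem.nat} := by
    ext ξ
    simp only [Set.mem_ofPred_eq, Set.mem_iUnion, Set.mem_inter_iff, Program.cells]
    cases (P.run M ξ t).pc with
    | none => simp
    | some l => simp
  rw [heq]
  simp only [P.run_eq_runFrom]
  exact MeasurableSet.iUnion fun l => (h1 (some l)).inter
    ((measurable_memory_iff.1 h2).1 (Instr.measurableSet_cells _ a))

theorem Program.sum_measure_cells_le (P : Program) (M : Memory) (t : ℕ) (F : Finset ℕ) :
    ∑ a ∈ F, tapeLaw {ξ | a ∈ P.cells (P.run M ξ t)} ≤ 3 := by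
  classical
  have h1 : ∀ a, tapeLaw {ξ | a ∈ P.cells (P.run M ξ t)} =
      ∫⁻ ξ, {ξ | a ∈ P.cells (P.run M ξ t)}.indicator 1 ξ ∂tapeLaw := fun a =>
    (lintegral_indicator_one (P.measurableSet_cells M t a)).symm
  simp only [h1]
  rw [← lintegral_finsetSum _ fun a _ => measurable_one.indicator (P.measurableSet_cells M t a)]
  refine (lintegral_mono (g := fun _ => 3) fun ξ => ?_).trans (by simp)
  simp only [Set.indicator_apply, Set.mem_ofPred_eq, Pi.one_apply]
  rw [← Finset.sum_filter, Finset.sum_const, nsmul_eq_mul, mul_one]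
  have h2 : (F.filter (· ∈ P.cells (P.run M ξ t))).card ≤ 3 := by
    refine le_trans (Finset.card_le_card (t := (P.cells (P.run M ξ t)).toFinset) fun a ha => ?_)
      ((List.toFinset_card_le _).trans (P.length_cells_le _))
    rw [List.mem_toFinset]
    exact (Finset.mem_filter.1 ha).2
  exact_mod_cast h2

/-- Among many cells there is one that a program is likely not to touch. -/
theorem Program.card_le_of_touched {P : Program} {M : Memory} {t : ℕ} {F : Finset ℕ}
    (h : ∀ a ∈ F, ENNReal.ofReal (1 / 3) ≤
      tapeLaw {ξ | ∃ u < t, a ∈ P.cells (P.run M ξ u)}) : F.card ≤ 9 * t := by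
  -- At most three real cells are touched per step, so the expected number of touched cells is at
  -- most `3 * t`, while each cell of `F` contributes at least `1 / 3`.
  have h1 : ∑ a ∈ F, tapeLaw {ξ | ∃ u < t, a ∈ P.cells (P.run M ξ u)} ≤ t * 3 := by
    calc ∑ a ∈ F, tapeLaw {ξ | ∃ u < t, a ∈ P.cells (P.run M ξ u)}
        ≤ ∑ a ∈ F, ∑ u ∈ Finset.range t, tapeLaw {ξ | a ∈ P.cells (P.run M ξ u)} := by
          refine Finset.sum_le_sum fun a _ => le_trans (measure_mono fun ξ hξ => ?_)
            (measure_biUnion_finset_le (Finset.range t)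
              fun u => {ξ | a ∈ P.cells (P.run M ξ u)})
          obtain ⟨u, hu, hξ⟩ := hξ
          exact Set.mem_biUnion (Finset.mem_coe.2 (Finset.mem_range.2 hu)) hξ
      _ = ∑ u ∈ Finset.range t, ∑ a ∈ F, tapeLaw {ξ | a ∈ P.cells (P.run M ξ u)} :=
          Finset.sum_comm
      _ ≤ ∑ u ∈ Finset.range t, 3 :=
          Finset.sum_le_sum fun u _ => P.sum_measure_cells_le M u F
      _ = t * 3 := by simp
  have h2 : (F.card : ℝ≥0∞) * ENNReal.ofReal (1 / 3) ≤ t * 3 := by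
    refine le_trans (le_of_eq ?_) ((Finset.sum_le_sum h).trans h1)
    rw [Finset.sum_const, nsmul_eq_mul]
  rw [← ENNReal.ofReal_natCast, ← ENNReal.ofReal_natCast t, ← ENNReal.ofReal_mul (by positivity),
    show (3 : ℝ≥0∞) = ENNReal.ofReal 3 by simp, ← ENNReal.ofReal_mul (by positivity),
    ENNReal.ofReal_le_ofReal_iff (by positivity)] at h2
  have h3 : (F.card : ℝ) ≤ 9 * t := by linarith
  exact_mod_cast h3

/-- The Laplacian of the complete graph with one entry changed. -/
def perturbed (n : ℕ) (i j : Fin n) (s : ℝ) : Matrix (Fin n) (Fin n) ℝ :=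
  Matrix.of fun k l => (if k = l then (n : ℝ) else 0) - 1 + if k = i ∧ l = j then s else 0

theorem perturbed_mulVec {n : ℕ} (i j : Fin n) (s : ℝ) (x : Fin n → ℝ) (k : Fin n) :
    (perturbed n i j s).mulVec x k = n * x k - ∑ l, x l + if k = i then s * x j else 0 := by
  rw [Matrix.mulVec, dotProduct]
  simp only [perturbed, Matrix.of_apply, add_mul, sub_mul, ite_mul, one_mul, zero_mul,
    Finset.sum_add_distrib, Finset.sum_sub_distrib, Finset.sum_ite_eq, Finset.mem_univ, if_true]
  congr 1
  by_cases hk : k = i <;> simp [hk]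

theorem sum_perturbed_mulVec {n : ℕ} (i j : Fin n) (s : ℝ) (x : Fin n → ℝ) :
    ∑ k, (perturbed n i j s).mulVec x k = s * x j := by
  simp only [perturbed_mulVec, Finset.sum_add_distrib, Finset.sum_sub_distrib, ← Finset.mul_sum]
  simp

/-- The columns of the Laplacian sum to zero, so for a kernel vector the sum of all rows reads `s *
x j = 0`. The remaining equations make `x` constant, hence zero. -/
theorem rank_perturbed {n : ℕ} (i j : Fin n) {s : ℝ} (hs : s ≠ 0) :
    (perturbed n i j s).rank = n := by
  refine (Matrix.rank_of_isUnit _ ?_).trans (Fintype.card_fin _)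
  rw [Matrix.isUnit_iff_isUnit_det, isUnit_iff_ne_zero]
  intro hdet
  obtain ⟨x, hx0, hx⟩ := Matrix.exists_mulVec_eq_zero_iff.2 hdet
  have hj : x j = 0 := by
    have := sum_perturbed_mulVec i j s x
    rw [hx] at this
    simpa [hs] using this.symm
  have hk (k : Fin n) : n * x k = ∑ l, x l := by
    have h := perturbed_mulVec i j s x k
    rw [hx, hj] at h
    simp at h
    linarith
  have hsum : ∑ l, x l = 0 := by rw [← hk j, hj, mul_zero]
  have hn : (n : ℝ) ≠ 0 := by exact_mod_cast (Fin.pos i).ne'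
  exact hx0 (funext fun k => by simpa [hsum, hn] using hk k)

theorem encodeSystem_perturbed {n : ℕ} (i j : Fin n) (s : ℝ) (b : Fin n → ℝ) :
    encodeSystem (perturbed n i j s) b =
      (encodeSystem (perturbed n i j 0) b).put (n * i + j) (perturbed n i j s i j) := by
  have hlt : n * i + j < n * n := by
    have : (i : ℕ) + 1 ≤ n := i.2
    nlinarith [j.2]
  have hn : 0 < n := Fin.pos i
  simp only [encodeSystem, Memory.put, Memory.mk.injEq, true_and]
  funext k
  by_cases hk : k = n * i + j
  · subst hk
    rw [Function.update_self, if_pos hlt, rowMajor, dif_pos hlt]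
    congr 1
    · ext
      simp [finProdFinEquiv, Fin.divNat, Nat.mul_add_div hn]
    · ext
      simp [finProdFinEquiv, Fin.modNat, Nat.mod_eq_of_lt j.2]
  · rw [Function.update_of_ne hk]
    split_ifs with h
    · rw [rowMajor, rowMajor, dif_pos h, dif_pos h]
      simp only [perturbed, Matrix.of_apply, ite_self]
      congr 1
      refine if_neg ?_
      rintro ⟨h1, h2⟩
      refine hk ?_
      have := congrArg finProdFinEquiv (Prod.ext h1 h2 :
        finProdFinEquiv.symm (⟨k, h⟩ : Fin (n * n)) = (i, j))
      rw [Equiv.apply_symm_apply] at this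
      have := congrArg Fin.val this
      simp only [finProdFinEquiv_apply_val] at this
      lia
    · rfl

/-- Better than the trivial solution means `‖y - 1‖² < n = ‖1‖²` for `y = A x`; expanding the square
gives `2 * ∑ yₖ > ∑ yₖ² ≥ 0`. -/
theorem sum_pos_of_isApproxSolution {n : ℕ} (hn : 0 < n) {ε : ℝ} (hε : ε < 1)
    {A : Matrix (Fin n) (Fin n) ℝ} {x : Fin n → ℝ} (h : IsApproxSolution ε A (fun _ => 1) x) :
    0 < ∑ k, A.mulVec x k := by
  unfold IsApproxSolution at h
  have hb : ‖WithLp.toLp 2 (fun _ : Fin n => (1 : ℝ))‖ ^ 2 = n := by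
    rw [EuclideanSpace.norm_sq_eq]
    simp
  have hpos : 0 < ‖WithLp.toLp 2 (fun _ : Fin n => (1 : ℝ))‖ := by
    have : (0 : ℝ) < n := by exact_mod_cast hn
    refine lt_of_le_of_ne (norm_nonneg _) fun h0 => ?_
    rw [← hb, ← h0] at this
    simp at this
  have hlt : ‖WithLp.toLp 2 (A.mulVec x - fun _ => 1)‖ ^ 2 < n := by
    rw [← hb]
    refine pow_lt_pow_left₀ (h.trans_lt ?_) (norm_nonneg _) two_ne_zero
    nlinarith
  rw [EuclideanSpace.norm_sq_eq] at hlt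
  simp only [Pi.sub_apply, Real.norm_eq_abs, sq_abs, sub_sq, mul_one, one_pow,
    Finset.sum_add_distrib, Finset.sum_sub_distrib, ← Finset.mul_sum] at hlt
  simp only [Finset.sum_const, Finset.card_univ, Fintype.card_fin, nsmul_eq_mul, mul_one] at hlt
  have : 0 ≤ ∑ k, A.mulVec x k ^ 2 := Finset.sum_nonneg fun _ _ => sq_nonneg _
  linarith

/-- Approximate linear search takes quadratic time. -/
theorem sq_sub_le_time {P : Program} {T : ℕ → ℕ} {err ε : ℕ → ℝ}
    (hP : (approxLinearSearchSquareFullRank ε).SolvedBy err P T) {n : ℕ} (hn : 0 < n)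
    (hε : ε n < 1) (herr : err n ≤ 1 / 3) : n * n - n ≤ 9 * T n := by
  -- Cells below `n` are left out because they also hold the output, which must be the same for both
  -- perturbations.
  have hcard : (Finset.Ico n (n * n)).card = n * n - n := Nat.card_Ico _ _
  rw [← hcard]
  set M := encodeSystem (perturbed n ⟨0, hn⟩ ⟨0, hn⟩ 0) (fun _ => 1) with hM
  refine Program.card_le_of_touched (P := P) (M := M) fun a ha => ?_
  rw [Finset.mem_Ico] at ha
  have hi : a / n < n := Nat.div_lt_of_lt_mul ha.2
  have hj : a % n < n := Nat.mod_lt _ hn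
  set i : Fin n := ⟨a / n, hi⟩ with hi'
  set j : Fin n := ⟨a % n, hj⟩ with hj'
  have hidx : n * i + j = a := Nat.div_add_mod a n
  have hzero : perturbed n i j 0 = perturbed n ⟨0, hn⟩ ⟨0, hn⟩ 0 := by
    ext k l
    simp [perturbed]
  have henc (s : ℝ) : encodeSystem (perturbed n i j s) (fun _ => 1) =
      M.put a (perturbed n i j s i j) := by
    rw [encodeSystem_perturbed, hzero, hidx]
  let bad (s : ℝ) : Set Tape := {ξ | ¬ IsApproxSolution (ε n) (perturbed n i j s) (fun _ => 1)
    fun k => (P.run (encodeSystem (perturbed n i j s) fun _ => 1) ξ (T n)).mem.real k}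
  have hbad (s : ℝ) (hs : s ≠ 0) : tapeLaw (bad s) ≤ ENNReal.ofReal (1 / 3) :=
    ((hP ⟨n, perturbed n i j s, fun _ => 1⟩).2 (rank_perturbed i j hs)).trans
      (ENNReal.ofReal_le_ofReal herr)
  set touch : Set Tape := {ξ | ∃ u < T n, a ∈ P.cells (P.run M ξ u)} with htouch
  -- If cell `a` stays untouched, the perturbations `s = 1` and `s = -1` of entry `(i, j)` produce
  -- the same output `x`, but correctness would require `s * x j > 0` for both. So on every tape the
  -- cell is touched or one of the two runs fails.
  have hcover : Set.univ ⊆ touch ∪ (bad 1 ∪ bad (-1)) := by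
    intro ξ _
    by_contra hξ
    simp only [Set.mem_union, not_or] at hξ
    obtain ⟨h1, h2, h3⟩ := hξ
    have hun : ∀ u < T n, a ∉ P.cells (P.run M ξ u) := fun u hu h => h1 ⟨u, hu, h⟩
    have hout (s : ℝ) : (fun k : Fin n => (P.run (encodeSystem (perturbed n i j s) fun _ => 1) ξ
        (T n)).mem.real k) = fun k : Fin n => (P.run M ξ (T n)).mem.real k := by
      funext k
      rw [henc, Program.run_put _ hun]
      exact Function.update_of_ne (by lia) _ _
    simp only [bad, Set.mem_ofPred_eq, not_not, hout] at h2 h3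
    have g2 := sum_pos_of_isApproxSolution hn hε h2
    have g3 := sum_pos_of_isApproxSolution hn hε h3
    rw [sum_perturbed_mulVec] at g2 g3
    linarith
  have hone : (1 : ℝ≥0∞) ≤ tapeLaw touch + (ENNReal.ofReal (1 / 3) + ENNReal.ofReal (1 / 3)) := by
    rw [← measure_univ (μ := tapeLaw)]
    refine (measure_mono hcover).trans ((measure_union_le _ _).trans ?_)
    gcongr
    refine (measure_union_le _ _).trans ?_
    exact add_le_add (hbad 1 one_ne_zero) (hbad (-1) (by norm_num))
  have hsplit : (1 : ℝ≥0∞) =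
      ENNReal.ofReal (1 / 3) + (ENNReal.ofReal (1 / 3) + ENNReal.ofReal (1 / 3)) := by
    rw [← ENNReal.ofReal_add (by norm_num) (by norm_num),
      ← ENNReal.ofReal_add (by norm_num) (by norm_num)]
    norm_num
  rw [hsplit] at hone
  exact (ENNReal.add_le_add_iff_right (by simp)).1 hone

/-! ## Hardness -/

/-- The binary search makes `ell` rounds of `ell²` trials, and one trial costs a constant times `N²
+ T`; everything else is of lower order. -/
theorem rankTime_le (P : Program) {C D r n T N : ℕ} (hD : 1 ≤ D) (hN : N = D * n + r + 1)
    (hN2 : 2 ≤ N) :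
    rankTime P D r (C * n) n T ≤ (6 * C + 6 * P.numLabels + 500) *
      (Nat.clog 2 N ^ 3 * (N * N + T)) := by
  unfold rankTime
  rw [← hN]
  have hL1 : 1 ≤ Nat.clog 2 N := Nat.clog_pos (by norm_num) (by lia)
  generalize Nat.clog 2 N = L at hL1 ⊢
  have hnN : n ≤ N := by nlinarith
  unfold searchTime testTime trialTime
  set Y := L ^ 3 * (N * N + T) with hY
  have hNN : 1 ≤ N * N + T := by nlinarith
  have h3 : L ^ 3 ≤ Y := Nat.le_mul_of_pos_right _ hNN
  have h2 : L ^ 2 ≤ Y := (Nat.pow_le_pow_right hL1 (by norm_num)).trans h3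
  have h1 : L ≤ Y := (Nat.le_self_pow (by norm_num) L).trans h3
  have h0 : 1 ≤ Y := hL1.trans h1
  have hX : N * N + T ≤ Y := Nat.le_mul_of_pos_left _ (by positivity)
  have hn2 : n * n ≤ Y := (Nat.mul_le_mul hnN hnN).trans (by lia)
  have hC : C * (n * n) ≤ C * Y := Nat.mul_le_mul_left _ hn2
  have hT : L ^ 3 * (N * N) + L ^ 3 * T = Y := by rw [hY, mul_add]
  have hTq : P.numLabels * (L ^ 3 * T) ≤ P.numLabels * Y := Nat.mul_le_mul_left _ (by lia)
  have hT' : L ^ 3 * T ≤ Y := by lia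
  have hN' : L ^ 3 * (N * N) ≤ Y := by lia
  nlinarith

theorem clog_le_log {N : ℕ} (hN : 2 ≤ N) : (Nat.clog 2 N : ℝ) ≤ 4 * Real.log N := by
  have hlog2 : Real.log 2 ≤ Real.log N := Real.log_le_log (by norm_num) (by exact_mod_cast hN)
  have h2 := Real.log_two_gt_d9
  have hlt : 2 ^ (Nat.clog 2 N).pred < N := Nat.pow_pred_clog_lt_self (by norm_num) (by lia)
  have hlt' : (2 : ℝ) ^ (Nat.clog 2 N).pred ≤ N := by exact_mod_cast hlt.le
  have hlog := Real.log_le_log (by positivity) hlt'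
  rw [Real.log_pow] at hlog
  have hcast : (Nat.clog 2 N : ℝ) = ((Nat.clog 2 N).pred : ℕ) + 1 := by
    have : 1 ≤ Nat.clog 2 N := Nat.clog_pos (by norm_num) hN
    have h : Nat.clog 2 N = (Nat.clog 2 N).pred + 1 := (Nat.succ_pred_eq_of_pos this).symm
    exact_mod_cast h
  have hnn : (0 : ℝ) ≤ ((Nat.clog 2 N).pred : ℕ) := Nat.cast_nonneg _
  rw [hcast]
  nlinarith

/-- The exponent may have either sign, hence `|a|`. -/
theorem rpow_affine_le {D r n : ℕ} (hD : 1 ≤ D) (hn : 1 ≤ n) (a : ℝ) :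
    ((D * n + r + 1 : ℕ) : ℝ) ^ a ≤ ((D + r + 1 : ℕ) : ℝ) ^ |a| * (n : ℝ) ^ a := by
  have hn0 : (0 : ℝ) < n := by exact_mod_cast hn
  have hle : (n : ℝ) ≤ (D * n + r + 1 : ℕ) := by
    have : n ≤ D * n + r + 1 := by nlinarith
    exact_mod_cast this
  have hle' : ((D * n + r + 1 : ℕ) : ℝ) ≤ (D + r + 1 : ℕ) * n := by
    have : D * n + r + 1 ≤ (D + r + 1) * n := by nlinarith
    exact_mod_cast this
  rcases le_total 0 a with ha | ha
  · rw [abs_of_nonneg ha, ← Real.mul_rpow (by positivity) hn0.le]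
    exact Real.rpow_le_rpow (by positivity) hle' ha
  · refine (Real.rpow_le_rpow_of_nonpos hn0 hle ha).trans ?_
    refine le_mul_of_one_le_left (by positivity) (Real.one_le_rpow ?_ (abs_nonneg _))
    exact_mod_cast Nat.le_add_left 1 _

/-- The bound for the sizes in one residue class. -/
theorem exists_bound_of_isTildeOmega {P : Program} {T : ℕ → ℕ} {C D r : ℕ} {a : ℝ} (hD : 1 ≤ D)
    (ha : a ≠ 0) (hT : ∀ N, r < N → N * N - N ≤ 9 * T N)
    (h : IsTildeOmega (fun n => (rankTime P D r (C * n) n (T (D * n + r + 1)) : ℝ))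
      fun n => (n : ℝ) ^ a) :
    ∃ (K : ℝ) (d n₀ : ℕ), 0 ≤ K ∧ ∀ n ≥ n₀, ((D * n + r + 1 : ℕ) : ℝ) ^ a ≤
      K * Real.log (D * n + r + 1 : ℕ) ^ d * T (D * n + r + 1) := by
  obtain ⟨d, h⟩ := h
  obtain ⟨c, hc⟩ := h.bound
  obtain ⟨n₁, hn₁⟩ := eventually_atTop.1 hc
  set K₀ : ℕ := 6 * C + 6 * P.numLabels + 500
  refine ⟨((D + r + 1 : ℕ) : ℝ) ^ |a| * (|a| ^ d * |c| * (K₀ * (4 ^ 3 * 19))), d + 3, max n₁ 2,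
    by positivity, fun n hn => ?_⟩
  have hn2 : 2 ≤ n := (le_max_right _ _).trans hn
  have hb := hn₁ n ((le_max_left _ _).trans hn)
  have hn0 : (0 : ℝ) < n := by exact_mod_cast (by lia : 0 < n)
  refine (rpow_affine_le hD (by lia) a).trans ?_
  generalize hN : D * n + r + 1 = N at hb ⊢
  have hnN : n ≤ N := by
    rw [← hN]
    nlinarith
  have hlogn : 0 < Real.log n := Real.log_pos (by exact_mod_cast (by lia : 1 < n))
  have hlog : Real.log n ≤ Real.log N := Real.log_le_log hn0 (by exact_mod_cast hnN)
  have hTN := hT N (by lia)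
  -- For `N ≥ 2` one has `N² ≤ 2 * (N² - N) ≤ 18 * T N`.
  have hTN' : N * N + T N ≤ 19 * T N := by
    have h1 : 2 * N ≤ N * N := by nlinarith
    lia
  have htime : (rankTime P D r (C * n) n (T N) : ℝ) ≤
      K₀ * (4 ^ 3 * 19) * (Real.log N ^ 3 * T N) := by
    have h1 : rankTime P D r (C * n) n (T N) ≤ K₀ * (Nat.clog 2 N ^ 3 * (19 * T N)) :=
      (rankTime_le P hD hN.symm (by lia)).trans (by gcongr)
    calc (rankTime P D r (C * n) n (T N) : ℝ) ≤ K₀ * ((Nat.clog 2 N : ℝ) ^ 3 * (19 * T N)) := by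
          exact_mod_cast h1
      _ ≤ K₀ * ((4 * Real.log N) ^ 3 * (19 * T N)) := by
          gcongr
          exact clog_le_log (by lia)
      _ = _ := by ring
  rw [Real.norm_eq_abs, Real.norm_eq_abs, Nat.abs_cast, abs_div, abs_pow,
    Real.log_rpow hn0, abs_mul, abs_of_pos hlogn, abs_of_pos (Real.rpow_pos_of_pos hn0 a)] at hb
  have hpos : 0 < (|a| * Real.log n) ^ d := by
    have := abs_pos.2 ha
    positivity
  rw [div_le_iff₀ hpos] at hb
  have hmain : (n : ℝ) ^ a ≤ |c| * (K₀ * (4 ^ 3 * 19) * (Real.log N ^ 3 * T N)) *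
      (|a| * Real.log N) ^ d := by
    refine hb.trans ?_
    gcongr
    exact le_abs_self c
  calc ((D + r + 1 : ℕ) : ℝ) ^ |a| * (n : ℝ) ^ a
      ≤ ((D + r + 1 : ℕ) : ℝ) ^ |a| * (|c| * (K₀ * (4 ^ 3 * 19) * (Real.log N ^ 3 * T N)) *
        (|a| * Real.log N) ^ d) := by gcongr
    _ = _ := by
      rw [mul_pow, pow_add]
      ring

/-- Combination of the bounds for all residue classes. -/
theorem isTildeOmega_of_residues {T : ℕ → ℕ} {D r₀ : ℕ} {a : ℝ} (hD : 1 ≤ D) (ha : a ≠ 0)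
    (h : ∀ i, ∃ (K : ℝ) (d n₀ : ℕ), 0 ≤ K ∧ ∀ n ≥ n₀, ((D * n + (r₀ + i) + 1 : ℕ) : ℝ) ^ a ≤
      K * Real.log (D * n + (r₀ + i) + 1 : ℕ) ^ d * T (D * n + (r₀ + i) + 1)) :
    IsTildeOmega (fun n => (T n : ℝ)) fun n => (n : ℝ) ^ a := by
  choose K d n₀ hK h using h
  -- Sums over the finitely many classes serve as common upper bounds for the constants.
  set Kt := ∑ i ∈ Finset.range D, K i
  set dt := ∑ i ∈ Finset.range D, d i
  set nt := ∑ i ∈ Finset.range D, n₀ i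
  refine ⟨dt, IsBigO.of_bound (Kt / |a| ^ dt) ?_⟩
  filter_upwards [eventually_ge_atTop (D * nt + r₀ + 4)] with N hN
  set i := (N - 1 - r₀) % D with hi
  set n := (N - 1 - r₀) / D with hn
  have hiD : i < D := Nat.mod_lt _ (by lia)
  have hdm : D * n + i = N - 1 - r₀ := Nat.div_add_mod _ _
  have hNeq : D * n + (r₀ + i) + 1 = N := by lia
  have hmem : i ∈ Finset.range D := Finset.mem_range.2 hiD
  have hnt : nt ≤ n := by
    rw [hn, Nat.le_div_iff_mul_le (by lia), mul_comm]
    lia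
  have hb := h i n ((Finset.single_le_sum (fun _ _ => Nat.zero_le _) hmem).trans hnt)
  rw [hNeq] at hb
  have hN0 : (0 : ℝ) < N := by exact_mod_cast (by lia : 0 < N)
  have hlog : 1 ≤ Real.log N := by
    rw [Real.le_log_iff_exp_le hN0]
    have h3 : (3 : ℝ) ≤ N := by exact_mod_cast (by lia : 3 ≤ N)
    linarith [Real.exp_one_lt_d9]
  have hb' : (N : ℝ) ^ a ≤ Kt * Real.log N ^ dt * T N := by
    refine hb.trans ?_
    have h1 : K i ≤ Kt := Finset.single_le_sum (fun i _ => hK i) hmem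
    have h2 : Real.log N ^ d i ≤ Real.log N ^ dt :=
      pow_le_pow_right₀ hlog (Finset.single_le_sum (fun _ _ => Nat.zero_le _) hmem)
    have h3 := (hK i).trans h1
    gcongr
  have hpos : 0 < (|a| * Real.log N) ^ dt := by
    have := abs_pos.2 ha
    positivity
  rw [Real.norm_eq_abs, Real.norm_eq_abs, Nat.abs_cast, abs_div, abs_pow,
    Real.log_rpow hN0, abs_mul, abs_of_pos (zero_lt_one.trans_le hlog),
    abs_of_pos (Real.rpow_pos_of_pos hN0 a), div_le_iff₀ hpos]
  refine hb'.trans (le_of_eq ?_)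
  have : |a| ^ dt ≠ 0 := pow_ne_zero _ (abs_ne_zero.2 ha)
  rw [mul_pow]
  field_simp

/-- For each class `i` the conjecture is applied to the rank program built with `r = max n₀ 2 + i`.
This offset keeps all systems so large that the error bound `1 / 3` is in force. -/
theorem tildeOmegaHard_square (hconj : RankFindingConjecture) {c : ℝ} (hc : 0 < c)
    {err : ℕ → ℝ} (herr : ∀ᶠ n in atTop, err n ≤ 1 / 3) :
    (approxLinearSearchSquareFullRank fun n => 1 - 1 / (n : ℝ) ^ c).TildeOmegaHard err
      fun n => (n : ℝ) ^ omega := by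
  intro P T hP
  obtain ⟨C, hconj⟩ := hconj
  obtain ⟨n₀, hn₀⟩ := eventually_atTop.1 herr
  have hsq : ∀ N, max n₀ 2 < N → N * N - N ≤ 9 * T N := fun N hN => by
    have hN0 : 0 < N := by lia
    refine sq_sub_le_time hP hN0 ?_ (hn₀ N ((le_max_left n₀ 2).trans hN.le))
    have : 0 < 1 / (N : ℝ) ^ c :=
      one_div_pos.2 (Real.rpow_pos_of_pos (by exact_mod_cast hN0) _)
    linarith
  -- If `omega = 0`, then `log (n ^ omega)` vanishes and no logarithmic factor may be divided out;
  -- the exponent `d = 0` and `T N ≥ 1` suffice.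
  by_cases ha : omega = 0
  · refine ⟨0, IsBigO.of_bound 1 ?_⟩
    filter_upwards [eventually_gt_atTop (max n₀ 2)] with N hN
    have h1 := hsq N hN
    have h2 : 2 * N ≤ N * N := Nat.mul_le_mul_right _ (by lia)
    have h3 : 1 ≤ T N := by lia
    simpa [ha] using h3
  refine isTildeOmega_of_residues (D := 2 * (C + 1)) (r₀ := max n₀ 2) (by lia) ha fun i => ?_
  have herr' : ∀ n, max n₀ 2 + i < n → err n ≤ 1 / 3 := fun n hn =>
    hn₀ n ((le_max_left n₀ 2).trans (by lia))
  obtain ⟨P', hP'⟩ := rankFinding_solvedBy hc.le hP C (r := max n₀ 2 + i)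
    ((le_max_right _ _).trans (Nat.le_add_right _ _)) herr'
  exact exists_bound_of_isTildeOmega (P := P) (C := C) (by lia) ha (fun N hN => hsq N (by lia))
    (hconj P' _ hP')

/-- A square matrix of full rank is surjective, so the system is satisfiable for every right-hand
side; size, encoding and correctness agree in the two problems. -/
theorem Problem.SolvedBy.square {C : ℕ} (hC : 1 ≤ C) {ε err : ℕ → ℝ} {P : Program} {T : ℕ → ℕ}
    (h : (approxLinearSearch C ε).SolvedBy err P T) :
    (approxLinearSearchSquareFullRank ε).SolvedBy err P T := by
  rintro ⟨n, A, b⟩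
  have := h ⟨⟨n, n, by nlinarith, A⟩, b⟩
  refine ⟨this.1, fun hrank => this.2 ?_⟩
  have htop : LinearMap.range A.mulVecLin = ⊤ :=
    Submodule.eq_top_of_finrank_eq (hrank.trans (Module.finrank_fin_fun ℝ).symm)
  exact LinearMap.range_eq_top.1 htop b

end RealRAM

end

theorem corollary4p2 (hconj : RealRAM.RankFindingConjecture) (c : ℝ) (hc : 0 < c)
    (err : ℕ → ℝ) (herr : ∀ᶠ n in Filter.atTop, err n ≤ 1 / 3) :
    (∀ C : ℕ, 1 ≤ C →
      (RealRAM.approxLinearSearch C (fun n => 1 - 1 / (n : ℝ) ^ c)).TildeOmegaHard err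
        (fun n => (n : ℝ) ^ RealRAM.omega)) ∧
    (RealRAM.approxLinearSearchSquareFullRank (fun n => 1 - 1 / (n : ℝ) ^ c)).TildeOmegaHard err
      (fun n => (n : ℝ) ^ RealRAM.omega) := by
  have hsquare := RealRAM.tildeOmegaHard_square hconj hc herr
  exact ⟨fun C hC P T hP => hsquare P T (hP.square hC), hsquare⟩
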